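/- Let $q_o>0$, $q_\pm\in\mathbb C$ with $|q_\pm|=q_o$, and let $\mathbf q(x,t)\in\mathbb C^3$ be a potential of the defocusing three-component VNLS problem with nonzero boundary conditions: at the time $t$ considered, $\mathbf q(\cdot,t)$ is continuous, $\mathbf q(x,t)\to\mathbf q_\pm=(0,0,q_\pm)^T$ as $x\to\pm\infty$, and $\mathbf q(\cdot,t)-\mathbf q_\pm$ is integrable near $\pm\infty$. Put $$k=\tfrac12\Big(z+\frac{q_o^2}{z}\Big),\quad \lambda=\tfrac12\Big(z-\frac{q_o^2}{z}\Big),\quad \gamma(z)=1-\frac{q_o^2}{z^2},\quad \hat z=\frac{q_o^2}{z^*},$$ $$\theta_1=-\lambda x+2k\lambda t,\qquad \theta_2=kx-(k^2+\lambda^2)t,\qquad \Theta=\mathrm{diag}(\theta_1,\theta_2,\theta_2,-\theta_1),$$ $J=\mathrm{diag}(1,-1,-1,-1)$, $Q=\begin{pmatrix}0&\mathbf q^\dagger\\ \mathbf q&0\end{pmatrix}$, $E_\pm=I-\frac iz JQ_\pm$. For real $z\ne0,\pm q_o$ let $\phi_\pm$ be the solutions of $\phi_x=(-ikJ+Q)\phi$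 with $\phi_\pm=E_\pm e^{i\Theta}+o(1)$ as $x\to\pm\infty$, and let $A(z)=(a_{ij}(z))$ be the scattering matrix, $\phi_-=\phi_+A$. Write $A_{\binom{i_1,\dots,i_p}{k_1,\dots,k_p}}$ for its minor with rows $i_1,\dots,i_p$ and columns $k_1,\dots,k_p$, and $A_{[i_1,\dots,i_p]}$ for the corresponding principal minor. The minors $A_{[1]},A_{[1,2]},A_{[1,2,3]}$ and the functions $\phi_{-,1}$, $\phi_{+,4}$, $$\chi_2^+=-a_{12}\phi_{-,1}+a_{11}\phi_{-,2},\qquad \chi_3^+=A_{\binom{1,2}{2,3}}\phi_{-,1}-A_{\binom{1,2}{1,3}}\phi_{-,2}+A_{[1,2]}\phi_{-,3}$$ are continued analytically to $\operatorname{Im}z>0$; the minors $A_{[4]},A_{[3,4]},A_{[2,3,4]}$ and the functions $\phi_{+,1}$, $\phi_{-,4}$, $$\chi_2^-=A_{[3,4]}\phi_{-,2}-A_{\binom{3,4}{2,4}}\phi_{-,3}+A_{\binom{3,4}{2,3}}\phi_{-,4},\qquad \chi_3^-=a_{44}\phi_{-,3}-a_{43}\phi_{-,4}$$ to $\operatorname{Im}z<0$.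 Assume that the analytic non-principal minors $A_{\binom{1,2}{1,3}}$, $A_{\binom{1,3}{1,2}}$, $A_{\binom{2,4}{3,4}}$, $A_{\binom{3,4}{2,4}}$ vanish identically. Let $z_n$ ($\operatorname{Im}z_n>0$) be an eigenvalue of type I: a simple zero of $A_{[1]}$ with $A_{[1,2]}(z_n)\ne0$ and $A_{[1,2,3]}(z_n)\neq0$; let $w_n$ ($\operatorname{Im}w_n>0$) be an eigenvalue of type IV: a simple zero of $A_{[1]}$ with $A_{[1,2]}(w_n)=0$ and $A_{[1,2,3]}(w_n)\ne0$. Then there are unique norming constants with, for all $x$, $$\phi_{-,1}(z_n)=\tfrac{d_n}{A_{[1,2]}(z_n)}\chi_2^+(z_n),\quad \chi_2^-(z_n^*)=\bar d_n\phi_{+,1}(z_n^*),\quad \phi_{-,4}(\hat z_n^*)=\check d_n\chi_2^-(\hat z_n^*),\quad \chi_2^+(\hat z_n)=\hat d_n\phi_{+,4}(\hat z_n),$$ $$\phi_{-,1}(w_n)=\tfrac{c_n}{A_{[1,2,3]}(w_n)}\chi_3^+(w_n),\quad \chi_3^-(w_n^*)=\bar c_n\phi_{+,1}(w_n^*),\quad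 \phi_{-,4}(\hat w_n^*)=\check c_n\chi_3^-(\hat w_n^*),\quad \chi_3^+(\hat w_n)=\hat c_n\phi_{+,4}(\hat w_n).$$ Set $$D_n=\tfrac{d_n}{A_{[1]}'(z_n)}e^{-i(\theta_1-\theta_2)(x,t,z_n)},\qquad \check D_n=\tfrac{\check d_nA_{[2,3,4]}(\hat z_n^*)}{A_{[4]}'(\hat z_n^*)}e^{-i(\theta_1-\theta_2)(x,t,z_n)},$$ $$\bar D_n=\tfrac{\bar d_n}{A_{[2,3,4]}'(z_n^*)}e^{i(\theta_1-\theta_2)(x,t,z_n^*)},\qquad \hat D_n=\tfrac{\hat d_n}{A_{[1,2]}'(\hat z_n)}e^{i(\theta_1-\theta_2)(x,t,z_n^*)},$$ $$C_n=\tfrac{c_n}{A_{[1]}'(w_n)}e^{-i(\theta_1-\theta_2)(x,t,w_n)},\qquad \check C_n=\tfrac{\check c_nA_{[3,4]}(\hat w_n^*)}{A_{[4]}'(\hat w_n^*)}e^{-i(\theta_1-\theta_2)(x,t,w_n)},$$ $$\bar C_n=\tfrac{\bar c_n}{A_{[3,4]}'(w_n^*)}e^{i(\theta_1-\theta_2)(x,t,w_n^*)},\qquad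 \hat C_n=\tfrac{\hat c_n}{A_{[1,2,3]}'(\hat w_n)}e^{i(\theta_1-\theta_2)(x,t,w_n^*)}.$$ Then, for all $x$, $$\check D_n=\frac{iq_+^*}{z_n}D_n,\qquad \bar D_n=\frac{D_n^*}{\gamma(z_n^*)},\qquad \hat D_n=\frac{iq_+}{z_n^*\gamma(\hat z_n)}D_n^*,$$ $$\check C_n=\frac{iq_+^*}{w_n}C_n,\qquad \bar C_n=\frac{C_n^*}{\gamma(w_n^*)},\qquad \hat C_n=\frac{iq_+}{w_n^*\gamma(\hat w_n)}C_n^*.$$ -/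

import Mathlib

open scoped ComplexConjugate

namespace VNLS

noncomputable section

/-- The data of the problem: the background amplitude `qo`, the boundary values `qm = q₋` and
`qp = q₊` of the third component, and the potential `q x t`, with values in `ℂ³`. -/
structure Potential where
  qo : ℝ
  qm : ℂ
  qp : ℂ
  q : ℝ → ℝ → Fin 3 → ℂ

/-- The boundary vector `(0, 0, c)`. -/
def bvec (c : ℂ) : Fin 3 → ℂ := ![0, 0, c]

/-- Nonzero boundary conditions at time `t`: `q(x,t) → (0,0,q_±)` as `x → ±∞`, where
`|q_±| = qo > 0`, with `q(·,t)` continuous and `q(·,t) - (0,0,q_±)` integrable near `±∞`. -/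
structure Potential.IsAdmissibleAt (P : Potential) (t : ℝ) : Prop where
  qo_pos : 0 < P.qo
  norm_qm : ‖P.qm‖ = P.qo
  norm_qp : ‖P.qp‖ = P.qo
  continuous_q : Continuous fun x => P.q x t
  tendsto_bot : Filter.Tendsto (fun x => P.q x t) Filter.atBot (nhds (bvec P.qm))
  tendsto_top : Filter.Tendsto (fun x => P.q x t) Filter.atTop (nhds (bvec P.qp))
  integrable_bot : MeasureTheory.IntegrableOn (fun x => P.q x t - bvec P.qm) (Set.Iic 0)
  integrable_top : MeasureTheory.IntegrableOn (fun x => P.q x t - bvec P.qp) (Set.Ici 0)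

/-! ### The scattering problem in the uniformization variable `z` -/

/-- `J = diag(1, -1, -1, -1)`. -/
def J : Matrix (Fin 4) (Fin 4) ℂ := Matrix.diagonal ![1, -1, -1, -1]

/-- `Q = (0, v†; v, 0)`. -/
def Q (v : Fin 3 → ℂ) : Matrix (Fin 4) (Fin 4) ℂ :=
  !![0, conj (v 0), conj (v 1), conj (v 2);
     v 0, 0, 0, 0;
     v 1, 0, 0, 0;
     v 2, 0, 0, 0]

namespace Potential

variable (P : Potential)

/-- `k = (z + qo² / z) / 2`. -/
def k (z : ℂ) : ℂ := (z + (P.qo : ℂ) ^ 2 / z) / 2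

/-- `λ = (z - qo² / z) / 2`. -/
def lam (z : ℂ) : ℂ := (z - (P.qo : ℂ) ^ 2 / z) / 2

/-- `γ(z) = 1 - qo² / z²`. -/
def gam (z : ℂ) : ℂ := 1 - (P.qo : ℂ) ^ 2 / z ^ 2

/-- `ẑ = qo² / z^*`. -/
def hat (z : ℂ) : ℂ := (P.qo : ℂ) ^ 2 / conj z

/-- `θ₁(x,t,z) = -λ x + 2 k λ t`. -/
def theta1 (x t : ℝ) (z : ℂ) : ℂ := -(P.lam z) * x + 2 * P.k z * P.lam z * t

/-- `θ₂(x,t,z) = k x - (k² + λ²) t`. -/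
def theta2 (x t : ℝ) (z : ℂ) : ℂ := P.k z * x - (P.k z ^ 2 + P.lam z ^ 2) * t

/-- `e^{iΘ(x,t,z)}` with `Θ = diag(θ₁, θ₂, θ₂, -θ₁)`. -/
def expTheta (x t : ℝ) (z : ℂ) : Matrix (Fin 4) (Fin 4) ℂ :=
  Matrix.diagonal
    ![Complex.exp (Complex.I * P.theta1 x t z), Complex.exp (Complex.I * P.theta2 x t z),
      Complex.exp (Complex.I * P.theta2 x t z), Complex.exp (-(Complex.I * P.theta1 x t z))]

/-- `X(x,t,z) = -i k J + Q(x,t)`. -/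
def X (x t : ℝ) (z : ℂ) : Matrix (Fin 4) (Fin 4) ℂ :=
  -(Complex.I * P.k z) • J + Q (P.q x t)

/-- The asymptotic eigenvector matrix `E(z) = I - (i/z) J Q_c` for the boundary vector
`(0, 0, c)`; its columns are eigenvectors of `-i k J + Q_c` for the eigenvalues
`-iλ, ik, ik, iλ`. -/
def E (c z : ℂ) : Matrix (Fin 4) (Fin 4) ℂ := 1 - (Complex.I / z) • (J * Q (bvec c))

/-- `Φ` is a matrix solution of `Φ_x = X Φ` at time `t` with `Φ = E(z) e^{iΘ(x,t,z)} + o(1)` as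
`x` tends to the end `l` of the line. -/
def IsJost (l : Filter ℝ) (c : ℂ) (t : ℝ) (z : ℂ) (Φ : ℝ → Matrix (Fin 4) (Fin 4) ℂ) : Prop :=
  (∀ x i j, HasDerivAt (fun y => Φ y i j) ((P.X x t z * Φ x) i j) x) ∧
  ∀ i j, Filter.Tendsto (fun x => Φ x i j - (E c z * P.expTheta x t z) i j) l (nhds 0)

/-- The Jost eigenfunctions `φ₋(x,t,s)` for real `s` (defined for `s ≠ 0, ±qo`). -/
def jostMinus (t s : ℝ) : ℝ → Matrix (Fin 4) (Fin 4) ℂ :=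
  Classical.epsilon (P.IsJost Filter.atBot P.qm t s)

/-- The Jost eigenfunctions `φ₊(x,t,s)` for real `s` (defined for `s ≠ 0, ±qo`). -/
def jostPlus (t s : ℝ) : ℝ → Matrix (Fin 4) (Fin 4) ℂ :=
  Classical.epsilon (P.IsJost Filter.atTop P.qp t s)

/-- The scattering matrix `A(s)`, `s` real: `φ₋(x,t,s) = φ₊(x,t,s) A(s)` for all `x`. -/
def scat (t s : ℝ) : Matrix (Fin 4) (Fin 4) ℂ :=
  Classical.epsilon fun A => ∀ x, P.jostMinus t s x = P.jostPlus t s x * A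

/-- The minor of the scattering matrix with rows `r` and columns `c` (indices start at `0`). -/
def minor {p : ℕ} (r c : Fin p → Fin 4) (t s : ℝ) : ℂ := ((P.scat t s).submatrix r c).det

/-! ### Analytic continuation off the real axis -/

/-- The continuous spectrum without the branch points and without `0`. -/
def spec : Set ℝ := {s | s ≠ 0 ∧ s ≠ P.qo ∧ s ≠ -P.qo}

/-- `F` is analytic in the open half plane `U`, continuous up to the real axis away from
`0, ±qo`, and has boundary values `f` there. -/
def IsExtension {V : Type} [NormedAddCommGroup V] [NormedSpace ℂ V]
    (U : Set ℂ) (f : ℝ → V) (F : ℂ → V) : Prop :=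
  DifferentiableOn ℂ F U ∧ ContinuousOn F (U ∪ (fun s : ℝ => (s : ℂ)) '' P.spec) ∧
  ∀ s ∈ P.spec, F s = f s

/-- The analytic continuation of `f` to the upper half plane (unique there). -/
def extUp {V : Type} [NormedAddCommGroup V] [NormedSpace ℂ V] (f : ℝ → V) : ℂ → V :=
  Classical.epsilon (P.IsExtension {z | 0 < z.im} f)

/-- The analytic continuation of `f` to the lower half plane (unique there). -/
def extDown {V : Type} [NormedAddCommGroup V] [NormedSpace ℂ V] (f : ℝ → V) : ℂ → V :=
  Classical.epsilon (P.IsExtension {z | z.im < 0} f)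

/-- The principal minor `A_{[1]}` in the upper half plane. -/
def A1 (t : ℝ) : ℂ → ℂ := P.extUp (P.minor ![0] ![0] t)
/-- The principal minor `A_{[1,2]}` in the upper half plane. -/
def A12 (t : ℝ) : ℂ → ℂ := P.extUp (P.minor ![0, 1] ![0, 1] t)
/-- The principal minor `A_{[1,2,3]}` in the upper half plane. -/
def A123 (t : ℝ) : ℂ → ℂ := P.extUp (P.minor ![0, 1, 2] ![0, 1, 2] t)
/-- The principal minor `A_{[4]}` in the lower half plane. -/
def A4 (t : ℝ) : ℂ → ℂ := P.extDown (P.minor ![3] ![3] t)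
/-- The principal minor `A_{[3,4]}` in the lower half plane. -/
def A34 (t : ℝ) : ℂ → ℂ := P.extDown (P.minor ![2, 3] ![2, 3] t)
/-- The principal minor `A_{[2,3,4]}` in the lower half plane. -/
def A234 (t : ℝ) : ℂ → ℂ := P.extDown (P.minor ![1, 2, 3] ![1, 2, 3] t)

/-- The analytic non-principal minors `A_{[12;13]}`, `A_{[13;12]}` (upper half plane) and
`A_{[24;34]}`, `A_{[34;24]}` (lower half plane) are identically zero. -/
def NonprincipalMinorsVanish (t : ℝ) : Prop :=
  ∀ s ∈ P.spec, P.minor ![0, 1] ![0, 2] t s = 0 ∧ P.minor ![0, 2] ![0, 1] t s = 0 ∧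
    P.minor ![1, 3] ![2, 3] t s = 0 ∧ P.minor ![2, 3] ![1, 3] t s = 0

/-- `φ_{-,1}`, analytic in the upper half plane. -/
def phiM1 (x t : ℝ) : ℂ → Fin 4 → ℂ := P.extUp fun s i => P.jostMinus t s x i 0
/-- `φ_{+,4}`, analytic in the upper half plane. -/
def phiP4 (x t : ℝ) : ℂ → Fin 4 → ℂ := P.extUp fun s i => P.jostPlus t s x i 3
/-- `φ_{+,1}`, analytic in the lower half plane. -/
def phiP1 (x t : ℝ) : ℂ → Fin 4 → ℂ := P.extDown fun s i => P.jostPlus t s x i 0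
/-- `φ_{-,4}`, analytic in the lower half plane. -/
def phiM4 (x t : ℝ) : ℂ → Fin 4 → ℂ := P.extDown fun s i => P.jostMinus t s x i 3

/-- The auxiliary eigenfunction `χ₂⁺`, analytic in the upper half plane; on the real axis
`χ₂⁺ = -a₁₂ φ_{-,1} + a₁₁ φ_{-,2}`
`= A_{[1,2]} φ_{+,2} + A_{[13;12]} φ_{+,3} + A_{[14;12]} φ_{+,4}`. -/
def chi2Up (x t : ℝ) : ℂ → Fin 4 → ℂ := P.extUp fun s =>
  (P.jostMinus t s x).mulVec ![-(P.scat t s 0 1), P.scat t s 0 0, 0, 0]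

/-- The auxiliary eigenfunction `χ₃⁺`, analytic in the upper half plane; on the real axis
`χ₃⁺ = A_{[12;23]} φ_{-,1} - A_{[12;13]} φ_{-,2} + A_{[1,2]} φ_{-,3}`
`= A_{[1,2,3]} φ_{+,3} + A_{[124;123]} φ_{+,4}`. -/
def chi3Up (x t : ℝ) : ℂ → Fin 4 → ℂ := P.extUp fun s =>
  (P.jostMinus t s x).mulVec
    ![P.minor ![0, 1] ![1, 2] t s, -P.minor ![0, 1] ![0, 2] t s, P.minor ![0, 1] ![0, 1] t s, 0]

/-- The auxiliary eigenfunction `χ₂⁻`, analytic in the lower half plane; on the real axis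
`χ₂⁻ = A_{[3,4]} φ_{-,2} - A_{[34;24]} φ_{-,3} + A_{[34;23]} φ_{-,4}`
`= A_{[134;234]} φ_{+,1} + A_{[2,3,4]} φ_{+,2}`. -/
def chi2Down (x t : ℝ) : ℂ → Fin 4 → ℂ := P.extDown fun s =>
  (P.jostMinus t s x).mulVec
    ![0, P.minor ![2, 3] ![2, 3] t s, -P.minor ![2, 3] ![1, 3] t s, P.minor ![2, 3] ![1, 2] t s]

/-- The auxiliary eigenfunction `χ₃⁻`, analytic in the lower half plane; on the real axis
`χ₃⁻ = a₄₄ φ_{-,3} - a₄₃ φ_{-,4}`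
`= A_{[14;34]} φ_{+,1} + A_{[24;34]} φ_{+,2} + A_{[3,4]} φ_{+,3}`. -/
def chi3Down (x t : ℝ) : ℂ → Fin 4 → ℂ := P.extDown fun s =>
  (P.jostMinus t s x).mulVec ![0, 0, P.scat t s 3 3, -(P.scat t s 3 2)]

/-! ### Discrete eigenvalues, norming constants and residue coefficients -/

/-- `z` is a discrete eigenvalue of type I (and a simple zero of `A_{[1]}`). -/
def IsTypeI (t : ℝ) (z : ℂ) : Prop :=
  0 < z.im ∧ P.A1 t z = 0 ∧ deriv (P.A1 t) z ≠ 0 ∧ P.A12 t z ≠ 0 ∧ P.A123 t z ≠ 0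

/-- `w` is a discrete eigenvalue of type IV (and a simple zero of `A_{[1]}`). -/
def IsTypeIV (t : ℝ) (w : ℂ) : Prop :=
  0 < w.im ∧ P.A1 t w = 0 ∧ deriv (P.A1 t) w ≠ 0 ∧ P.A12 t w = 0 ∧ P.A123 t w ≠ 0

end Potential

/-- The norming constants `d`, `d̄`, `ď`, `d̂` (or `c`, `c̄`, `č`, `ĉ`) of one eigenvalue. -/
structure NormingConstants where
  plain : ℂ
  bar : ℂ
  check : ℂ
  hat : ℂ

namespace Potential

variable (P : Potential)

/-- The relations which define the norming constants of a type I eigenvalue `z`. -/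
def IsNormingI (t : ℝ) (z : ℂ) (d : NormingConstants) : Prop :=
  ∀ x, P.phiM1 x t z = (d.plain / P.A12 t z) • P.chi2Up x t z ∧
    P.chi2Down x t (conj z) = d.bar • P.phiP1 x t (conj z) ∧
    P.phiM4 x t (conj (P.hat z)) = d.check • P.chi2Down x t (conj (P.hat z)) ∧
    P.chi2Up x t (P.hat z) = d.hat • P.phiP4 x t (P.hat z)

/-- The relations which define the norming constants of a type IV eigenvalue `w`. -/
def IsNormingIV (t : ℝ) (w : ℂ) (c : NormingConstants) : Prop :=
  ∀ x, P.phiM1 x t w = (c.plain / P.A123 t w) • P.chi3Up x t w ∧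
    P.chi3Down x t (conj w) = c.bar • P.phiP1 x t (conj w) ∧
    P.phiM4 x t (conj (P.hat w)) = c.check • P.chi3Down x t (conj (P.hat w)) ∧
    P.chi3Up x t (P.hat w) = c.hat • P.phiP4 x t (P.hat w)

/-- `e^{-i(θ₁-θ₂)(x,t,z)}`. -/
def phase (x t : ℝ) (z : ℂ) : ℂ :=
  Complex.exp (-(Complex.I * (P.theta1 x t z - P.theta2 x t z)))

/-- `e^{i(θ₁-θ₂)(x,t,z)}`. -/
def phaseInv (x t : ℝ) (z : ℂ) : ℂ :=
  Complex.exp (Complex.I * (P.theta1 x t z - P.theta2 x t z))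

/-- `D(x,t)`. -/
def D (z : ℂ) (d : NormingConstants) (x t : ℝ) : ℂ :=
  d.plain / deriv (P.A1 t) z * P.phase x t z
/-- `Ď(x,t)`. -/
def DCheck (z : ℂ) (d : NormingConstants) (x t : ℝ) : ℂ :=
  d.check * P.A234 t (conj (P.hat z)) / deriv (P.A4 t) (conj (P.hat z)) * P.phase x t z
/-- `D̄(x,t)`. -/
def DBar (z : ℂ) (d : NormingConstants) (x t : ℝ) : ℂ :=
  d.bar / deriv (P.A234 t) (conj z) * P.phaseInv x t (conj z)
/-- `D̂(x,t)`. -/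
def DHat (z : ℂ) (d : NormingConstants) (x t : ℝ) : ℂ :=
  d.hat / deriv (P.A12 t) (P.hat z) * P.phaseInv x t (conj z)

/-- `C(x,t)`. -/
def C (w : ℂ) (c : NormingConstants) (x t : ℝ) : ℂ :=
  c.plain / deriv (P.A1 t) w * P.phase x t w
/-- `Č(x,t)`. -/
def CCheck (w : ℂ) (c : NormingConstants) (x t : ℝ) : ℂ :=
  c.check * P.A34 t (conj (P.hat w)) / deriv (P.A4 t) (conj (P.hat w)) * P.phase x t w
/-- `C̄(x,t)`. -/
def CBar (w : ℂ) (c : NormingConstants) (x t : ℝ) : ℂ :=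
  c.bar / deriv (P.A34 t) (conj w) * P.phaseInv x t (conj w)
/-- `Ĉ(x,t)`. -/
def CHat (w : ℂ) (c : NormingConstants) (x t : ℝ) : ℂ :=
  c.hat / deriv (P.A123 t) (P.hat w) * P.phaseInv x t (conj w)

end Potential

end

end VNLS

namespace VNLS

open MeasureTheory Set Filter Topology

/-! ### Improper integrals over `(-∞, x]` -/

section Tail

variable {E : Type*} [NormedAddCommGroup E]

/-! Off the real axis only a few objects have to be constructed. In the upper half plane these are
the fastest decaying solution at `-∞`, `jostCol t z 0`, and the 2-tensors `jostTensor t z a` with `a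
= 1, 2` (indices counted from 0), which continue the exterior products of Jost columns 0 and `a`.
Their exponents dominate all competing ones, so each solves a Volterra equation whose Neumann series
converges uniformly and is holomorphic in `z`.

Three symmetries supply the rest. The reflection `(x, z, q) ↦ (-x, -z, -q)` exchanges the two ends
of the line and gives the `φ₊` objects in the lower half plane. The form `u† J w` of a solution at
`conj z` with a solution at `z` is constant in `x`; this expresses the inverse of `A` through its
adjoint, and the minors and auxiliary eigenfunctions as pairings and contractions: `minorOne`,
`minorTwo`, `chiP`, `chiM`. The inversion `z ↦ q_o²/z` exchanges columns 0 and 3 and turns `χ₃^±`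
into `chiM` and `chiP` with `a = 2`. Because a continuation is determined by its values on the
spectrum, these closed forms are the functions chosen by `extUp` and `extDown`.

Let `minorOne` vanish at `z`, and let `minorTwo t a z ≠ 0`; here `a = 1` for type I and `a = 2` for
type IV. The tensor at `z` is decomposable, `φ_{-,1} ∧ w`, and `φ_{-,1}(z)` is orthogonal to
`φ_{+,1}(conj z)`. The contraction defining `chiP` therefore collapses to `κ φ_{-,1}`, and dually
`chiM` at `conj z` is a multiple of `φ_{+,1}`. The minor `minorTwo t a z` factors into the same two
pairings, so the second multiple is `conj (minorTwo t a z / κ) / γ(conj z)` (`exists_proportional`).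
As the first norming constant is `minorTwo t a z / κ`, this is the relation for the barred one.

The other two relations use the vanishing non-principal minors. They give `A_{[1,2]} A_{[1,3]} =
A_{[1]} A_{[1,2,3]}` (`minorTwo_mul_minorTwo`), and they make `chiP` at `z` and `chiM` at `q_o²/z`
proportional with explicit scalar factors (`minorOne_smul_chiP`). At `z` one divides by the nonzero
factor (`chiM_inv`); at `ẑ` both factors vanish, and differentiation compares the two functions
(`chiP_hat`). The remaining steps compare derivatives of the minors at the four points of the orbit
and use `|q_±| = q_o`. -/

theorem integrableOn_Iic_of_continuous {f : ℝ → E} (hf : Continuous f)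
    (h0 : IntegrableOn f (Iic 0)) (x : ℝ) : IntegrableOn f (Iic x) := by
  rcases le_total x 0 with h | h
  · exact h0.mono_set (Iic_subset_Iic.2 h)
  · rw [← Iic_union_Icc_eq_Iic h]
    exact h0.union hf.integrableOn_Icc

variable [NormedSpace ℝ E]

theorem integral_Iic_eq_add {f : ℝ → E} (hi : ∀ x, IntegrableOn f (Iic x)) (a x : ℝ) :
    ∫ y in Iic x, f y = (∫ y in Iic a, f y) + ∫ y in a..x, f y := by
  rw [← intervalIntegral.integral_Iic_sub_Iic (hi a) (hi x)]; abel

variable [CompleteSpace E]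

theorem hasDerivAt_integral_Iic {f : ℝ → E} (hf : Continuous f)
    (hi : ∀ x, IntegrableOn f (Iic x)) (x : ℝ) :
    HasDerivAt (fun x => ∫ y in Iic x, f y) (f x) x := by
  have h : (fun x => ∫ y in Iic x, f y) = fun x => (∫ y in Iic 0, f y) + ∫ y in (0 : ℝ)..x, f y :=
    funext fun x => integral_Iic_eq_add hi 0 x
  rw [h]
  exact (hf.integral_hasStrictDerivAt 0 x).hasDerivAt.const_add _

omit [CompleteSpace E] in
theorem tendsto_integral_Iic_atBot {f : ℝ → E} (hi : ∀ x, IntegrableOn f (Iic x)) :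
    Tendsto (fun x => ∫ y in Iic x, f y) atBot (𝓝 0) := by
  have h := intervalIntegral_tendsto_integral_Iic 0 (hi 0) tendsto_id
  have h2 := (tendsto_const_nhds (x := ∫ y in Iic (0 : ℝ), f y)).sub h
  rw [sub_self] at h2
  refine h2.congr fun x => ?_
  rw [integral_Iic_eq_add hi x 0]; simp

end Tail

/-- A nonnegative continuous weight which is integrable near `-∞`. -/
structure IsWeight (r : ℝ → ℝ) : Prop where
  cont : Continuous r
  nonneg : ∀ x, 0 ≤ r x
  integrable : ∀ x, IntegrableOn r (Iic x)

namespace IsWeight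

/-- The primitive of a weight which vanishes at `-∞`. -/
noncomputable def prim (r : ℝ → ℝ) (x : ℝ) : ℝ := ∫ y in Iic x, r y

variable {r : ℝ → ℝ} (hr : IsWeight r)

include hr

theorem hasDerivAt_prim (x : ℝ) : HasDerivAt (prim r) (r x) x :=
  hasDerivAt_integral_Iic hr.cont hr.integrable x

theorem continuous_prim : Continuous (prim r) :=
  continuous_iff_continuousAt.2 fun x => (hr.hasDerivAt_prim x).continuousAt

theorem tendsto_prim : Tendsto (prim r) atBot (𝓝 0) := tendsto_integral_Iic_atBot hr.integrable

theorem prim_nonneg (x : ℝ) : 0 ≤ prim r x := integral_nonneg hr.nonneg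

theorem prim_mono : Monotone (prim r) :=
  monotone_of_hasDerivAt_nonneg (fun x => hr.hasDerivAt_prim x) hr.nonneg

theorem hasDerivAt_exp_prim (κ x : ℝ) :
    HasDerivAt (fun x => Real.exp (κ * prim r x)) (κ * (r x * Real.exp (κ * prim r x))) x := by
  exact ((hr.hasDerivAt_prim x).const_mul κ).exp.congr_deriv (by ring)

theorem continuous_mul_exp_prim (κ : ℝ) : Continuous fun y => r y * Real.exp (κ * prim r y) :=
  hr.cont.mul (Real.continuous_exp.comp (continuous_const.mul hr.continuous_prim))

theorem integrableOn_mul_exp_prim {κ : ℝ} (hκ : 0 ≤ κ) (x : ℝ) :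
    IntegrableOn (fun y => r y * Real.exp (κ * prim r y)) (Iic x) := by
  refine Integrable.mono' ((hr.integrable x).mul_const (Real.exp (κ * prim r x)))
    (hr.continuous_mul_exp_prim κ).aestronglyMeasurable ?_
  refine (ae_restrict_mem measurableSet_Iic).mono fun y hy => ?_
  rw [Real.norm_of_nonneg (mul_nonneg (hr.nonneg y) (Real.exp_pos _).le)]
  exact mul_le_mul_of_nonneg_left (Real.exp_le_exp.2
    (mul_le_mul_of_nonneg_left (hr.prim_mono hy) hκ)) (hr.nonneg y)

/-- The integrand has the antiderivative `exp (κ R) / κ`, where `R` is the primitive of the weight.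
With `κ = 2K` the quotient supplies the factor `1/2` which makes the iterations below geometric. -/
theorem integral_mul_exp_prim {κ : ℝ} (hκ : 0 < κ) (x : ℝ) :
    ∫ y in Iic x, r y * Real.exp (κ * prim r y) = (Real.exp (κ * prim r x) - 1) / κ := by
  have h := integral_Iic_of_hasDerivAt_of_tendsto' (a := x) (m := 1 / κ)
    (f := fun y => Real.exp (κ * prim r y) / κ)
    (f' := fun y => r y * Real.exp (κ * prim r y)) (fun y _ => ?_)
    (hr.integrableOn_mul_exp_prim hκ.le x) ?_
  · rw [h]; ring
  · exact ((hr.hasDerivAt_exp_prim κ y).div_const κ).congr_deriv (mul_div_cancel_left₀ _ hκ.ne')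
  · have := (Real.continuous_exp.tendsto _).comp (hr.tendsto_prim.const_mul κ)
    simp only [mul_zero, Real.exp_zero] at this
    exact this.div_const κ

end IsWeight

/-! ### Linear systems `y' = diag(ν) y + g(x) y` with `Re ν ≤ 0` and `g` integrable at `-∞` -/

/-- The data of a linear system with `Re ν ≤ 0` and `g` dominated by a weight. -/
structure IsTame {ι : Type*} [Fintype ι] (ν : ι → ℂ) (g : ℝ → Matrix ι ι ℂ) (r : ℝ → ℝ) (K : ℝ) :
    Prop where
  re_nonpos : ∀ i, (ν i).re ≤ 0
  cont : ∀ i j, Continuous fun y => g y i j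
  pos : 0 < K
  bound : ∀ y i, ∑ j, ‖g y i j‖ ≤ K * r y

section System

variable {ι : Type*} [Fintype ι] {ν : ι → ℂ} {g : ℝ → Matrix ι ι ℂ} {r : ℝ → ℝ} {K : ℝ}

theorem IsTame.norm_mulVec_le (h : IsTame ν g r K) (y : ℝ) {u : ι → ℂ} {M : ℝ}
    (hu : ∀ j, ‖u j‖ ≤ M) (i : ι) : ‖(g y).mulVec u i‖ ≤ K * r y * M := by
  have hM : 0 ≤ M := (norm_nonneg _).trans (hu i)
  calc ‖(g y).mulVec u i‖ ≤ ∑ j, ‖g y i j * u j‖ := norm_sum_le _ _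
    _ ≤ ∑ j, ‖g y i j‖ * M := Finset.sum_le_sum fun j _ => by
        rw [norm_mul]; exact mul_le_mul_of_nonneg_left (hu j) (norm_nonneg _)
    _ = (∑ j, ‖g y i j‖) * M := (Finset.sum_mul ..).symm
    _ ≤ _ := mul_le_mul_of_nonneg_right (h.bound y i) hM

theorem norm_exp_mul_le_one {a : ℂ} (ha : a.re ≤ 0) {s : ℝ} (hs : 0 ≤ s) :
    ‖Complex.exp (a * s)‖ ≤ 1 := by
  rw [Complex.norm_exp, Complex.re_mul_ofReal]
  exact Real.exp_le_one_iff.2 (mul_nonpos_of_nonpos_of_nonneg ha hs)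

/-- A solution of a tame system which vanishes at `-∞` is zero. -/
theorem IsTame.eq_zero (h : IsTame ν g r K) (hr : IsWeight r) {y : ℝ → ι → ℂ}
    (hy : ∀ x i, HasDerivAt (fun x => y x i) (ν i * y x i + (g x).mulVec (y x) i) x)
    (h0 : ∀ i, Tendsto (fun x => y x i) atBot (𝓝 0)) (x : ℝ) : y x = 0 := by
  have hcont : ∀ i, Continuous fun x => y x i := fun i =>
    continuous_iff_continuousAt.2 fun x => (hy x i).continuousAt
  have hbd : ∃ M, ∀ s ≤ x, ∀ i, ‖y s i‖ ≤ M := by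
    have hev : ∀ᶠ s in atBot, ∀ i, ‖y s i‖ ≤ 1 := by
      refine eventually_all.2 fun i => ?_
      have := (h0 i).norm
      rw [norm_zero] at this
      exact this.eventually_le_const one_pos
    obtain ⟨a, ha⟩ := eventually_atBot.1 hev
    have hc : Continuous fun s => ∑ i, ‖y s i‖ := continuous_finsetSum _ fun i _ => (hcont i).norm
    obtain ⟨M, hM⟩ := (isCompact_Icc (a := a) (b := x)).bddAbove_image hc.continuousOn
    refine ⟨max 1 M, fun s hs i => ?_⟩
    rcases le_total s a with h1 | h1
    · exact (ha s h1 i).trans (le_max_left _ _)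
    · have h2 : ∑ i, ‖y s i‖ ≤ M := hM (mem_image_of_mem _ ⟨h1, hs⟩)
      exact (Finset.single_le_sum (f := fun i => ‖y s i‖) (fun i _ => norm_nonneg _)
        (Finset.mem_univ i)).trans (h2.trans (le_max_right _ _))
  obtain ⟨M, hM⟩ := hbd
  set R := IsWeight.prim r
  -- Inserting a bound of this shape into the equation halves its constant, since the derivative of
  -- `exp (2KR)` is `2K r exp (2KR)`, twice the size of the perturbation term. Iterating drives the
  -- constant to zero.
  have key : ∀ n : ℕ, ∀ s ≤ x, ∀ i, ‖y s i‖ ≤ M * (1 / 2) ^ n * Real.exp (2 * K * R s) := by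
    intro n
    induction n with
    | zero =>
      intro s hs i
      have h1 : 1 ≤ Real.exp (2 * K * R s) := Real.one_le_exp
        (mul_nonneg (mul_nonneg zero_le_two h.pos.le) (hr.prim_nonneg s))
      have h2 := hM s hs i
      have h3 : 0 ≤ M := (norm_nonneg _).trans h2
      simpa using h2.trans (le_mul_of_one_le_right h3 h1)
    | succ n ih =>
      intro s hs i
      have hM0 : 0 ≤ M := (norm_nonneg _).trans (hM s hs i)
      -- The factor `exp (ν (s - p))` cancels the diagonal term and has norm at most 1 for `p ≤ s`.
      -- The boundary term at `a` disappears as `a → -∞`.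
      have step : ∀ a ≤ s, ‖y s i‖ ≤ ‖y a i‖ + M * (1 / 2) ^ (n + 1) * Real.exp (2 * K * R s) := by
        intro a ha
        have hd : ∀ p, HasDerivAt (fun p => Complex.exp (ν i * (s - p : ℝ)) * y p i)
            (Complex.exp (ν i * (s - p : ℝ)) * (g p).mulVec (y p) i) p := by
          intro p
          have h1 : HasDerivAt (fun p : ℝ => ν i * (s - p : ℝ)) (-ν i) p := by
            have := (((hasDerivAt_id p).const_sub s).ofReal_comp).const_mul (ν i)
            simpa using this
          exact (h1.cexp.mul (hy p i)).congr_deriv (by ring)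
        have := image_norm_le_of_norm_deriv_right_le_deriv_boundary (a := a) (b := s)
          (f := fun p => Complex.exp (ν i * (s - p : ℝ)) * y p i)
          (B := fun p => ‖y a i‖ + M * (1 / 2) ^ (n + 1) * Real.exp (2 * K * R p))
          (fun p _ => (hd p).continuousAt.continuousWithinAt)
          (fun p _ => (hd p).hasDerivWithinAt) ?_
          (fun p => ((hr.hasDerivAt_exp_prim (2 * K) p).const_mul
            (M * (1 / 2) ^ (n + 1))).const_add _) ?_ (right_mem_Icc.2 ha)
        · simpa using this
        · rw [norm_mul]
          refine le_add_of_le_of_nonneg ?_ (by positivity)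
          exact mul_le_of_le_one_left (norm_nonneg _)
            (norm_exp_mul_le_one (h.re_nonpos i) (sub_nonneg.2 ha))
        · intro p hp
          rw [norm_mul]
          refine (mul_le_of_le_one_left (norm_nonneg _)
            (norm_exp_mul_le_one (h.re_nonpos i) (sub_nonneg.2 hp.2.le))).trans ?_
          refine (h.norm_mulVec_le p (ih p (hp.2.le.trans hs)) i).trans (le_of_eq ?_)
          change _ = M * (1 / 2) ^ (n + 1) * (2 * K * (r p * Real.exp (2 * K * R p)))
          ring
      have hl : Tendsto (fun a => ‖y a i‖ + M * (1 / 2) ^ (n + 1) * Real.exp (2 * K * R s)) atBot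
          (𝓝 (0 + M * (1 / 2) ^ (n + 1) * Real.exp (2 * K * R s))) := by
        have := (h0 i).norm
        rw [norm_zero] at this
        exact this.add_const _
      rw [zero_add] at hl
      exact ge_of_tendsto hl ((eventually_le_atBot s).mono fun a ha => step a ha)
  funext i
  have hl : Tendsto (fun n : ℕ => M * (1 / 2) ^ n * Real.exp (2 * K * R x)) atTop (𝓝 0) := by
    have := ((tendsto_pow_atTop_nhds_zero_of_lt_one (r := (1 / 2 : ℝ)) (by norm_num)
      (by norm_num)).const_mul M).mul_const (Real.exp (2 * K * R x))
    simpa using this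
  have := ge_of_tendsto' hl fun n => key n x le_rfl i
  simpa using le_antisymm this (norm_nonneg _)

end System

/-- The solution of `u' = a u + F` on the line which vanishes at `-∞`. -/
noncomputable def duhamel (a : ℂ) (F : ℝ → ℂ) (x : ℝ) : ℂ :=
  ∫ y in Iic x, Complex.exp (a * (x - y : ℝ)) * F y

section Duhamel

variable {a : ℂ} {F : ℝ → ℂ} {B : ℝ → ℝ}

theorem norm_exp_mul_le_of_le (ha : a.re ≤ 0) {x y : ℝ} (hxy : y ≤ x) (c : ℂ) :
    ‖Complex.exp (a * (x - y : ℝ)) * c‖ ≤ ‖c‖ := by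
  rw [norm_mul]
  exact mul_le_of_le_one_left (norm_nonneg _) (norm_exp_mul_le_one ha (sub_nonneg.2 hxy))

theorem integrableOn_duhamel (ha : a.re ≤ 0) (hF : Continuous F)
    (hB : ∀ x, IntegrableOn B (Iic x)) (hFB : ∀ y, ‖F y‖ ≤ B y) (x : ℝ) :
    IntegrableOn (fun y => Complex.exp (a * (x - y : ℝ)) * F y) (Iic x) := by
  refine Integrable.mono' (hB x) (by fun_prop) ?_
  refine (ae_restrict_mem measurableSet_Iic).mono fun y hy => ?_
  exact (norm_exp_mul_le_of_le ha hy _).trans (hFB y)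

theorem norm_duhamel_le (ha : a.re ≤ 0) (hB : ∀ x, IntegrableOn B (Iic x))
    (hFB : ∀ y, ‖F y‖ ≤ B y) (x : ℝ) : ‖duhamel a F x‖ ≤ ∫ y in Iic x, B y := by
  refine norm_integral_le_of_norm_le (hB x) ?_
  refine (ae_restrict_mem measurableSet_Iic).mono fun y hy => ?_
  exact (norm_exp_mul_le_of_le ha hy _).trans (hFB y)

/-- Taking `exp (a x)` out of the integral leaves an integrand free of `x`, to which the fundamental
theorem applies; its integrability near `-∞` is the majorized case at `x = 0`. -/
theorem hasDerivAt_duhamel (ha : a.re ≤ 0) (hF : Continuous F)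
    (hB : ∀ x, IntegrableOn B (Iic x)) (hFB : ∀ y, ‖F y‖ ≤ B y) (x : ℝ) :
    HasDerivAt (duhamel a F) (a * duhamel a F x + F x) x := by
  have hc : Continuous fun y : ℝ => Complex.exp (-a * y) * F y := by fun_prop
  have hi : ∀ x, IntegrableOn (fun y : ℝ => Complex.exp (-a * y) * F y) (Iic x) := by
    refine integrableOn_Iic_of_continuous hc ?_
    have := integrableOn_duhamel ha hF hB hFB 0
    simpa using this
  have he : duhamel a F = fun x : ℝ =>
      Complex.exp (a * x) * ∫ y in Iic x, Complex.exp (-a * y) * F y := by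
    funext x
    rw [duhamel, ← integral_const_mul]
    refine integral_congr_ae (Eventually.of_forall fun y => ?_)
    simp only [← mul_assoc, ← Complex.exp_add]
    congr 2
    push_cast; ring
  have h1 : HasDerivAt (fun x : ℝ => Complex.exp (a * x)) (Complex.exp (a * x) * a) x := by
    have h2 : HasDerivAt (fun x : ℝ => a * (x : ℂ)) a x := by
      simpa using (hasDerivAt_id x).ofReal_comp.const_mul a
    exact h2.cexp
  rw [he]
  refine (h1.mul (hasDerivAt_integral_Iic hc hi x)).congr_deriv ?_
  have h3 : Complex.exp (a * x) * Complex.exp (-a * x) = 1 := by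
    rw [← Complex.exp_add]; simp
  linear_combination F x * h3

end Duhamel

/-- The terms of the Neumann series of the Volterra equation
`y(x) = v + ∫_{-∞}^x e^{diag(ν)(x-s)} g(s) y(s) ds`. -/
noncomputable def volterraTerm {ι : Type*} [Fintype ι] (ν : ι → ℂ) (g : ℝ → Matrix ι ι ℂ)
    (v : ι → ℂ) : ℕ → ℝ → ι → ℂ
  | 0 => fun _ => v
  | n + 1 => fun x i => duhamel (ν i) (fun y => (g y).mulVec (volterraTerm ν g v n y) i) x

/-- The solution of the Volterra equation. -/
noncomputable def volterraSol {ι : Type*} [Fintype ι] (ν : ι → ℂ) (g : ℝ → Matrix ι ι ℂ)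
    (v : ι → ℂ) (x : ℝ) (i : ι) : ℂ := ∑' n, volterraTerm ν g v n x i

section Volterra

variable {ι : Type*} [Fintype ι] {ν : ι → ℂ} {g : ℝ → Matrix ι ι ℂ} {r : ℝ → ℝ} {K : ℝ}
  {v : ι → ℂ} {V : ℝ}

theorem IsTame.continuous_mulVec (h : IsTame ν g r K) {u : ℝ → ι → ℂ}
    (hu : ∀ j, Continuous fun x => u x j) (i : ι) : Continuous fun x => (g x).mulVec (u x) i :=
  continuous_finsetSum _ fun j _ => (h.cont i j).mul (hu j)

/-- The bound for the integrand in the `n`-th step of the iteration. -/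
noncomputable def volterraBound (r : ℝ → ℝ) (K V : ℝ) (x : ℝ) : ℝ :=
  K * V * (r x * Real.exp (2 * K * IsWeight.prim r x))

theorem IsWeight.integrableOn_volterraBound (hr : IsWeight r) (hK : 0 < K) (V x : ℝ) :
    IntegrableOn (volterraBound r K V) (Iic x) :=
  (hr.integrableOn_mul_exp_prim (by positivity) x).const_mul _

theorem IsWeight.integral_volterraBound (hr : IsWeight r) (hK : 0 < K) (V x : ℝ) :
    ∫ y in Iic x, volterraBound r K V y =
      V * (1 / 2) * (Real.exp (2 * K * IsWeight.prim r x) - 1) := by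
  simp only [volterraBound]
  rw [integral_const_mul, hr.integral_mul_exp_prim (by positivity)]
  field_simp

theorem IsTame.norm_mulVec_le_volterraBound (h : IsTame ν g r K) (y : ℝ) {u : ι → ℂ}
    (hu : ∀ j, ‖u j‖ ≤ V * Real.exp (2 * K * IsWeight.prim r y)) (i : ι) :
    ‖(g y).mulVec u i‖ ≤ volterraBound r K V y :=
  (h.norm_mulVec_le y hu i).trans (le_of_eq (by rw [volterraBound]; ring))

/-- Measured against `exp (2KR)`, every Volterra integration gains a factor `1/2`. The bound
involves `ν` and `g` only through `K`, so it is uniform over families with a common `K`. -/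
theorem IsTame.volterraTerm_spec (h : IsTame ν g r K) (hr : IsWeight r) (hv : ∀ i, ‖v i‖ ≤ V)
    (n : ℕ) : (∀ i, Continuous fun x => volterraTerm ν g v n x i) ∧
      ∀ x i, ‖volterraTerm ν g v n x i‖ ≤
        V * (1 / 2) ^ n * Real.exp (2 * K * IsWeight.prim r x) := by
  induction n with
  | zero =>
    refine ⟨fun i => continuous_const, fun x i => ?_⟩
    have h1 : 1 ≤ Real.exp (2 * K * IsWeight.prim r x) := Real.one_le_exp
      (mul_nonneg (mul_nonneg zero_le_two h.pos.le) (hr.prim_nonneg x))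
    have h3 : 0 ≤ V := (norm_nonneg _).trans (hv i)
    simpa [volterraTerm] using (hv i).trans (le_mul_of_one_le_right h3 h1)
  | succ n ih =>
    have hB := fun y i => h.norm_mulVec_le_volterraBound y (ih.2 y) i
    have hI := hr.integrableOn_volterraBound h.pos (V * (1 / 2) ^ n)
    refine ⟨fun i => continuous_iff_continuousAt.2 fun x => (hasDerivAt_duhamel (h.re_nonpos i)
      (h.continuous_mulVec ih.1 i) hI (hB · i) x).continuousAt, fun x i => ?_⟩
    refine (norm_duhamel_le (h.re_nonpos i) hI (hB · i) x).trans ?_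
    rw [hr.integral_volterraBound h.pos, pow_succ, ← mul_assoc]
    have h3 : 0 ≤ V := (norm_nonneg _).trans (hv i)
    exact mul_le_mul_of_nonneg_left (sub_le_self _ zero_le_one) (by positivity)

theorem summable_geometric_mul (V E : ℝ) : Summable fun n : ℕ => V * (1 / 2 : ℝ) ^ n * E :=
  ((summable_geometric_of_lt_one (by norm_num) (by norm_num)).mul_left V).mul_right E

theorem tsum_geometric_mul (V E : ℝ) : ∑' n : ℕ, V * (1 / 2 : ℝ) ^ n * E = 2 * V * E := by
  rw [tsum_mul_right, tsum_mul_left, tsum_geometric_of_lt_one (by norm_num) (by norm_num)]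
  norm_num
  left
  ring

theorem IsTame.summable_volterraTerm (h : IsTame ν g r K) (hr : IsWeight r) (v : ι → ℂ) (x : ℝ)
    (i : ι) : Summable fun n => volterraTerm ν g v n x i :=
  (summable_geometric_mul _ _).of_norm_bounded
    fun n => (h.volterraTerm_spec hr (fun i => norm_le_pi_norm v i) n).2 x i

theorem IsTame.norm_volterraSol_le (h : IsTame ν g r K) (hr : IsWeight r) (hv : ∀ i, ‖v i‖ ≤ V)
    (x : ℝ) (i : ι) :
    ‖volterraSol ν g v x i‖ ≤ 2 * V * Real.exp (2 * K * IsWeight.prim r x) := by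
  rw [← tsum_geometric_mul]
  exact tsum_of_norm_bounded (summable_geometric_mul _ _).hasSum
    fun n => (h.volterraTerm_spec hr hv n).2 x i

theorem IsTame.continuous_volterraSol (h : IsTame ν g r K) (hr : IsWeight r) (v : ι → ℂ)
    (i : ι) : Continuous fun x => volterraSol ν g v x i := by
  refine continuous_iff_continuousAt.2 fun x => ?_
  have hs := fun n => h.volterraTerm_spec hr (fun i => norm_le_pi_norm v i) n
  refine ContinuousOn.continuousAt (s := Iic (x + 1)) ?_ (Iic_mem_nhds (by linarith))
  refine continuousOn_tsum (fun n => ((hs n).1 i).continuousOn)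
    (summable_geometric_mul ‖v‖ (Real.exp (2 * K * IsWeight.prim r (x + 1))))
    fun n y hy => ((hs n).2 y i).trans ?_
  have := h.pos
  refine mul_le_mul_of_nonneg_left (Real.exp_le_exp.2 (mul_le_mul_of_nonneg_left
    (hr.prim_mono hy) (by positivity))) (by positivity)

theorem IsTame.volterraSol_eq (h : IsTame ν g r K) (hr : IsWeight r) (v : ι → ℂ) (x : ℝ) (i : ι) :
    volterraSol ν g v x i =
      v i + duhamel (ν i) (fun y => (g y).mulVec (volterraSol ν g v y) i) x := by
  have hs := fun n => h.volterraTerm_spec hr (fun i => norm_le_pi_norm v i) n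
  have hB := fun n y i => h.norm_mulVec_le_volterraBound y ((hs n).2 y) i
  have hI := fun n : ℕ => hr.integrableOn_volterraBound h.pos (‖v‖ * (1 / 2) ^ n)
  rw [volterraSol, (h.summable_volterraTerm hr v x i).tsum_eq_zero_add]
  congr 1
  -- Sum and integral may be interchanged because the integrals of the norms are dominated by a
  -- geometric series.
  have h1 := hasSum_integral_of_summable_integral_norm (μ := volume.restrict (Iic x))
    (F := fun n y => Complex.exp (ν i * (x - y : ℝ)) *
      (g y).mulVec (volterraTerm ν g v n y) i)
    (fun n => integrableOn_duhamel (h.re_nonpos i) (h.continuous_mulVec (hs n).1 i) (hI n)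
      (hB n · i) x) ?_
  · have h2 : duhamel (ν i) (fun y => (g y).mulVec (volterraSol ν g v y) i) x =
        ∫ y in Iic x, ∑' n, Complex.exp (ν i * (x - y : ℝ)) *
          (g y).mulVec (volterraTerm ν g v n y) i := by
      refine integral_congr_ae (Eventually.of_forall fun y => ?_)
      simp only
      rw [tsum_mul_left]
      congr 1
      simp only [Matrix.mulVec, dotProduct, volterraSol]
      rw [Summable.tsum_finsetSum fun j _ => (h.summable_volterraTerm hr v y j).mul_left _]
      exact Finset.sum_congr rfl fun j _ => tsum_mul_left.symm
    rw [h2]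
    exact h1.tsum_eq
  · refine Summable.of_nonneg_of_le (fun n => integral_nonneg fun y => norm_nonneg _) (fun n => ?_)
      (summable_geometric_mul (‖v‖ * (1 / 2)) (Real.exp (2 * K * IsWeight.prim r x) - 1))
    have : ∫ y in Iic x, ‖Complex.exp (ν i * (x - y : ℝ)) *
        (g y).mulVec (volterraTerm ν g v n y) i‖ ≤
        ∫ y in Iic x, volterraBound r K (‖v‖ * (1 / 2) ^ n) y := by
      refine setIntegral_mono_on (integrableOn_duhamel (h.re_nonpos i)
        (h.continuous_mulVec (hs n).1 i) (hI n) (hB n · i) x).norm (hI n x) measurableSet_Iic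
        fun y hy => (norm_exp_mul_le_of_le (h.re_nonpos i) hy _).trans (hB n y i)
    refine this.trans (le_of_eq ?_)
    rw [hr.integral_volterraBound h.pos]
    ring

/-- The Duhamel term contributes `ν (y - v)`; the condition `ν i * v i = 0`, that is, that the
constant `v` solves the unperturbed system, turns this into `ν y`. -/
theorem IsTame.hasDerivAt_volterraSol (h : IsTame ν g r K) (hr : IsWeight r) (v : ι → ℂ)
    (h0 : ∀ i, ν i * v i = 0) (x : ℝ) (i : ι) :
    HasDerivAt (fun x => volterraSol ν g v x i)
      (ν i * volterraSol ν g v x i + (g x).mulVec (volterraSol ν g v x) i) x := by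
  have h1 := (hasDerivAt_duhamel (h.re_nonpos i)
    (h.continuous_mulVec (h.continuous_volterraSol hr v) i)
    (hr.integrableOn_volterraBound h.pos (2 * ‖v‖))
    (fun y => h.norm_mulVec_le_volterraBound y
      ((h.norm_volterraSol_le hr fun i => norm_le_pi_norm v i) y) i) x).const_add (v i)
  have h2 : (fun x => volterraSol ν g v x i) =
      fun x => v i + duhamel (ν i) (fun y => (g y).mulVec (volterraSol ν g v y) i) x :=
    funext fun x => h.volterraSol_eq hr v x i
  rw [h2]
  refine h1.congr_deriv ?_
  rw [h.volterraSol_eq hr v x i]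
  linear_combination -h0 i

theorem IsTame.tendsto_volterraSol (h : IsTame ν g r K) (hr : IsWeight r) (v : ι → ℂ) (i : ι) :
    Tendsto (fun x => volterraSol ν g v x i) atBot (𝓝 (v i)) := by
  rw [tendsto_iff_norm_sub_tendsto_zero]
  have hl : Tendsto (fun x => 2 * ‖v‖ * (1 / 2) * (Real.exp (2 * K * IsWeight.prim r x) - 1))
      atBot (𝓝 0) := by
    have := (Real.continuous_exp.tendsto _).comp (hr.tendsto_prim.const_mul (2 * K))
    simp only [mul_zero, Real.exp_zero] at this
    simpa using (this.sub_const 1).const_mul (2 * ‖v‖ * (1 / 2))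
  refine squeeze_zero (fun x => norm_nonneg _) (fun x => ?_) hl
  rw [h.volterraSol_eq hr v x i, add_sub_cancel_left, ← hr.integral_volterraBound h.pos]
  exact norm_duhamel_le (h.re_nonpos i) (hr.integrableOn_volterraBound h.pos (2 * ‖v‖))
    (fun y => h.norm_mulVec_le_volterraBound y
      ((h.norm_volterraSol_le hr fun i => norm_le_pi_norm v i) y) i) x

end Volterra

/-! ### Holomorphic dependence of Volterra solutions on the spectral parameter -/

/-- An integral of holomorphic functions with an integrable majorant is holomorphic. -/
theorem differentiableOn_integral_of_dominated {α : Type*} [MeasurableSpace α] {μ : Measure α}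
    {F : ℂ → α → ℂ} {B : α → ℝ} {U : Set ℂ} (hU : IsOpen U)
    (hm : ∀ z ∈ U, AEStronglyMeasurable (F z) μ) (hB : Integrable B μ)
    (hFB : ∀ᵐ y ∂μ, ∀ z ∈ U, ‖F z y‖ ≤ B y)
    (hd : ∀ᵐ y ∂μ, DifferentiableOn ℂ (fun z => F z y) U) :
    DifferentiableOn ℂ (fun z => ∫ y, F z y ∂μ) U := by
  intro z hz
  obtain ⟨δ, hδ, hball⟩ := Metric.isOpen_iff.1 hU z hz
  set ε := δ / 3 with hε
  have hε0 : 0 < ε := by positivity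
  have hsub : ∀ w ∈ Metric.ball z ε, Metric.closedBall w ε ⊆ U := by
    intro w hw p hp
    refine hball ?_
    rw [Metric.mem_ball] at hw ⊢
    rw [Metric.mem_closedBall] at hp
    linarith [dist_triangle p w z]
  have hmem : ∀ w ∈ Metric.ball z ε, w ∈ U := fun w hw =>
    hsub w hw (Metric.mem_closedBall_self hε0.le)
  refine (hasDerivAt_integral_of_dominated_loc_of_deriv_le (F := F)
    (F' := fun w y => deriv (fun z => F z y) w) (bound := fun y => B y / ε)
    (Metric.ball_mem_nhds z hε0) ?_ ?_ ?_ ?_ ?_ ?_).2.differentiableAt.differentiableWithinAt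
  · filter_upwards [hU.mem_nhds hz] with w hw using hm w hw
  · exact Integrable.mono' hB (hm z hz) (hFB.mono fun y hy => hy z hz)
  -- Measurability of the derivative in `z`: it is the limit of difference quotients along this
  -- sequence of increments, which keep `z` plus the increment in the ball of radius `ε`.
  · have ht : Tendsto (fun n : ℕ => (((1 : ℝ) / (n + 1) * (ε / 2) : ℝ) : ℂ)) atTop (𝓝[≠] 0) := by
      refine tendsto_nhdsWithin_iff.2 ⟨?_, Eventually.of_forall fun n => ?_⟩
      · have := (tendsto_one_div_add_atTop_nhds_zero_nat (𝕜 := ℝ)).mul_const (ε / 2)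
        rw [zero_mul] at this
        exact (Complex.continuous_ofReal.tendsto 0).comp this
      · have : (0 : ℝ) < 1 / (n + 1) * (ε / 2) := by positivity
        simpa using Complex.ofReal_ne_zero.2 this.ne'
    refine aestronglyMeasurable_of_tendsto_ae atTop
      (f := fun (n : ℕ) y => ((((1 : ℝ) / (n + 1) * (ε / 2) : ℝ) : ℂ))⁻¹ *
        (F (z + (((1 : ℝ) / (n + 1) * (ε / 2) : ℝ) : ℂ)) y - F z y)) (fun n => ?_) ?_
    · refine ((hm _ (hmem _ ?_)).sub (hm z hz)).const_mul _
      rw [Metric.mem_ball, dist_self_add_left, Complex.norm_real, Real.norm_of_nonneg (by positivity)]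
      have : (1 : ℝ) / (n + 1) ≤ 1 := by
        rw [div_le_one (by positivity)]; linarith [n.cast_nonneg (α := ℝ)]
      nlinarith
    · filter_upwards [hd] with y hy
      have := ((hy z hz).differentiableAt (hU.mem_nhds hz)).hasDerivAt
      exact (hasDerivAt_iff_tendsto_slope_zero.1 this).comp ht
  -- Cauchy's estimate on circles of radius `ε` bounds the derivative by `B / ε`.
  · filter_upwards [hFB, hd] with y hy hy' w hw
    refine Complex.norm_deriv_le_of_forall_mem_sphere_norm_le hε0 ?_
      fun p hp => hy p (hsub w hw (Metric.sphere_subset_closedBall hp))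
    exact DifferentiableOn.diffContOnCl_ball (U := U) hy' (hsub w hw)
  · exact hB.div_const ε
  · filter_upwards [hd] with y hy w hw
    exact ((hy w (hmem w hw)).differentiableAt (hU.mem_nhds (hmem w hw))).hasDerivAt

section Parameter

variable {ι : Type*} [Fintype ι] {ν : ℂ → ι → ℂ} {g : ℂ → ℝ → Matrix ι ι ℂ} {r : ℝ → ℝ} {K : ℝ}
  {S U : Set ℂ}

/-- A family of tame systems which depends continuously on `z ∈ S` and holomorphically on
`z ∈ U`. -/
structure IsTameFamily (ν : ℂ → ι → ℂ) (g : ℂ → ℝ → Matrix ι ι ℂ) (r : ℝ → ℝ) (K : ℂ → ℝ)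
    (S U : Set ℂ) : Prop where
  isOpen : IsOpen U
  subset : U ⊆ S
  tame : ∀ z ∈ S, IsTame (ν z) (g z) r (K z)
  cont_nu : ∀ i, ContinuousOn (fun z => ν z i) S
  cont_g : ∀ y i j, ContinuousOn (fun z => g z y i j) S
  diff_nu : ∀ i, DifferentiableOn ℂ (fun z => ν z i) U
  diff_g : ∀ y i j, DifferentiableOn ℂ (fun z => g z y i j) U
  cont_K : ContinuousOn K S

/-- A constant `K` is required here so that one integrable majorant serves all parameters in the
dominated convergence arguments. -/
theorem IsTameFamily.volterraTerm_regular (h : IsTameFamily ν g r (fun _ => K) S U)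
    (hr : IsWeight r) (v : ι → ℂ) (n : ℕ) :
    ∀ x i, ContinuousOn (fun z => volterraTerm (ν z) (g z) v n x i) S ∧
      DifferentiableOn ℂ (fun z => volterraTerm (ν z) (g z) v n x i) U := by
  induction n with
  | zero => exact fun x i => ⟨continuousOn_const, differentiableOn_const _⟩
  | succ n ih =>
    intro x i
    rcases S.eq_empty_or_nonempty with hS | ⟨z₀, hz₀⟩
    · have : U = ∅ := subset_empty_iff.1 (hS ▸ h.subset)
      subst hS; subst this
      exact ⟨continuousOn_empty _, differentiableOn_empty⟩
    have hK := (h.tame z₀ hz₀).pos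
    have hs := fun z hz => (h.tame z hz).volterraTerm_spec hr (fun i => norm_le_pi_norm v i) n
    have hB := fun z hz y i => (h.tame z hz).norm_mulVec_le_volterraBound y ((hs z hz).2 y) i
    have hI := hr.integrableOn_volterraBound hK (‖v‖ * (1 / 2) ^ n)
    have hbd : ∀ z ∈ S, ∀ y ∈ Iic x, ‖Complex.exp (ν z i * (x - y : ℝ)) *
        (g z y).mulVec (volterraTerm (ν z) (g z) v n y) i‖ ≤
        volterraBound r K (‖v‖ * (1 / 2) ^ n) y := fun z hz y hy =>
      (norm_exp_mul_le_of_le ((h.tame z hz).re_nonpos i) hy _).trans (hB z hz y i)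
    have hm : ∀ z ∈ S, AEStronglyMeasurable (fun y => Complex.exp (ν z i * (x - y : ℝ)) *
        (g z y).mulVec (volterraTerm (ν z) (g z) v n y) i) (volume.restrict (Iic x)) :=
      fun z hz => (integrableOn_duhamel ((h.tame z hz).re_nonpos i)
        ((h.tame z hz).continuous_mulVec (hs z hz).1 i) hI (hB z hz · i) x).1
    constructor
    · refine continuousOn_of_dominated hm
        (fun z hz => (ae_restrict_mem measurableSet_Iic).mono (hbd z hz)) (hI x)
        (Eventually.of_forall fun y => ?_)
      refine ((h.cont_nu i).mul continuousOn_const).cexp.mul ?_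
      exact continuousOn_finsetSum _ fun j _ => (h.cont_g y i j).mul (ih y j).1
    · refine differentiableOn_integral_of_dominated h.isOpen (fun z hz => hm z (h.subset hz)) (hI x)
        ((ae_restrict_mem measurableSet_Iic).mono fun y hy z hz => hbd z (h.subset hz) y hy)
        (Eventually.of_forall fun y => ?_)
      refine ((h.diff_nu i).mul (differentiableOn_const _)).cexp.mul ?_
      exact DifferentiableOn.fun_sum fun j _ => (h.diff_g y i j).mul (ih y j).2

theorem IsTameFamily.volterraSol_regular_of_const (h : IsTameFamily ν g r (fun _ => K) S U)
    (hr : IsWeight r) (v : ι → ℂ) (x : ℝ) (i : ι) :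
    ContinuousOn (fun z => volterraSol (ν z) (g z) v x i) S ∧
      DifferentiableOn ℂ (fun z => volterraSol (ν z) (g z) v x i) U := by
  have hb : ∀ n, ∀ z ∈ S, ‖volterraTerm (ν z) (g z) v n x i‖ ≤
      ‖v‖ * (1 / 2) ^ n * Real.exp (2 * K * IsWeight.prim r x) := fun n z hz =>
    ((h.tame z hz).volterraTerm_spec hr (fun i => norm_le_pi_norm v i) n).2 x i
  exact ⟨continuousOn_tsum (fun n => (h.volterraTerm_regular hr v n x i).1)
      (summable_geometric_mul _ _) hb,
    Complex.differentiableOn_tsum_of_summable_norm (summable_geometric_mul _ _)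
      (fun n => (h.volterraTerm_regular hr v n x i).2) h.isOpen
      fun n z hz => hb n z (h.subset hz)⟩

/-- The solution of a family of Volterra equations inherits the regularity in the parameter. -/
theorem IsTameFamily.volterraSol_regular {K : ℂ → ℝ} (h : IsTameFamily ν g r K S U)
    (hr : IsWeight r) (v : ι → ℂ) (x : ℝ) (i : ι) :
    ContinuousOn (fun z => volterraSol (ν z) (g z) v x i) S ∧
      DifferentiableOn ℂ (fun z => volterraSol (ν z) (g z) v x i) U := by
  -- Regularity is local, and by continuity `K z₀ + 1` bounds `K` on a relative neighbourhood of
  -- `z₀`.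
  have loc : ∀ z₀ ∈ S, ∃ T, IsOpen T ∧ z₀ ∈ T ∧
      ContinuousOn (fun z => volterraSol (ν z) (g z) v x i) (S ∩ T) ∧
      DifferentiableOn ℂ (fun z => volterraSol (ν z) (g z) v x i) (U ∩ T) := by
    intro z₀ hz₀
    have h1 : ∀ᶠ z in 𝓝[S] z₀, K z < K z₀ + 1 :=
      (h.cont_K z₀ hz₀).eventually_lt_const (lt_add_one _)
    obtain ⟨T, hT, hzT, hTS⟩ := mem_nhdsWithin.1 h1
    refine ⟨T, hT, hzT, IsTameFamily.volterraSol_regular_of_const (K := K z₀ + 1) (r := r) ?_ hr v x i⟩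
    exact
      { isOpen := h.isOpen.inter hT
        subset := inter_subset_inter_left _ h.subset
        tame := fun z hz =>
          { re_nonpos := (h.tame z hz.1).re_nonpos
            cont := (h.tame z hz.1).cont
            pos := by linarith [(h.tame z₀ hz₀).pos]
            bound := fun y i => ((h.tame z hz.1).bound y i).trans
              (mul_le_mul_of_nonneg_right (hTS ⟨hz.2, hz.1⟩).le (hr.nonneg y)) }
        cont_nu := fun i => (h.cont_nu i).mono inter_subset_left
        cont_g := fun y i j => (h.cont_g y i j).mono inter_subset_left
        diff_nu := fun i => (h.diff_nu i).mono inter_subset_left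
        diff_g := fun y i j => (h.diff_g y i j).mono inter_subset_left
        cont_K := continuousOn_const }
  constructor
  · intro z hz
    obtain ⟨T, hT, hzT, hc, -⟩ := loc z hz
    exact (continuousWithinAt_inter (hT.mem_nhds hzT)).1 (hc z ⟨hz, hzT⟩)
  · intro z hz
    obtain ⟨T, hT, hzT, -, hd⟩ := loc z (h.subset hz)
    exact (differentiableWithinAt_inter (hT.mem_nhds hzT)).1 (hd z ⟨hz, hzT⟩)

end Parameter

/-! ### Half planes and uniqueness from boundary values -/

/-- The open upper half plane. -/
abbrev upper : Set ℂ := {z | 0 < z.im}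

/-- The open lower half plane. -/
abbrev lower : Set ℂ := {z | z.im < 0}

theorem isOpen_upper : IsOpen upper := isOpen_lt continuous_const Complex.continuous_im

theorem isOpen_lower : IsOpen lower := isOpen_lt Complex.continuous_im continuous_const

/-- A function which is continuous on a closed square, holomorphic inside and zero on the bottom
edge is zero. -/
theorem eq_zero_on_square {H : ℂ → ℂ} (hd : DifferentiableOn ℂ H (Ioo (-1) 1 ×ℂ Ioo (-1) 1))
    (hc : ContinuousOn H (Icc (-1) 1 ×ℂ Icc (-1) 1))
    (h0 : ∀ x ∈ Icc (-1 : ℝ) 1, H (x - Complex.I) = 0) :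
    ∀ w ∈ Ioo (-1 : ℝ) 1 ×ℂ Ioo (-1 : ℝ) 1, H w = 0 := by
  set Ω : Set ℂ := Ioo (-1 : ℝ) 1 ×ℂ Ioo (-1 : ℝ) 1 with hΩ
  have hopen : IsOpen Ω := isOpen_Ioo.reProdIm isOpen_Ioo
  have hcl : closure Ω = Icc (-1 : ℝ) 1 ×ℂ Icc (-1 : ℝ) 1 := by
    rw [hΩ, Complex.closure_reProdIm, closure_Ioo (by norm_num)]
  have hI : ∀ w ∈ Ω, Complex.I * w ∈ Ω := by
    intro w hw
    simp only [hΩ, Complex.mem_reProdIm, mem_Ioo, Complex.mul_re, Complex.mul_im, Complex.I_re,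
      Complex.I_im] at hw ⊢
    constructor <;> constructor <;> linarith [hw.1.1, hw.1.2, hw.2.1, hw.2.2]
  have hIc : ∀ w ∈ Icc (-1 : ℝ) 1 ×ℂ Icc (-1 : ℝ) 1,
      Complex.I * w ∈ Icc (-1 : ℝ) 1 ×ℂ Icc (-1 : ℝ) 1 := by
    intro w hw
    simp only [Complex.mem_reProdIm, mem_Icc, Complex.mul_re, Complex.mul_im, Complex.I_re,
      Complex.I_im] at hw ⊢
    constructor <;> constructor <;> linarith [hw.1.1, hw.1.2, hw.2.1, hw.2.2]
  have rot : ∀ {G : ℂ → ℂ}, DifferentiableOn ℂ G Ω →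
      DifferentiableOn ℂ (fun w => G (Complex.I * w)) Ω := fun hG =>
    hG.comp (differentiableOn_id.const_mul _) hI
  have rotc : ∀ {G : ℂ → ℂ}, ContinuousOn G (Icc (-1 : ℝ) 1 ×ℂ Icc (-1 : ℝ) 1) →
      ContinuousOn (fun w => G (Complex.I * w)) (Icc (-1 : ℝ) 1 ×ℂ Icc (-1 : ℝ) 1) := fun hG =>
    hG.comp (continuousOn_const.mul continuousOn_id) hIc
  -- The product of the four rotates of `H` vanishes on all four edges, hence inside by the maximum
  -- principle. Analyticity on a connected set then makes one factor vanish identically, and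
  -- rotating back gives `H = 0`.
  have hprod : EqOn (fun w => H w * H (Complex.I * w) *
      (H (Complex.I * (Complex.I * w)) * H (Complex.I * (Complex.I * (Complex.I * w)))))
      (fun _ => 0) Ω := by
    refine Complex.eqOn_of_eqOn_frontier
      ((Metric.isBounded_Ioo _ _).reProdIm (Metric.isBounded_Ioo _ _))
      ⟨(hd.mul (rot hd)).mul ((rot (rot hd)).mul (rot (rot (rot hd)))), ?_⟩
      diffContOnCl_const ?_
    · rw [hcl]
      exact (hc.mul (rotc hc)).mul ((rotc (rotc hc)).mul (rotc (rotc (rotc hc))))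
    · intro w hw
      have hw' : w ∈ Icc (-1 : ℝ) 1 ×ℂ Icc (-1 : ℝ) 1 := by
        rw [← hcl]; exact frontier_subset_closure hw
      have hnot : w ∉ Ω := by
        rw [hopen.frontier_eq] at hw; exact hw.2
      simp only [hΩ, Complex.mem_reProdIm, mem_Ioo, mem_Icc] at hw' hnot
      have e : ∀ p : ℂ, p.im = -1 → p.re ∈ Icc (-1 : ℝ) 1 → H p = 0 := by
        intro p hp hr
        rw [← h0 p.re hr]
        congr 1
        apply Complex.ext <;> simp [hp]
      by_cases h1 : w.im = -1
      · simp [e w h1 hw'.1]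
      by_cases h2 : w.re = -1
      · have : H (Complex.I * w) = 0 := e _ (by simp [h2]) (by
          simp only [Complex.mul_re, Complex.I_re, Complex.I_im, mem_Icc]
          constructor <;> linarith [hw'.2.1, hw'.2.2])
        simp [this]
      by_cases h3 : w.im = 1
      · have : H (Complex.I * (Complex.I * w)) = 0 := e _ (by simp [h3]) (by
          simp only [Complex.mul_re, Complex.mul_im, Complex.I_re, Complex.I_im, mem_Icc]
          constructor <;> linarith [hw'.1.1, hw'.1.2])
        simp [this]
      by_cases h4 : w.re = 1
      · have : H (Complex.I * (Complex.I * (Complex.I * w))) = 0 := e _ (by simp [h4]) (by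
          simp only [Complex.mul_re, Complex.mul_im, Complex.I_re, Complex.I_im, mem_Icc]
          constructor <;> linarith [hw'.2.1, hw'.2.2])
        simp [this]
      exact absurd ⟨⟨lt_of_le_of_ne hw'.1.1 (Ne.symm h2), lt_of_le_of_ne hw'.1.2 h4⟩,
        lt_of_le_of_ne hw'.2.1 (Ne.symm h1), lt_of_le_of_ne hw'.2.2 h3⟩ hnot
  have hconn : IsPreconnected Ω :=
    (((convex_Ioo (-1 : ℝ) 1).linear_preimage Complex.reLm).inter
      ((convex_Ioo (-1 : ℝ) 1).linear_preimage Complex.imLm)).isPreconnected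
  have an : ∀ {G : ℂ → ℂ}, DifferentiableOn ℂ G Ω → AnalyticOnNhd ℂ G Ω := fun hG =>
    hG.analyticOnNhd hopen
  have unrot : ∀ {G : ℂ → ℂ}, (∀ w ∈ Ω, G (Complex.I * w) = 0) → ∀ w ∈ Ω, G w = 0 := by
    intro G hG w hw
    have := hG _ (hI _ (hI _ (hI w hw)))
    rwa [show Complex.I * (Complex.I * (Complex.I * (Complex.I * w))) = w by
      linear_combination (Complex.I * Complex.I - 1) * w * Complex.I_mul_I] at this
  rcases (an (hd.mul (rot hd))).eq_zero_or_eq_zero_of_mul_eq_zero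
    (an ((rot (rot hd)).mul (rot (rot (rot hd))))) hprod hconn with h | h
  · rcases (an hd).eq_zero_or_eq_zero_of_mul_eq_zero (an (rot hd)) h hconn with h | h
    · exact h
    · exact unrot h
  · rcases (an (rot (rot hd))).eq_zero_or_eq_zero_of_mul_eq_zero (an (rot (rot (rot hd)))) h hconn
      with h | h
    · exact unrot (unrot (G := fun w => H (Complex.I * w)) h)
    · exact unrot (unrot (G := fun w => H (Complex.I * w))
        (unrot (G := fun w => H (Complex.I * (Complex.I * w))) h))

namespace Potential

variable (P : Potential)

/-- A half plane together with the continuous spectrum on its boundary. -/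
def dom (U : Set ℂ) : Set ℂ := U ∪ (fun s : ℝ => (s : ℂ)) '' P.spec

variable {P}

theorem subset_dom (U : Set ℂ) : U ⊆ P.dom U := subset_union_left

theorem ofReal_mem_dom {s : ℝ} (hs : s ∈ P.spec) (U : Set ℂ) : (s : ℂ) ∈ P.dom U :=
  Or.inr ⟨s, hs, rfl⟩

theorem conj_mem_dom_lower {z : ℂ} (hz : z ∈ P.dom upper) : conj z ∈ P.dom lower := by
  rcases hz with hz | ⟨s, hs, rfl⟩
  · exact Or.inl (by simpa using hz)
  · exact Or.inr ⟨s, hs, by simp⟩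

theorem conj_mem_dom_upper {z : ℂ} (hz : z ∈ P.dom lower) : conj z ∈ P.dom upper := by
  rcases hz with hz | ⟨s, hs, rfl⟩
  · exact Or.inl (by simpa using hz)
  · exact Or.inr ⟨s, hs, by simp⟩

theorem neg_mem_spec {s : ℝ} (hs : s ∈ P.spec) : -s ∈ P.spec :=
  ⟨neg_ne_zero.2 hs.1, fun h => hs.2.2 (by linarith), fun h => hs.2.1 (by linarith)⟩

theorem neg_mem_dom_lower {z : ℂ} (hz : z ∈ P.dom upper) : -z ∈ P.dom lower := by
  rcases hz with hz | ⟨s, hs, rfl⟩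
  · exact Or.inl (by simpa using hz)
  · exact Or.inr ⟨-s, neg_mem_spec hs, by simp⟩

theorem neg_mem_dom_upper {z : ℂ} (hz : z ∈ P.dom lower) : -z ∈ P.dom upper := by
  rcases hz with hz | ⟨s, hs, rfl⟩
  · exact Or.inl (by simpa using hz)
  · exact Or.inr ⟨-s, neg_mem_spec hs, by simp⟩

theorem inv_mem_spec (hq : P.qo ≠ 0) {s : ℝ} (hs : s ∈ P.spec) : P.qo ^ 2 / s ∈ P.spec := by
  obtain ⟨h0, h1, h2⟩ := hs
  refine ⟨div_ne_zero (pow_ne_zero 2 hq) h0, fun h => h1 ?_, fun h => h2 ?_⟩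
  · rw [div_eq_iff h0, pow_two] at h
    exact (mul_left_cancel₀ hq h).symm
  · rw [div_eq_iff h0] at h
    have : P.qo * P.qo = P.qo * -s := by linarith
    linarith [mul_left_cancel₀ hq this]

theorem inv_im (q : ℝ) (z : ℂ) : ((q : ℂ) ^ 2 / z).im = -(q ^ 2 * z.im / Complex.normSq z) := by
  simp only [← Complex.ofReal_pow, Complex.div_im, Complex.ofReal_im, Complex.ofReal_re]
  ring

theorem inv_mem_lower (hq : P.qo ≠ 0) {z : ℂ} (hz : z ∈ upper) :
    (P.qo : ℂ) ^ 2 / z ∈ lower := by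
  have h : 0 < z.im := hz
  have : z ≠ 0 := fun h0 => by simp [h0] at h
  have := Complex.normSq_pos.2 this
  change ((P.qo : ℂ) ^ 2 / z).im < 0
  rw [inv_im, neg_lt_zero]
  positivity

theorem inv_mem_upper (hq : P.qo ≠ 0) {z : ℂ} (hz : z ∈ lower) :
    (P.qo : ℂ) ^ 2 / z ∈ upper := by
  have h : z.im < 0 := hz
  have : z ≠ 0 := fun h0 => by simp [h0] at h
  have := Complex.normSq_pos.2 this
  change 0 < ((P.qo : ℂ) ^ 2 / z).im
  rw [inv_im, Left.neg_pos_iff]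
  exact div_neg_of_neg_of_pos (mul_neg_of_pos_of_neg (by positivity) h) this

theorem inv_mem_dom_lower (hq : P.qo ≠ 0) {z : ℂ} (hz : z ∈ P.dom upper) :
    (P.qo : ℂ) ^ 2 / z ∈ P.dom lower := by
  rcases hz with hz | ⟨s, hs, rfl⟩
  · exact Or.inl (inv_mem_lower hq hz)
  · exact Or.inr ⟨_, inv_mem_spec hq hs, by push_cast; rfl⟩

theorem inv_mem_dom_upper (hq : P.qo ≠ 0) {z : ℂ} (hz : z ∈ P.dom lower) :
    (P.qo : ℂ) ^ 2 / z ∈ P.dom upper := by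
  rcases hz with hz | ⟨s, hs, rfl⟩
  · exact Or.inl (inv_mem_upper hq hz)
  · exact Or.inr ⟨_, inv_mem_spec hq hs, by push_cast; rfl⟩

theorem ne_zero_of_mem_dom_upper {z : ℂ} (hz : z ∈ P.dom upper) : z ≠ 0 := by
  rcases hz with hz | ⟨s, hs, rfl⟩
  · rintro rfl; simp at hz
  · exact Complex.ofReal_ne_zero.2 hs.1

theorem ne_zero_of_mem_dom_lower {z : ℂ} (hz : z ∈ P.dom lower) : z ≠ 0 := by
  rw [← map_ne_zero (starRingEnd ℂ)]
  exact ne_zero_of_mem_dom_upper (conj_mem_dom_upper hz)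

theorem gam_ne_zero_of_mem_dom_upper {z : ℂ} (hz : z ∈ P.dom upper) : P.gam z ≠ 0 := by
  have h0 := ne_zero_of_mem_dom_upper hz
  intro h
  have h1 : (z - P.qo) * (z + P.qo) = 0 := by
    rw [gam, sub_eq_zero, eq_div_iff (pow_ne_zero 2 h0)] at h
    linear_combination h
  have h2 : z = P.qo ∨ z = -P.qo := (mul_eq_zero.1 h1).imp sub_eq_zero.1 eq_neg_of_add_eq_zero_left
  rcases hz with hz | ⟨s, hs, rfl⟩
  · rcases h2 with rfl | rfl <;> simp at hz
  · rcases h2 with h2 | h2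
    · exact hs.2.1 (Complex.ofReal_injective h2)
    · exact hs.2.2 (Complex.ofReal_injective (by simpa using h2))

theorem gam_conj (z : ℂ) : P.gam (conj z) = conj (P.gam z) := by simp [gam]

theorem gam_neg (z : ℂ) : P.gam (-z) = P.gam z := by simp [gam]

theorem gam_ne_zero_of_mem_dom_lower {z : ℂ} (hz : z ∈ P.dom lower) : P.gam z ≠ 0 := by
  rw [← map_ne_zero (starRingEnd ℂ), ← gam_conj]
  exact gam_ne_zero_of_mem_dom_upper (conj_mem_dom_upper hz)

/-! ### Calculus of functions regular up to the spectrum -/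

/-- `F` is holomorphic in the half plane `U` and continuous up to the spectrum. -/
structure Reg {V : Type} [NormedAddCommGroup V] [NormedSpace ℂ V] (P : Potential) (U : Set ℂ)
    (F : ℂ → V) : Prop where
  diff : DifferentiableOn ℂ F U
  cont : ContinuousOn F (P.dom U)

namespace Reg

variable {U : Set ℂ} {V : Type} [NormedAddCommGroup V] [NormedSpace ℂ V]

theorem const (c : V) : P.Reg U fun _ => c := ⟨differentiableOn_const _, continuousOn_const⟩

theorem id : P.Reg U fun z => z := ⟨differentiableOn_id, continuousOn_id⟩

theorem add {F G : ℂ → V} (hF : P.Reg U F) (hG : P.Reg U G) : P.Reg U fun z => F z + G z :=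
  ⟨hF.diff.add hG.diff, hF.cont.add hG.cont⟩

theorem sub {F G : ℂ → V} (hF : P.Reg U F) (hG : P.Reg U G) : P.Reg U fun z => F z - G z :=
  ⟨hF.diff.sub hG.diff, hF.cont.sub hG.cont⟩

theorem neg {F : ℂ → V} (hF : P.Reg U F) : P.Reg U fun z => -F z :=
  ⟨hF.diff.neg, hF.cont.neg⟩

theorem smul {f : ℂ → ℂ} {F : ℂ → V} (hf : P.Reg U f) (hF : P.Reg U F) :
    P.Reg U fun z => f z • F z :=
  ⟨hf.diff.smul hF.diff, hf.cont.smul hF.cont⟩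

theorem mul {F G : ℂ → ℂ} (hF : P.Reg U F) (hG : P.Reg U G) : P.Reg U fun z => F z * G z :=
  ⟨hF.diff.mul hG.diff, hF.cont.mul hG.cont⟩

theorem sum {ι : Type} (s : Finset ι) {F : ι → ℂ → V} (hF : ∀ i, P.Reg U (F i)) :
    P.Reg U fun z => ∑ i ∈ s, F i z :=
  ⟨DifferentiableOn.fun_sum fun i _ => (hF i).diff, continuousOn_finsetSum _ fun i _ => (hF i).cont⟩

theorem inv {F : ℂ → ℂ} (hF : P.Reg U F) (h : ∀ z ∈ P.dom U, F z ≠ 0) : P.Reg U fun z => (F z)⁻¹ :=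
  ⟨hF.diff.inv fun z hz => h z (subset_dom U hz), hF.cont.inv₀ h⟩

theorem div {F G : ℂ → ℂ} (hF : P.Reg U F) (hG : P.Reg U G) (h : ∀ z ∈ P.dom U, G z ≠ 0) :
    P.Reg U fun z => F z / G z := by
  simp only [div_eq_mul_inv]
  exact hF.mul (hG.inv h)

theorem pi {n : ℕ} {F : ℂ → Fin n → ℂ} (hF : ∀ i, P.Reg U fun z => F z i) : P.Reg U F :=
  ⟨differentiableOn_pi.2 fun i => (hF i).diff, continuousOn_pi.2 fun i => (hF i).cont⟩

theorem apply {n : ℕ} {F : ℂ → Fin n → ℂ} (hF : P.Reg U F) (i : Fin n) : P.Reg U fun z => F z i :=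
  ⟨differentiableOn_pi.1 hF.diff i, continuousOn_pi.1 hF.cont i⟩

theorem comp {U' : Set ℂ} {F : ℂ → V} {φ : ℂ → ℂ} (hF : P.Reg U' F) (hφ : P.Reg U φ)
    (h1 : ∀ z ∈ U, φ z ∈ U') (h2 : ∀ z ∈ P.dom U, φ z ∈ P.dom U') : P.Reg U fun z => F (φ z) :=
  ⟨hF.diff.comp hφ.diff h1, hF.cont.comp hφ.cont h2⟩

theorem comp_neg_upper {F : ℂ → V} (hF : P.Reg upper F) : P.Reg lower fun z => F (-z) :=
  hF.comp id.neg (fun z hz => by simpa using hz) fun z hz => neg_mem_dom_upper hz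

theorem comp_neg_lower {F : ℂ → V} (hF : P.Reg lower F) : P.Reg upper fun z => F (-z) :=
  hF.comp id.neg (fun z hz => by simpa using hz) fun z hz => neg_mem_dom_lower hz

theorem comp_inv_upper (hq : P.qo ≠ 0) {F : ℂ → V} (hF : P.Reg upper F) :
    P.Reg lower fun z => F ((P.qo : ℂ) ^ 2 / z) :=
  hF.comp ((const _).div id fun _ hz => ne_zero_of_mem_dom_lower hz)
    (fun _ hz => inv_mem_upper hq hz) fun _ hz => inv_mem_dom_upper hq hz

theorem comp_inv_lower (hq : P.qo ≠ 0) {F : ℂ → V} (hF : P.Reg lower F) :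
    P.Reg upper fun z => F ((P.qo : ℂ) ^ 2 / z) :=
  hF.comp ((const _).div id fun _ hz => ne_zero_of_mem_dom_upper hz)
    (fun _ hz => inv_mem_lower hq hz) fun _ hz => inv_mem_dom_lower hq hz

theorem conj_conj_upper {F : ℂ → ℂ} (hF : P.Reg upper F) :
    P.Reg lower fun z => conj (F (conj z)) := by
  refine ⟨fun z hz => ?_, ?_⟩
  · have h1 : conj z ∈ upper := by simpa using hz
    have h2 := ((hF.diff _ h1).differentiableAt (isOpen_upper.mem_nhds h1)).conj_conj
    rw [Complex.conj_conj] at h2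
    exact h2.differentiableWithinAt
  · exact Complex.continuous_conj.comp_continuousOn
      (hF.cont.comp Complex.continuous_conj.continuousOn fun z hz => conj_mem_dom_upper hz)

theorem conj_conj_lower {F : ℂ → ℂ} (hF : P.Reg lower F) :
    P.Reg upper fun z => conj (F (conj z)) := by
  refine ⟨fun z hz => ?_, ?_⟩
  · have h1 : conj z ∈ lower := by simpa using hz
    have h2 := ((hF.diff _ h1).differentiableAt (isOpen_lower.mem_nhds h1)).conj_conj
    rw [Complex.conj_conj] at h2
    exact h2.differentiableWithinAt
  · exact Complex.continuous_conj.comp_continuousOn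
      (hF.cont.comp Complex.continuous_conj.continuousOn fun z hz => conj_mem_dom_lower hz)

theorem gam_upper : P.Reg upper P.gam := by
  have := (const (P := P) (U := upper) (1 : ℂ)).sub ((const ((P.qo : ℂ) ^ 2)).div (id.mul id)
    fun z hz => mul_ne_zero (ne_zero_of_mem_dom_upper hz) (ne_zero_of_mem_dom_upper hz))
  have h : P.gam = fun z => 1 - (P.qo : ℂ) ^ 2 / (z * z) := by funext z; rw [gam, pow_two z]
  rw [h]
  exact this

theorem differentiableAt_upper {F : ℂ → V} (hF : P.Reg upper F) {z : ℂ} (hz : z ∈ upper) :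
    DifferentiableAt ℂ F z :=
  (hF.diff z hz).differentiableAt (isOpen_upper.mem_nhds hz)

/-- A function in the upper half plane with boundary values zero is zero. -/
theorem eq_zero_scalar {F : ℂ → ℂ} (hF : P.Reg upper F) (h0 : ∀ s ∈ P.spec, F s = 0) :
    ∀ z ∈ upper, F z = 0 := by
  -- The square of half-side 1 about `c = a + i` stands on `[a - 1, a + 1]`, which avoids the
  -- excluded points `0` and `±q_o`. Once `F` vanishes in the square, the identity theorem extends
  -- this to the half plane.
  set a : ℝ := |P.qo| + 2 with ha
  set c : ℂ := a + Complex.I with hc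
  have hre : ∀ w : ℂ, (c + w).re = a + w.re := fun w => by simp [hc]
  have him : ∀ w : ℂ, (c + w).im = 1 + w.im := fun w => by simp [hc]
  have hspec : ∀ x : ℝ, -1 ≤ x → a + x ∈ P.spec := by
    intro x hx
    have h1 := le_abs_self P.qo
    have h2 := neg_abs_le P.qo
    have h3 := abs_nonneg P.qo
    refine ⟨?_, ?_, ?_⟩ <;> (rw [ha]; intro h; linarith)
  have hsq := eq_zero_on_square (H := fun w => F (c + w))
    (hF.diff.comp (differentiableOn_id.const_add c) fun w hw => by
      have := (Complex.mem_reProdIm.1 hw).2.1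
      change 0 < (c + w).im
      rw [him]; linarith)
    (hF.cont.comp (continuousOn_const.add continuousOn_id) fun w hw => by
      have h1 := (Complex.mem_reProdIm.1 hw).2.1
      have h2 := (Complex.mem_reProdIm.1 hw).1.1
      rcases h1.eq_or_lt with h | h
      · refine Or.inr ⟨a + w.re, hspec _ h2, ?_⟩
        apply Complex.ext <;> simp [hc, ← h]
      · left
        change 0 < (c + w).im
        rw [him]; linarith)
    (fun x hx => by
      have : c + (x - Complex.I) = ((a + x : ℝ) : ℂ) := by rw [hc]; push_cast; ring
      simp only [this]
      exact h0 _ (hspec x hx.1))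
  have hcU : c ∈ upper := by
    change 0 < c.im
    simp [hc]
  have han : AnalyticOnNhd ℂ F upper := hF.diff.analyticOnNhd isOpen_upper
  refine han.eqOn_zero_of_preconnected_of_eventuallyEq_zero
    (convex_halfSpace_im_gt 0).isPreconnected hcU ?_
  have hnhds : ∀ᶠ w in 𝓝 c, w - c ∈ Ioo (-1 : ℝ) 1 ×ℂ Ioo (-1 : ℝ) 1 := by
    have : Tendsto (fun w => w - c) (𝓝 c) (𝓝 0) := by
      simpa using (continuous_id.sub continuous_const).tendsto (x := c) (f := fun w : ℂ => w - c)
    refine this ((isOpen_Ioo.reProdIm isOpen_Ioo).mem_nhds ?_)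
    simp [Complex.mem_reProdIm]
  filter_upwards [hnhds] with w hw
  simpa using hsq _ hw

theorem eq_zero_upper {F : ℂ → V} (hF : P.Reg upper F) (h0 : ∀ s ∈ P.spec, F s = 0) {z : ℂ}
    (hz : z ∈ upper) : F z = 0 := by
  refine SeparatingDual.eq_zero_of_forall_dual_eq_zero (R := ℂ) fun f => ?_
  refine eq_zero_scalar (P := P) (F := fun z => f (F z)) ⟨?_, ?_⟩ (fun s hs => ?_) z hz
  · exact f.differentiable.comp_differentiableOn hF.diff
  · exact f.continuous.comp_continuousOn hF.cont
  · rw [h0 s hs, map_zero]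

theorem eq_of_eq_spec_upper {F G : ℂ → V} (hF : P.Reg upper F) (hG : P.Reg upper G)
    (h : ∀ s ∈ P.spec, F s = G s) {z : ℂ} (hz : z ∈ upper) : F z = G z :=
  sub_eq_zero.1 ((hF.sub hG).eq_zero_upper (fun s hs => sub_eq_zero.2 (h s hs)) hz)

theorem eq_of_eq_spec_lower {F G : ℂ → V} (hF : P.Reg lower F) (hG : P.Reg lower G)
    (h : ∀ s ∈ P.spec, F s = G s) {z : ℂ} (hz : z ∈ lower) : F z = G z := by
  have := hF.comp_neg_lower.eq_of_eq_spec_upper hG.comp_neg_lower (z := -z)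
    (fun s hs => by simpa using h (-s) (neg_mem_spec hs)) (by simpa using hz)
  simpa using this

/-- The analytic continuation of `f` is any regular function with boundary values `f`. -/
theorem extUp_eq {f : ℝ → V} {F : ℂ → V} (hF : P.Reg upper F) (h : ∀ s ∈ P.spec, F s = f s) {z : ℂ}
    (hz : z ∈ upper) : P.extUp f z = F z := by
  have hs : P.IsExtension {z | 0 < z.im} f (P.extUp f) :=
    Classical.epsilon_spec (p := P.IsExtension {z | 0 < z.im} f) ⟨F, hF.diff, hF.cont, h⟩
  exact eq_of_eq_spec_upper ⟨hs.1, hs.2.1⟩ hF (fun s hs' => (hs.2.2 s hs').trans (h s hs').symm) hz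

theorem extDown_eq {f : ℝ → V} {F : ℂ → V} (hF : P.Reg lower F) (h : ∀ s ∈ P.spec, F s = f s)
    {z : ℂ} (hz : z ∈ lower) : P.extDown f z = F z := by
  have hs : P.IsExtension {z | z.im < 0} f (P.extDown f) :=
    Classical.epsilon_spec (p := P.IsExtension {z | z.im < 0} f) ⟨F, hF.diff, hF.cont, h⟩
  exact eq_of_eq_spec_lower ⟨hs.1, hs.2.1⟩ hF (fun s hs' => (hs.2.2 s hs').trans (h s hs').symm) hz

theorem deriv_extUp_eq {f : ℝ → V} {F : ℂ → V} (hF : P.Reg upper F) (h : ∀ s ∈ P.spec, F s = f s)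
    {z : ℂ} (hz : z ∈ upper) : deriv (P.extUp f) z = deriv F z :=
  Filter.EventuallyEq.deriv_eq (Filter.eventually_of_mem (isOpen_upper.mem_nhds hz)
    fun _ hw => hF.extUp_eq h hw)

theorem deriv_extDown_eq {f : ℝ → V} {F : ℂ → V} (hF : P.Reg lower F) (h : ∀ s ∈ P.spec, F s = f s)
    {z : ℂ} (hz : z ∈ lower) : deriv (P.extDown f) z = deriv F z :=
  Filter.EventuallyEq.deriv_eq (Filter.eventually_of_mem (isOpen_lower.mem_nhds hz)
    fun _ hw => hF.extDown_eq h hw)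

end Reg

end Potential

/-! ### Eigenbasis of the scattering problem with constant potential -/

namespace Potential

variable (P : Potential)

/-- The derivatives in `x` of the exponents `iΘ`. -/
noncomputable def mu (z : ℂ) : Fin 4 → ℂ :=
  ![-(Complex.I * P.lam z), Complex.I * P.k z, Complex.I * P.k z, Complex.I * P.lam z]

/-- The exponents `iΘ(x,t,z)`. -/
noncomputable def expo (x t : ℝ) (z : ℂ) : Fin 4 → ℂ :=
  ![Complex.I * P.theta1 x t z, Complex.I * P.theta2 x t z, Complex.I * P.theta2 x t z,
    -(Complex.I * P.theta1 x t z)]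

/-- The inverse of `E(z)`. -/
noncomputable def Einv (c z : ℂ) : Matrix (Fin 4) (Fin 4) ℂ :=
  !![1 / P.gam z, 0, 0, Complex.I * conj c / (z * P.gam z);
     0, 1, 0, 0;
     0, 0, 1, 0;
     -(Complex.I * c) / (z * P.gam z), 0, 0, 1 / P.gam z]

theorem expTheta_eq (x t : ℝ) (z : ℂ) :
    P.expTheta x t z = Matrix.diagonal fun i => Complex.exp (P.expo x t z i) := by
  rw [expTheta]
  congr 1
  funext i
  fin_cases i <;> rfl

theorem hasDerivAt_expo (x t : ℝ) (z : ℂ) (i : Fin 4) :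
    HasDerivAt (fun x => P.expo x t z i) (P.mu z i) x := by
  have h1 : HasDerivAt (fun x => P.theta1 x t z) (-P.lam z) x := by
    have := ((hasDerivAt_id x).ofReal_comp.const_mul (-P.lam z)).add_const
      (2 * P.k z * P.lam z * t)
    exact this.congr_deriv (by simp)
  have h2 : HasDerivAt (fun x => P.theta2 x t z) (P.k z) x := by
    have := ((hasDerivAt_id x).ofReal_comp.const_mul (P.k z)).sub_const
      ((P.k z ^ 2 + P.lam z ^ 2) * t)
    exact this.congr_deriv (by simp)
  have h3 := h1.const_mul Complex.I
  have h4 := h2.const_mul Complex.I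
  fin_cases i
  · exact h3.congr_deriv (by simp [mu])
  · exact h4
  · exact h4
  · exact h3.neg.congr_deriv (by simp [mu])

theorem E_eq (c z : ℂ) : E c z =
    !![1, 0, 0, -(Complex.I * conj c) / z;
       0, 1, 0, 0;
       0, 0, 1, 0;
       Complex.I * c / z, 0, 0, 1] := by
  ext i j
  fin_cases i <;> fin_cases j <;>
    simp [E, J, Q, bvec, Matrix.diagonal_mul] <;> ring

variable {P}

theorem mul_conj_eq {c : ℂ} (hc : ‖c‖ = P.qo) : c * conj c = (P.qo : ℂ) ^ 2 := by
  rw [Complex.mul_conj, Complex.normSq_eq_norm_sq, hc]; push_cast; rfl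

theorem gam_mul_sq {z : ℂ} (h0 : z ≠ 0) : P.gam z * z ^ 2 = z ^ 2 - (P.qo : ℂ) ^ 2 := by
  rw [gam]; field_simp

theorem E_mul_Einv {c z : ℂ} (hc : ‖c‖ = P.qo) (h0 : z ≠ 0) (hg : P.gam z ≠ 0) :
    E c z * P.Einv c z = 1 := by
  have h1 := mul_conj_eq hc
  have h2 := gam_mul_sq (P := P) h0
  rw [E_eq]
  ext i j
  fin_cases i <;> fin_cases j <;>
    simp [Einv, Matrix.mul_apply, Fin.sum_univ_four] <;> field_simp <;>
    first | ring1 | (simp only [Complex.I_sq]; linear_combination -h1 - h2)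

theorem Einv_mul_E {c z : ℂ} (hc : ‖c‖ = P.qo) (h0 : z ≠ 0) (hg : P.gam z ≠ 0) :
    P.Einv c z * E c z = 1 :=
  mul_eq_one_comm.1 (E_mul_Einv hc h0 hg)

theorem J_eq : J = !![1, 0, 0, 0; 0, -1, 0, 0; 0, 0, -1, 0; 0, 0, 0, -1] := by
  ext i j
  fin_cases i <;> fin_cases j <;> simp [J, Matrix.diagonal]

theorem smul_J_add_Q (a : ℂ) (v : Fin 3 → ℂ) : -a • J + Q v =
    !![-a, conj (v 0), conj (v 1), conj (v 2);
       v 0, a, 0, 0;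
       v 1, 0, a, 0;
       v 2, 0, 0, a] := by
  rw [J_eq]
  ext i j
  fin_cases i <;> fin_cases j <;> simp [Q]

theorem X_mul_E {c z : ℂ} (hc : ‖c‖ = P.qo) (h0 : z ≠ 0) :
    (-(Complex.I * P.k z) • J + Q (bvec c)) * E c z =
      E c z * Matrix.diagonal (P.mu z) := by
  have h1 := mul_conj_eq hc
  have h2 : 2 * z * P.k z = z ^ 2 + (P.qo : ℂ) ^ 2 := by rw [k]; field_simp
  have h3 : 2 * z * P.lam z = z ^ 2 - (P.qo : ℂ) ^ 2 := by rw [lam]; field_simp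
  have h6 : P.k z + P.lam z = z := by rw [k, lam]; ring
  rw [E_eq, smul_J_add_Q]
  ext i j
  rw [Matrix.mul_diagonal]
  fin_cases i <;> fin_cases j <;>
    simp [bvec, mu, Matrix.mul_apply, Fin.sum_univ_four] <;>
    field_simp <;> (try simp only [Complex.I_sq])
  · linear_combination h1 - (h2 - h3) / 2
  · linear_combination -conj c * h6
  · linear_combination -c * h6
  · linear_combination -h1 + (h2 - h3) / 2

/-! ### The system in the eigenbasis at `-∞` -/

/-- The perturbation `Q(x,t) - Q_-`. -/
noncomputable def pert (P : Potential) (t y : ℝ) : Matrix (Fin 4) (Fin 4) ℂ :=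
  Q (P.q y t) - Q (bvec P.qm)

/-- The perturbation in the eigenbasis of `-ikJ + Q_-`. -/
noncomputable def pertE (P : Potential) (t : ℝ) (z : ℂ) (y : ℝ) : Matrix (Fin 4) (Fin 4) ℂ :=
  P.Einv P.qm z * P.pert t y * E P.qm z

/-- The weight `‖q(x,t) - q_-‖`. -/
noncomputable def weight (P : Potential) (t y : ℝ) : ℝ := ‖P.q y t - bvec P.qm‖

theorem IsAdmissibleAt.isWeight {t : ℝ} (hP : P.IsAdmissibleAt t) : IsWeight (P.weight t) := by
  have hc : Continuous fun x => P.q x t - bvec P.qm := hP.continuous_q.sub continuous_const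
  exact ⟨hc.norm, fun x => norm_nonneg _,
    fun x => integrableOn_Iic_of_continuous hc.norm hP.integrable_bot.norm x⟩

theorem norm_pert_le (t y : ℝ) (i j : Fin 4) : ‖P.pert t y i j‖ ≤ P.weight t y := by
  have h : ∀ a : Fin 3, ‖P.q y t a - bvec P.qm a‖ ≤ P.weight t y := fun a =>
    norm_le_pi_norm (P.q y t - bvec P.qm) a
  have h' : ∀ a : Fin 3, ‖conj (P.q y t a) - conj (bvec P.qm a)‖ ≤ P.weight t y := fun a => by
    rw [← map_sub, RCLike.norm_conj]; exact h a
  have h0 : 0 ≤ P.weight t y := norm_nonneg _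
  fin_cases i <;> fin_cases j <;> simp [pert, Q, h0] <;> first | exact h _ | exact h' _

theorem continuous_pert {t : ℝ} (hP : P.IsAdmissibleAt t) (i j : Fin 4) :
    Continuous fun y => P.pert t y i j := by
  have h : ∀ a : Fin 3, Continuous fun y => P.q y t a := fun a =>
    (continuous_apply a).comp hP.continuous_q
  have h' : ∀ a : Fin 3, Continuous fun y => conj (P.q y t a) := fun a =>
    Complex.continuous_conj.comp (h a)
  fin_cases i <;> fin_cases j <;> simp [pert, Q] <;>
    first | exact continuous_const | exact (h _).sub continuous_const |
      exact (h' _).sub continuous_const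

/-- The constant in the bound of `pertE` by `weight`. -/
noncomputable def pertBound (P : Potential) (z : ℂ) : ℝ :=
  1 + ∑ i, ∑ j, ∑ l, ∑ m, ‖P.Einv P.qm z i m‖ * ‖E P.qm z l j‖

theorem pertBound_pos (z : ℂ) : 0 < P.pertBound z := by
  have : 0 ≤ ∑ i, ∑ j, ∑ l, ∑ m, ‖P.Einv P.qm z i m‖ * ‖E P.qm z l j‖ := by positivity
  rw [pertBound]; linarith

theorem pertE_apply (t : ℝ) (z : ℂ) (y : ℝ) (i j : Fin 4) :
    P.pertE t z y i j = ∑ l, (∑ m, P.Einv P.qm z i m * P.pert t y m l) * E P.qm z l j := by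
  simp only [pertE, Matrix.mul_apply]

theorem sum_norm_pertE_le (t : ℝ) (z : ℂ) (y : ℝ) (i : Fin 4) :
    ∑ j, ‖P.pertE t z y i j‖ ≤ P.pertBound z * P.weight t y := by
  have hw : 0 ≤ P.weight t y := norm_nonneg _
  have h1 : ∀ j, ‖P.pertE t z y i j‖ ≤
      (∑ l, ∑ m, ‖P.Einv P.qm z i m‖ * ‖E P.qm z l j‖) * P.weight t y := by
    intro j
    rw [pertE_apply, Finset.sum_mul]
    refine (norm_sum_le _ _).trans (Finset.sum_le_sum fun l _ => ?_)
    rw [norm_mul, Finset.sum_mul]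
    refine (mul_le_mul_of_nonneg_right (norm_sum_le _ _) (norm_nonneg _)).trans ?_
    rw [Finset.sum_mul]
    refine Finset.sum_le_sum fun m _ => ?_
    rw [norm_mul, mul_right_comm]
    exact mul_le_mul_of_nonneg_left (norm_pert_le t y m l) (by positivity)
  refine (Finset.sum_le_sum fun j _ => h1 j).trans ?_
  rw [← Finset.sum_mul]
  refine mul_le_mul_of_nonneg_right ?_ hw
  refine le_add_of_nonneg_of_le zero_le_one ?_
  exact Finset.single_le_sum
    (f := fun i => ∑ j, ∑ l, ∑ m, ‖P.Einv P.qm z i m‖ * ‖E P.qm z l j‖)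
    (fun i _ => by positivity) (Finset.mem_univ i)

theorem continuous_pertE {t : ℝ} (hP : P.IsAdmissibleAt t) (z : ℂ) (i j : Fin 4) :
    Continuous fun y => P.pertE t z y i j := by
  simp only [pertE_apply]
  exact continuous_finsetSum _ fun l _ => (continuous_finsetSum _ fun m _ =>
    continuous_const.mul (continuous_pert hP m l)).mul continuous_const

theorem Reg.E_upper (c : ℂ) (i j : Fin 4) : P.Reg upper fun z => E c z i j := by
  have h : ∀ a : ℂ, P.Reg upper fun z => a / z := fun a =>
    (Reg.const a).div Reg.id fun _ hz => ne_zero_of_mem_dom_upper hz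
  simp only [E_eq]
  fin_cases i <;> fin_cases j <;> first | exact Reg.const _ | exact h _

theorem Reg.Einv_upper (c : ℂ) (i j : Fin 4) : P.Reg upper fun z => P.Einv c z i j := by
  have h : ∀ a : ℂ, P.Reg upper fun z => a / P.gam z := fun a =>
    (Reg.const a).div Reg.gam_upper fun _ hz => gam_ne_zero_of_mem_dom_upper hz
  have h' : ∀ a : ℂ, P.Reg upper fun z => a / (z * P.gam z) := fun a =>
    (Reg.const a).div (Reg.id.mul Reg.gam_upper) fun _ hz =>
      mul_ne_zero (ne_zero_of_mem_dom_upper hz) (gam_ne_zero_of_mem_dom_upper hz)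
  fin_cases i <;> fin_cases j <;> first | exact Reg.const _ | exact h _ | exact h' _

theorem Reg.pertE_upper (t y : ℝ) (i j : Fin 4) : P.Reg upper fun z => P.pertE t z y i j := by
  simp only [pertE_apply]
  exact Reg.sum _ fun l => (Reg.sum _ fun m => (Reg.Einv_upper _ i m).mul (Reg.const _)).mul
    (Reg.E_upper _ l j)

theorem continuousOn_pertBound : ContinuousOn P.pertBound (P.dom upper) := by
  unfold pertBound
  exact continuousOn_const.add (continuousOn_finsetSum _ fun i _ => continuousOn_finsetSum _
    fun j _ => continuousOn_finsetSum _ fun l _ => continuousOn_finsetSum _ fun m _ =>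
      (Reg.Einv_upper _ i m).cont.norm.mul (Reg.E_upper _ l j).cont.norm)

theorem isTame_pertE {t : ℝ} (hP : P.IsAdmissibleAt t) (z : ℂ) {ν : Fin 4 → ℂ}
    (hν : ∀ i, (ν i).re ≤ 0) : IsTame ν (P.pertE t z) (P.weight t) (P.pertBound z) :=
  ⟨hν, continuous_pertE hP z, pertBound_pos z, sum_norm_pertE_le t z⟩

open scoped Kronecker in
/-- The perturbation which acts on 2-tensors. -/
noncomputable def pertE2 (P : Potential) (t : ℝ) (z : ℂ) (y : ℝ) :
    Matrix (Fin 4 × Fin 4) (Fin 4 × Fin 4) ℂ :=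
  P.pertE t z y ⊗ₖ 1 + 1 ⊗ₖ P.pertE t z y

theorem pertE2_apply (t : ℝ) (z : ℂ) (y : ℝ) (i j : Fin 4 × Fin 4) :
    P.pertE2 t z y i j = P.pertE t z y i.1 j.1 * (1 : Matrix (Fin 4) (Fin 4) ℂ) i.2 j.2 +
      (1 : Matrix (Fin 4) (Fin 4) ℂ) i.1 j.1 * P.pertE t z y i.2 j.2 := rfl

/-- A row sum of `g ⊗ 1 + 1 ⊗ g` is at most the sum of two row sums of `g`; hence the doubled
constant. -/
theorem isTame_pertE2 {t : ℝ} (hP : P.IsAdmissibleAt t) (z : ℂ) {ν : Fin 4 × Fin 4 → ℂ}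
    (hν : ∀ i, (ν i).re ≤ 0) : IsTame ν (P.pertE2 t z) (P.weight t) (2 * P.pertBound z) := by
  refine ⟨hν, fun i j => ?_, mul_pos two_pos (pertBound_pos z), fun y i => ?_⟩
  · simp only [pertE2_apply]
    exact ((continuous_pertE hP z _ _).mul continuous_const).add
      (continuous_const.mul (continuous_pertE hP z _ _))
  · have h1 := sum_norm_pertE_le (P := P) t z y i.1
    have h2 := sum_norm_pertE_le (P := P) t z y i.2
    refine (Finset.sum_le_sum fun j _ => norm_add_le _ _).trans ?_
    rw [Finset.sum_add_distrib]
    have e1 : ∑ j : Fin 4 × Fin 4, ‖P.pertE t z y i.1 j.1 *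
        (1 : Matrix (Fin 4) (Fin 4) ℂ) i.2 j.2‖ = ∑ j, ‖P.pertE t z y i.1 j‖ := by
      rw [Fintype.sum_prod_type]
      refine Finset.sum_congr rfl fun a _ => ?_
      simp [Matrix.one_apply, apply_ite]
    have e2 : ∑ j : Fin 4 × Fin 4, ‖(1 : Matrix (Fin 4) (Fin 4) ℂ) i.1 j.1 *
        P.pertE t z y i.2 j.2‖ = ∑ j, ‖P.pertE t z y i.2 j‖ := by
      rw [Fintype.sum_prod_type_right]
      refine Finset.sum_congr rfl fun a _ => ?_
      simp [Matrix.one_apply, apply_ite]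
    calc _ = ∑ j, ‖P.pertE t z y i.1 j‖ + ∑ j, ‖P.pertE t z y i.2 j‖ := by rw [← e1, ← e2]; rfl
      _ ≤ _ := by linarith

end Potential

theorem hasDerivAt_mulVec {n m : Type*} [Fintype n] (M : Matrix m n ℂ) {u : ℝ → n → ℂ}
    {u' : n → ℂ} {x : ℝ} (hu : ∀ j, HasDerivAt (fun x => u x j) (u' j) x) (i : m) :
    HasDerivAt (fun x => M.mulVec (u x) i) (M.mulVec u' i) x :=
  HasDerivAt.fun_sum fun j _ => (hu j).const_mul (M i j)

theorem tendsto_mulVec {n m : Type*} [Fintype n] (M : Matrix m n ℂ) {u : ℝ → n → ℂ}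
    {a : n → ℂ} {l : Filter ℝ} (hu : ∀ j, Tendsto (fun x => u x j) l (𝓝 (a j))) (i : m) :
    Tendsto (fun x => M.mulVec (u x) i) l (𝓝 (M.mulVec a i)) :=
  tendsto_finsetSum _ fun j _ => (hu j).const_mul (M i j)

/-! ### Jost columns at `-∞` -/

namespace Potential

variable {P : Potential}

theorem lam_im (z : ℂ) : (P.lam z).im = z.im * (1 + P.qo ^ 2 / Complex.normSq z) / 2 := by
  rw [lam, show (2 : ℂ) = ((2 : ℝ) : ℂ) by norm_num, Complex.div_ofReal_im, Complex.sub_im, inv_im]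
  ring

theorem k_add_lam (z : ℂ) : P.k z + P.lam z = z := by rw [k, lam]; ring

theorem k_sub_lam (z : ℂ) : P.k z - P.lam z = (P.qo : ℂ) ^ 2 / z := by rw [k, lam]; ring

theorem im_nonneg_of_mem_dom {z : ℂ} (hz : z ∈ P.dom upper) : 0 ≤ z.im := by
  rcases hz with hz | ⟨s, hs, rfl⟩
  · exact le_of_lt hz
  · simp

theorem lam_im_nonneg {z : ℂ} (hz : z ∈ P.dom upper) : 0 ≤ (P.lam z).im := by
  rw [lam_im]
  have := im_nonneg_of_mem_dom hz
  have := Complex.normSq_nonneg z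
  positivity

theorem lam_ofReal_im (s : ℝ) : (P.lam s).im = 0 := by simp [lam_im]

theorem k_ofReal_im (s : ℝ) : (P.k s).im = 0 := by
  have h := congrArg Complex.im (k_add_lam (P := P) s)
  rw [Complex.add_im, lam_ofReal_im, Complex.ofReal_im] at h
  linarith

theorem mu_ofReal_re (s : ℝ) (i : Fin 4) : (P.mu s i).re = 0 := by
  fin_cases i <;> simp [mu, lam_ofReal_im, k_ofReal_im]

/-- Because `Im λ ≥ 0` and `Im (k + λ) = Im z ≥ 0`, the exponent `-iλ` has the largest real part.
Column 0 thus decays at least as fast as the others at `-∞`, which is what makes it available in the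
upper half plane. -/
theorem re_mu_sub_mu_zero {z : ℂ} (hz : z ∈ P.dom upper) (i : Fin 4) :
    (P.mu z i - P.mu z 0).re ≤ 0 := by
  have h1 := lam_im_nonneg hz
  have h2 := im_nonneg_of_mem_dom hz
  have h3 := congrArg Complex.im (k_add_lam (P := P) z)
  rw [Complex.add_im] at h3
  fin_cases i <;> simp [mu] <;> linarith

theorem Reg.k_upper : P.Reg upper P.k :=
  (Reg.id.add ((Reg.const ((P.qo : ℂ) ^ 2)).div Reg.id
    fun _ hz => ne_zero_of_mem_dom_upper hz)).div (Reg.const 2) fun _ _ => two_ne_zero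

theorem Reg.lam_upper : P.Reg upper P.lam :=
  (Reg.id.sub ((Reg.const ((P.qo : ℂ) ^ 2)).div Reg.id
    fun _ hz => ne_zero_of_mem_dom_upper hz)).div (Reg.const 2) fun _ _ => two_ne_zero

theorem Reg.mu_upper (i : Fin 4) : P.Reg upper fun z => P.mu z i := by
  have h1 := (Reg.const (P := P) (U := upper) Complex.I).mul Reg.k_upper
  have h2 := (Reg.const (P := P) (U := upper) Complex.I).mul Reg.lam_upper
  fin_cases i
  · exact h2.neg
  · exact h1
  · exact h1
  · exact h2

theorem Reg.cexp {U : Set ℂ} {F : ℂ → ℂ} (hF : P.Reg U F) : P.Reg U fun z => Complex.exp (F z) :=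
  ⟨hF.diff.cexp, hF.cont.cexp⟩

theorem Reg.expo_upper (x t : ℝ) (i : Fin 4) : P.Reg upper fun z => P.expo x t z i := by
  have h1 : P.Reg upper fun z => Complex.I * P.theta1 x t z :=
    (Reg.const _).mul ((Reg.lam_upper.neg.mul (Reg.const _)).add
      ((((Reg.const 2).mul Reg.k_upper).mul Reg.lam_upper).mul (Reg.const _)))
  have h2 : P.Reg upper fun z => Complex.I * P.theta2 x t z := by
    have := (Reg.const (P := P) (U := upper) Complex.I).mul ((Reg.k_upper.mul (Reg.const (x : ℂ))).sub
      (((Reg.k_upper.mul Reg.k_upper).add (Reg.lam_upper.mul Reg.lam_upper)).mul (Reg.const (t : ℂ))))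
    simpa only [theta2, pow_two] using this
  fin_cases i
  · exact h1
  · exact h2
  · exact h2
  · exact h1.neg

/-- `φ` solves `φ_x = Xφ`. -/
def IsSol (P : Potential) (t : ℝ) (z : ℂ) (φ : ℝ → Fin 4 → ℂ) : Prop :=
  ∀ x i, HasDerivAt (fun y => φ y i) ((P.X x t z).mulVec (φ x) i) x

theorem X_eq (x t : ℝ) (z : ℂ) :
    P.X x t z = (-(Complex.I * P.k z) • J + Q (bvec P.qm)) + P.pert t x := by
  rw [X, pert]; abel

theorem X_mul_E_qm {t : ℝ} (hP : P.IsAdmissibleAt t) (x : ℝ) {z : ℂ} (h0 : z ≠ 0)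
    (hg : P.gam z ≠ 0) :
    P.X x t z * E P.qm z = E P.qm z * (Matrix.diagonal (P.mu z) + P.pertE t z x) := by
  rw [X_eq, add_mul, X_mul_E hP.norm_qm h0, mul_add, pertE, ← mul_assoc, ← mul_assoc,
    E_mul_Einv hP.norm_qm h0 hg, one_mul]

theorem Einv_mul_X {t : ℝ} (hP : P.IsAdmissibleAt t) (x : ℝ) {z : ℂ} (h0 : z ≠ 0)
    (hg : P.gam z ≠ 0) :
    P.Einv P.qm z * P.X x t z =
      (Matrix.diagonal (P.mu z) + P.pertE t z x) * P.Einv P.qm z := by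
  have h1 := Einv_mul_E hP.norm_qm h0 hg
  have h2 := E_mul_Einv hP.norm_qm h0 hg
  calc P.Einv P.qm z * P.X x t z
      = P.Einv P.qm z * (P.X x t z * E P.qm z) * P.Einv P.qm z := by
        rw [mul_assoc (P.Einv P.qm z), mul_assoc (P.X x t z), h2, mul_one]
    _ = _ := by rw [X_mul_E_qm hP x h0 hg, ← mul_assoc, h1, one_mul]

theorem hasDerivAt_exp_expo (x t : ℝ) (z : ℂ) (j : Fin 4) :
    HasDerivAt (fun x => Complex.exp (P.expo x t z j))
      (Complex.exp (P.expo x t z j) * P.mu z j) x :=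
  (P.hasDerivAt_expo x t z j).cexp

theorem hasDerivAt_exp_neg_expo (x t : ℝ) (z : ℂ) (j : Fin 4) :
    HasDerivAt (fun x => Complex.exp (-P.expo x t z j))
      (Complex.exp (-P.expo x t z j) * -P.mu z j) x :=
  (P.hasDerivAt_expo x t z j).neg.cexp

/-- The solution of the system in the eigenbasis which tends to the `j`-th basis vector. -/
noncomputable def modCol (P : Potential) (t : ℝ) (z : ℂ) (j : Fin 4) (x : ℝ) : Fin 4 → ℂ :=
  volterraSol (fun i => P.mu z i - P.mu z j) (P.pertE t z) (Pi.single j 1) x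

/-- The column of `φ₋` with index `j`. -/
noncomputable def jostCol (P : Potential) (t : ℝ) (z : ℂ) (j : Fin 4) (x : ℝ) : Fin 4 → ℂ :=
  Complex.exp (P.expo x t z j) • (E P.qm z).mulVec (P.modCol t z j x)

/-- In the basis of the columns of `E` the constant part is `diag(μ)`; splitting off `exp (expo j)`
shifts it by `μ j`, so that the basis vector `j` is annihilated and the tame theory applies. -/
theorem isSol_jostCol {t : ℝ} (hP : P.IsAdmissibleAt t) {z : ℂ} (h0 : z ≠ 0) (hg : P.gam z ≠ 0)
    {j : Fin 4} (hre : ∀ i, (P.mu z i - P.mu z j).re ≤ 0) : P.IsSol t z (P.jostCol t z j) := by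
  intro x i
  have hm := (isTame_pertE hP z hre).hasDerivAt_volterraSol hP.isWeight (Pi.single j 1)
    (fun i => by
      by_cases h : i = j
      · subst h; simp
      · simp [h]) x
  have h1 := (P.hasDerivAt_exp_expo x t z j).mul (hasDerivAt_mulVec (E P.qm z) hm i)
  refine h1.congr_deriv ?_
  have h2 : (P.X x t z).mulVec (P.jostCol t z j x) = Complex.exp (P.expo x t z j) •
      (E P.qm z).mulVec ((Matrix.diagonal (P.mu z) + P.pertE t z x).mulVec (P.modCol t z j x)) := by
    rw [jostCol, Matrix.mulVec_smul, Matrix.mulVec_mulVec, X_mul_E_qm hP x h0 hg,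
      ← Matrix.mulVec_mulVec]
  have h3 : (fun i => (P.mu z i - P.mu z j) * P.modCol t z j x i +
        (P.pertE t z x).mulVec (P.modCol t z j x) i) =
      (Matrix.diagonal (P.mu z) + P.pertE t z x).mulVec (P.modCol t z j x) -
        P.mu z j • P.modCol t z j x := by
    funext i
    simp only [Matrix.add_mulVec, Matrix.mulVec_diagonal, Pi.add_apply, Pi.sub_apply, Pi.smul_apply,
      smul_eq_mul]
    ring
  have h4 := congrFun h2 i
  have h5 : (E P.qm z).mulVec (fun i => (P.mu z i - P.mu z j) * P.modCol t z j x i +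
      (P.pertE t z x).mulVec (P.modCol t z j x) i) i =
      (E P.qm z).mulVec ((Matrix.diagonal (P.mu z) + P.pertE t z x).mulVec (P.modCol t z j x)) i -
      P.mu z j * (E P.qm z).mulVec (P.modCol t z j x) i := by
    rw [h3, Matrix.mulVec_sub, Matrix.mulVec_smul]; rfl
  rw [h4, Pi.smul_apply, smul_eq_mul]
  change _ + Complex.exp (P.expo x t z j) * (E P.qm z).mulVec (fun i => (P.mu z i - P.mu z j) *
    P.modCol t z j x i + (P.pertE t z x).mulVec (P.modCol t z j x) i) i = _
  rw [h5]
  change Complex.exp (P.expo x t z j) * P.mu z j * (E P.qm z).mulVec (P.modCol t z j x) i + _ = _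
  ring

theorem tendsto_jostCol {t : ℝ} (hP : P.IsAdmissibleAt t) {z : ℂ}
    {j : Fin 4} (hre : ∀ i, (P.mu z i - P.mu z j).re ≤ 0) (i : Fin 4) :
    Tendsto (fun x => Complex.exp (-P.expo x t z j) * P.jostCol t z j x i) atBot
      (𝓝 (E P.qm z i j)) := by
  have h := tendsto_mulVec (E P.qm z) (fun i => (isTame_pertE hP z hre).tendsto_volterraSol
    hP.isWeight (Pi.single j 1) i) i
  rw [Matrix.mulVec_single_one] at h
  refine h.congr fun x => ?_
  rw [jostCol, Pi.smul_apply, smul_eq_mul, ← mul_assoc, ← Complex.exp_add, neg_add_cancel,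
    Complex.exp_zero, one_mul]
  rfl

/-- A solution of the scattering problem is determined by its leading behavior at `-∞`. -/
theorem IsSol.eq_of_tendsto {t : ℝ} (hP : P.IsAdmissibleAt t) {z : ℂ} (h0 : z ≠ 0)
    (hg : P.gam z ≠ 0) {j : Fin 4} (hre : ∀ i, (P.mu z i - P.mu z j).re ≤ 0)
    {φ ψ : ℝ → Fin 4 → ℂ} (hφ : P.IsSol t z φ) (hψ : P.IsSol t z ψ)
    (h : ∀ i, Tendsto (fun x => Complex.exp (-P.expo x t z j) * (φ x i - ψ x i)) atBot (𝓝 0)) :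
    φ = ψ := by
  set m : ℝ → Fin 4 → ℂ := fun x =>
    Complex.exp (-P.expo x t z j) • (P.Einv P.qm z).mulVec (φ x - ψ x) with hm
  have hd : ∀ x i, HasDerivAt (fun x => m x i)
      ((P.mu z i - P.mu z j) * m x i + (P.pertE t z x).mulVec (m x) i) x := by
    intro x i
    have h1 : ∀ i, HasDerivAt (fun x => (φ x - ψ x) i) ((P.X x t z).mulVec (φ x - ψ x) i) x := by
      intro i
      rw [Matrix.mulVec_sub]
      exact (hφ x i).sub (hψ x i)
    have h2 := (P.hasDerivAt_exp_neg_expo x t z j).mul (hasDerivAt_mulVec (P.Einv P.qm z) h1 i)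
    refine h2.congr_deriv ?_
    rw [Matrix.mulVec_mulVec, Einv_mul_X hP x h0 hg, ← Matrix.mulVec_mulVec]
    simp only [hm, Matrix.add_mulVec, Matrix.mulVec_diagonal, Pi.add_apply, Pi.smul_apply,
      smul_eq_mul, Matrix.mulVec_smul]
    ring
  have hz : ∀ i, Tendsto (fun x => m x i) atBot (𝓝 0) := by
    intro i
    have h1 := tendsto_mulVec (P.Einv P.qm z) (a := 0)
      (u := fun x i => Complex.exp (-P.expo x t z j) * (φ x i - ψ x i)) h i
    rw [Matrix.mulVec_zero] at h1
    refine h1.congr fun x => ?_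
    have : (fun i => Complex.exp (-P.expo x t z j) * (φ x i - ψ x i)) =
        Complex.exp (-P.expo x t z j) • (φ x - ψ x) := rfl
    rw [this, Matrix.mulVec_smul]
  funext x
  have h1 := (isTame_pertE hP z hre).eq_zero hP.isWeight hd hz x
  have h2 : (P.Einv P.qm z).mulVec (φ x - ψ x) = 0 := by
    have := congrArg (fun v => Complex.exp (P.expo x t z j) • v) h1
    simpa only [hm, smul_smul, ← Complex.exp_add, add_neg_cancel, Complex.exp_zero, one_smul,
      smul_zero] using this
  have h3 := congrArg (E P.qm z).mulVec h2
  rw [Matrix.mulVec_mulVec, E_mul_Einv hP.norm_qm h0 hg, Matrix.one_mulVec, Matrix.mulVec_zero] at h3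
  exact sub_eq_zero.1 h3

theorem Reg.jostCol_upper {t : ℝ} (hP : P.IsAdmissibleAt t) (x : ℝ) :
    P.Reg upper fun z => P.jostCol t z 0 x := by
  have hfam : IsTameFamily (fun z i => P.mu z i - P.mu z 0) (P.pertE t) (P.weight t) P.pertBound
      (P.dom upper) upper :=
    { isOpen := isOpen_upper
      subset := subset_dom _
      tame := fun z hz => isTame_pertE hP z (re_mu_sub_mu_zero hz)
      cont_nu := fun i => ((Reg.mu_upper i).sub (Reg.mu_upper 0)).cont
      cont_g := fun y i j => (Reg.pertE_upper t y i j).cont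
      diff_nu := fun i => ((Reg.mu_upper i).sub (Reg.mu_upper 0)).diff
      diff_g := fun y i j => (Reg.pertE_upper t y i j).diff
      cont_K := continuousOn_pertBound }
  have hmod : ∀ j, P.Reg upper fun z => P.modCol t z 0 x j := fun j =>
    have h := hfam.volterraSol_regular hP.isWeight (Pi.single 0 1) x j
    ⟨h.2, h.1⟩
  have hsum : ∀ i, P.Reg upper fun z => ∑ j, E P.qm z i j * P.modCol t z 0 x j := fun i =>
    Reg.sum _ fun j => (Reg.E_upper _ i j).mul (hmod j)
  exact Reg.pi fun i => (Reg.expo_upper x t 0).cexp.mul (hsum i)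

end Potential

/-! ### The 2-tensors of Jost columns -/

/-- The exterior product of two vectors, as a skew-symmetric matrix. -/
def wedge (u w : Fin 4 → ℂ) : Matrix (Fin 4) (Fin 4) ℂ := Matrix.vecMulVec u w - Matrix.vecMulVec w u

theorem wedge_apply (u w : Fin 4 → ℂ) (i j : Fin 4) : wedge u w i j = u i * w j - w i * u j := rfl

theorem mul_wedge_add (M : Matrix (Fin 4) (Fin 4) ℂ) (u w : Fin 4 → ℂ) :
    M * wedge u w + wedge u w * M.transpose = wedge (M.mulVec u) w + wedge u (M.mulVec w) := by
  simp only [wedge, mul_sub, sub_mul, Matrix.mul_vecMulVec, Matrix.vecMulVec_mul,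
    Matrix.vecMul_transpose]
  abel

theorem mul_wedge_mul (M : Matrix (Fin 4) (Fin 4) ℂ) (u w : Fin 4 → ℂ) :
    M * wedge u w * M.transpose = wedge (M.mulVec u) (M.mulVec w) := by
  simp only [wedge, mul_sub, sub_mul, Matrix.mul_vecMulVec, Matrix.vecMulVec_mul,
    Matrix.vecMul_transpose]

theorem wedge_smul_smul (a b : ℂ) (u w : Fin 4 → ℂ) : wedge (a • u) (b • w) = (a * b) • wedge u w := by
  ext i j
  simp only [wedge_apply, Pi.smul_apply, Matrix.smul_apply, smul_eq_mul]
  ring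

theorem hasDerivAt_matrix_mul_mul {M N : Matrix (Fin 4) (Fin 4) ℂ}
    {W : ℝ → Matrix (Fin 4) (Fin 4) ℂ} {W' : Matrix (Fin 4) (Fin 4) ℂ} {x : ℝ}
    (hW : ∀ i j, HasDerivAt (fun x => W x i j) (W' i j) x) (i j : Fin 4) :
    HasDerivAt (fun x => (M * W x * N) i j) ((M * W' * N) i j) x := by
  simp only [Matrix.mul_apply]
  exact HasDerivAt.fun_sum fun l _ =>
    (HasDerivAt.fun_sum fun m _ => (hW m l).const_mul (M i m)).mul_const (N l j)

namespace Potential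

variable {P : Potential}

theorem pertE2_mulVec (t : ℝ) (z : ℂ) (y : ℝ) (w : Matrix (Fin 4) (Fin 4) ℂ) (i j : Fin 4) :
    (P.pertE2 t z y).mulVec (fun p => w p.1 p.2) (i, j) =
      (P.pertE t z y * w + w * (P.pertE t z y).transpose) i j := by
  simp only [Matrix.mulVec, dotProduct, pertE2_apply, Matrix.add_apply, Matrix.mul_apply, add_mul,
    Finset.sum_add_distrib, Matrix.transpose_apply]
  congr 1
  · rw [Fintype.sum_prod_type]
    refine Finset.sum_congr rfl fun a _ => ?_
    simp [Matrix.one_apply]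
  · rw [Fintype.sum_prod_type_right]
    refine Finset.sum_congr rfl fun a _ => ?_
    simp [Matrix.one_apply, mul_comm]

/-- The exponents of the system for 2-tensors in the eigenbasis. -/
noncomputable def nu2 (P : Potential) (z : ℂ) (a : Fin 4) (p : Fin 4 × Fin 4) : ℂ :=
  -- On the diagonal the natural exponent can have positive real part: at `(0, 0)` it is `μ 0 - μ
  -- a`. The default 0 restores tameness and is harmless because the tensor turns out to be skew,
  -- with zero diagonal.
  if p.1 = p.2 then 0 else P.mu z p.1 + P.mu z p.2 - P.mu z 0 - P.mu z a

theorem nu2_swap (z : ℂ) (a i j : Fin 4) : P.nu2 z a (i, j) = P.nu2 z a (j, i) := by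
  simp only [nu2, eq_comm (a := i), add_comm (P.mu z i)]

/-- Among pairs of distinct indices `{0, a}` has the dominant exponent. The critical competitors are
`{1, 2}`, where the difference is `iz`, and `{0, 3}`, where it is `-i q_o²/z`; both have nonpositive
real part above the real axis. -/
theorem re_nu2 {z : ℂ} (hz : z ∈ P.dom upper) {a : Fin 4} (ha : a = 1 ∨ a = 2) (p : Fin 4 × Fin 4) :
    (P.nu2 z a p).re ≤ 0 := by
  have h1 := lam_im_nonneg hz
  have h2 := im_nonneg_of_mem_dom hz
  have h3 := congrArg Complex.im (k_add_lam (P := P) z)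
  have h4 := congrArg Complex.im (k_sub_lam (P := P) z)
  have h5 : 0 ≤ P.qo ^ 2 * z.im / Complex.normSq z :=
    div_nonneg (mul_nonneg (sq_nonneg _) h2) (Complex.normSq_nonneg z)
  rw [Complex.add_im] at h3
  rw [Complex.sub_im, inv_im] at h4
  obtain ⟨i, j⟩ := p
  rcases ha with rfl | rfl <;> fin_cases i <;> fin_cases j <;> simp [nu2, mu] <;> linarith

/-- The leading term at `-∞` of the 2-tensor, in the eigenbasis. -/
noncomputable def lead2 (a : Fin 4) (p : Fin 4 × Fin 4) : ℂ :=
  wedge (Pi.single 0 1) (Pi.single a 1) p.1 p.2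

/-- The normalized 2-tensor in the eigenbasis. -/
noncomputable def modTensor (P : Potential) (t : ℝ) (z : ℂ) (a : Fin 4) (x : ℝ) :
    Matrix (Fin 4) (Fin 4) ℂ :=
  fun i j => volterraSol (P.nu2 z a) (P.pertE2 t z) (lead2 a) x (i, j)

/-- The 2-tensor `φ_{-,1} ∧ φ_{-,a}`. -/
noncomputable def jostTensor (P : Potential) (t : ℝ) (z : ℂ) (a : Fin 4) (x : ℝ) :
    Matrix (Fin 4) (Fin 4) ℂ :=
  Complex.exp (P.expo x t z 0 + P.expo x t z a) •
    (E P.qm z * P.modTensor t z a x * (E P.qm z).transpose)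

section

variable {t : ℝ} (hP : P.IsAdmissibleAt t) {z : ℂ} (hz : z ∈ P.dom upper) {a : Fin 4}
  (ha : a = 1 ∨ a = 2)

include hP hz ha

theorem hasDerivAt_modTensor_aux (x : ℝ) (i j : Fin 4) :
    HasDerivAt (fun x => P.modTensor t z a x i j) (P.nu2 z a (i, j) * P.modTensor t z a x i j +
      (P.pertE t z x * P.modTensor t z a x +
        P.modTensor t z a x * (P.pertE t z x).transpose) i j) x := by
  have h := (isTame_pertE2 hP z (re_nu2 hz ha)).hasDerivAt_volterraSol hP.isWeight (lead2 a)
    (fun p => by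
      obtain ⟨i, j⟩ := p
      rcases ha with rfl | rfl <;> fin_cases i <;> fin_cases j <;>
        simp [nu2, mu, lead2, wedge_apply]) x (i, j)
  refine h.congr_deriv ?_
  rw [← pertE2_mulVec]
  rfl

theorem tendsto_modTensor (i j : Fin 4) :
    Tendsto (fun x => P.modTensor t z a x i j) atBot (𝓝 (lead2 a (i, j))) :=
  (isTame_pertE2 hP z (re_nu2 hz ha)).tendsto_volterraSol hP.isWeight (lead2 a) (i, j)

theorem modTensor_unique {w w' : ℝ → Matrix (Fin 4) (Fin 4) ℂ}
    (hw : ∀ x i j, HasDerivAt (fun x => w x i j) (P.nu2 z a (i, j) * w x i j +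
      (P.pertE t z x * w x + w x * (P.pertE t z x).transpose) i j) x)
    (hw' : ∀ x i j, HasDerivAt (fun x => w' x i j) (P.nu2 z a (i, j) * w' x i j +
      (P.pertE t z x * w' x + w' x * (P.pertE t z x).transpose) i j) x)
    {b : Fin 4 → Fin 4 → ℂ} (hl : ∀ i j, Tendsto (fun x => w x i j) atBot (𝓝 (b i j)))
    (hl' : ∀ i j, Tendsto (fun x => w' x i j) atBot (𝓝 (b i j))) : w = w' := by
  funext x
  have h := (isTame_pertE2 hP z (re_nu2 hz ha)).eq_zero hP.isWeight
    (y := fun x p => (w x - w' x) p.1 p.2) (fun x p => ?_) (fun p => ?_) x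
  · ext i j
    exact sub_eq_zero.1 (congrFun h (i, j))
  · obtain ⟨i, j⟩ := p
    rw [pertE2_mulVec]
    refine ((hw x i j).sub (hw' x i j)).congr_deriv ?_
    simp only [mul_sub, sub_mul, Matrix.add_apply, Matrix.sub_apply]
    ring
  · have := (hl p.1 p.2).sub (hl' p.1 p.2)
    rwa [sub_self] at this

/-- The negative transpose solves the same system, whose exponents are symmetric, with the same skew
limit at `-∞`; uniqueness gives equality. -/
theorem modTensor_transpose (x : ℝ) : (P.modTensor t z a x).transpose = -P.modTensor t z a x := by
  have h := modTensor_unique hP hz ha (w := fun x => -(P.modTensor t z a x).transpose)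
    (w' := P.modTensor t z a) (b := fun i j => lead2 a (i, j)) (fun x i j => ?_)
    (hasDerivAt_modTensor_aux hP hz ha) (fun i j => ?_) (tendsto_modTensor hP hz ha)
  · exact neg_eq_iff_eq_neg.1 (congrFun h x)
  · refine (hasDerivAt_modTensor_aux hP hz ha x j i).neg.congr_deriv ?_
    rw [nu2_swap]
    have : P.pertE t z x * -(P.modTensor t z a x).transpose +
        -(P.modTensor t z a x).transpose * (P.pertE t z x).transpose =
        -(P.pertE t z x * P.modTensor t z a x +
          P.modTensor t z a x * (P.pertE t z x).transpose).transpose := by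
      simp only [Matrix.transpose_add, Matrix.transpose_mul, Matrix.transpose_transpose, mul_neg,
        neg_mul, neg_add]
      abel
    rw [this]
    simp only [Matrix.neg_apply, Matrix.transpose_apply]
    ring
  · have := (tendsto_modTensor hP hz ha j i).neg
    refine (this.congr fun x => rfl).trans (le_of_eq ?_)
    congr 1
    simp only [lead2, wedge_apply]
    ring

theorem modTensor_diag (x : ℝ) (i : Fin 4) : P.modTensor t z a x i i = 0 := by
  have h := congrFun (congrFun (modTensor_transpose hP hz ha x) i) i
  rw [Matrix.transpose_apply, Matrix.neg_apply] at h
  exact self_eq_neg.1 h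

theorem hasDerivAt_modTensor (x : ℝ) (i j : Fin 4) :
    HasDerivAt (fun x => P.modTensor t z a x i j)
      (((Matrix.diagonal (P.mu z) + P.pertE t z x) * P.modTensor t z a x +
        P.modTensor t z a x * (Matrix.diagonal (P.mu z) + P.pertE t z x).transpose -
        (P.mu z 0 + P.mu z a) • P.modTensor t z a x) i j) x := by
  refine (hasDerivAt_modTensor_aux hP hz ha x i j).congr_deriv ?_
  simp only [Matrix.transpose_add, Matrix.diagonal_transpose, add_mul, mul_add, Matrix.add_apply,
    Matrix.sub_apply, Matrix.smul_apply, Matrix.diagonal_mul, Matrix.mul_diagonal, smul_eq_mul]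
  by_cases h : i = j
  · subst h
    rw [modTensor_diag hP hz ha]
    ring
  · simp only [nu2, h, if_false]
    ring

theorem hasDerivAt_jostTensor (x : ℝ) (i j : Fin 4) :
    HasDerivAt (fun x => P.jostTensor t z a x i j)
      ((P.X x t z * P.jostTensor t z a x +
        P.jostTensor t z a x * (P.X x t z).transpose) i j) x := by
  have h0 := ne_zero_of_mem_dom_upper hz
  have hg := gam_ne_zero_of_mem_dom_upper hz
  have h1 := ((P.hasDerivAt_expo x t z 0).add (P.hasDerivAt_expo x t z a)).cexp.mul
    (hasDerivAt_matrix_mul_mul (M := E P.qm z) (N := (E P.qm z).transpose)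
      (hasDerivAt_modTensor hP hz ha x) i j)
  refine h1.congr_deriv ?_
  have h2 : P.X x t z * P.jostTensor t z a x + P.jostTensor t z a x * (P.X x t z).transpose =
      Complex.exp (P.expo x t z 0 + P.expo x t z a) • (E P.qm z *
        ((Matrix.diagonal (P.mu z) + P.pertE t z x) * P.modTensor t z a x +
        P.modTensor t z a x * (Matrix.diagonal (P.mu z) + P.pertE t z x).transpose) *
        (E P.qm z).transpose) := by
    have h3 := X_mul_E_qm hP x h0 hg
    have h4 := congrArg Matrix.transpose h3
    rw [Matrix.transpose_mul, Matrix.transpose_mul] at h4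
    rw [jostTensor, mul_smul_comm, smul_mul_assoc, ← smul_add]
    congr 1
    rw [mul_add, add_mul]
    congr 1
    · simp only [← mul_assoc, h3]
    · simp only [mul_assoc, h4]
  rw [h2]
  simp only [mul_sub, sub_mul, mul_smul_comm, smul_mul_assoc, Matrix.sub_apply, Matrix.smul_apply,
    smul_eq_mul, Pi.add_apply]
  ring

end

/-- For real `s` all exponents are imaginary, so every column exists. By the Leibniz rule the wedge
of the normalized columns solves the tensor system, and it has the same limit at `-∞`. -/
theorem jostTensor_eq_wedge {t : ℝ} (hP : P.IsAdmissibleAt t) {s : ℝ} (hs : s ∈ P.spec) {a : Fin 4}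
    (ha : a = 1 ∨ a = 2) (x : ℝ) :
    P.jostTensor t s a x = wedge (P.jostCol t s 0 x) (P.jostCol t s a x) := by
  have hz := ofReal_mem_dom hs upper
  have hre : ∀ i j, (P.mu s i - P.mu s j).re ≤ 0 := fun i j => by
    rw [Complex.sub_re, mu_ofReal_re, mu_ofReal_re, sub_zero]
  have hd : ∀ j x i, HasDerivAt (fun x => P.modCol t s j x i) ((P.mu s i - P.mu s j) *
      P.modCol t s j x i + (P.pertE t s x).mulVec (P.modCol t s j x) i) x := fun j x i =>
    (isTame_pertE hP s (hre · j)).hasDerivAt_volterraSol hP.isWeight (Pi.single j 1)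
      (fun i => by
        by_cases h : i = j
        · subst h; simp
        · simp [h]) x i
  have hl : ∀ j i, Tendsto (fun x => P.modCol t s j x i) atBot
      (𝓝 ((Pi.single j 1 : Fin 4 → ℂ) i)) := fun j i =>
    (isTame_pertE hP s (hre · j)).tendsto_volterraSol hP.isWeight (Pi.single j 1) i
  have h := modTensor_unique hP hz ha (w := P.modTensor t s a)
    (w' := fun x => wedge (P.modCol t s 0 x) (P.modCol t s a x))
    (hasDerivAt_modTensor_aux hP hz ha) (fun x i j => ?_) (b := fun i j => lead2 a (i, j))
    (tendsto_modTensor hP hz ha) (fun i j => ?_)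
  · rw [jostTensor, h, mul_wedge_mul, jostCol, jostCol, wedge_smul_smul, Complex.exp_add]
  · refine (((hd 0 x i).mul (hd a x j)).sub ((hd a x i).mul (hd 0 x j))).congr_deriv ?_
    rw [mul_wedge_add]
    simp only [Matrix.add_apply, wedge_apply]
    by_cases h : i = j
    · subst h
      ring
    · simp only [nu2, h, if_false]
      ring
  · exact ((hl 0 i).mul (hl a j)).sub ((hl a i).mul (hl 0 j))

theorem Reg.jostTensor_upper {t : ℝ} (hP : P.IsAdmissibleAt t) {a : Fin 4} (ha : a = 1 ∨ a = 2)
    (x : ℝ) (i j : Fin 4) : P.Reg upper fun z => P.jostTensor t z a x i j := by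
  have hnu : ∀ p, P.Reg upper fun z => P.nu2 z a p := by
    rintro ⟨i, j⟩
    by_cases h : i = j
    · simpa only [nu2, h, if_true] using Reg.const _
    · simpa only [nu2, h, if_false] using
        (((Reg.mu_upper i).add (Reg.mu_upper j)).sub (Reg.mu_upper 0)).sub (Reg.mu_upper a)
  have hg : ∀ y p q, P.Reg upper fun z => P.pertE2 t z y p q := by
    intro y p q
    simp only [pertE2_apply]
    exact ((Reg.pertE_upper t y _ _).mul (Reg.const _)).add
      ((Reg.const _).mul (Reg.pertE_upper t y _ _))
  have hfam : IsTameFamily (fun z => P.nu2 z a) (P.pertE2 t) (P.weight t)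
      (fun z => 2 * P.pertBound z) (P.dom upper) upper :=
    { isOpen := isOpen_upper
      subset := subset_dom _
      tame := fun z hz => isTame_pertE2 hP z (re_nu2 hz ha)
      cont_nu := fun i => (hnu i).cont
      cont_g := fun y i j => (hg y i j).cont
      diff_nu := fun i => (hnu i).diff
      diff_g := fun y i j => (hg y i j).diff
      cont_K := continuousOn_const.mul continuousOn_pertBound }
  have hmod : ∀ i j, P.Reg upper fun z => P.modTensor t z a x i j := fun i j =>
    have h := hfam.volterraSol_regular hP.isWeight (lead2 a) x (i, j)
    ⟨h.2, h.1⟩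
  simp only [jostTensor, Matrix.smul_apply, Matrix.mul_apply, Matrix.transpose_apply]
  exact (((Reg.expo_upper x t 0).add (Reg.expo_upper x t a)).cexp).smul
    (Reg.sum _ fun l => (Reg.sum _ fun m => (Reg.E_upper _ i m).mul (hmod m l)).mul
      (Reg.E_upper _ j l))

end Potential

/-! ### Derivatives of determinants and matrix products -/

/-- Liouville's formula. -/
theorem hasDerivAt_det {n : Type*} [Fintype n] [DecidableEq n] {M : ℝ → Matrix n n ℂ}
    {X : Matrix n n ℂ} {x : ℝ} (hM : ∀ i j, HasDerivAt (fun x => M x i j) ((X * M x) i j) x) :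
    HasDerivAt (fun x => (M x).det) (X.trace * (M x).det) x := by
  have h1 : ∀ N : Matrix n n ℂ, N.det = ∑ σ : Equiv.Perm n, ((Equiv.Perm.sign σ : ℤ) : ℂ) * ∏ i, N i (σ i) := by
    intro N
    rw [← Matrix.det_transpose, Matrix.det_apply']
    rfl
  have h2 : HasDerivAt (fun x => (M x).det) (∑ σ : Equiv.Perm n, ((Equiv.Perm.sign σ : ℤ) : ℂ) *
      ∑ i, (∏ j ∈ Finset.univ.erase i, M x j (σ j)) • (X * M x) i (σ i)) x := by
    simp only [h1]
    exact HasDerivAt.fun_sum fun σ _ => (HasDerivAt.fun_finsetProd fun i _ => hM i (σ i)).const_mul _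
  refine h2.congr_deriv ?_
  have h3 : ∀ i, ((M x).updateRow i (∑ k, X i k • M x k)).det = X i i * (M x).det := fun i => by
    rw [Matrix.det_updateRow_sum, smul_eq_mul]
  rw [Matrix.trace, Finset.sum_mul]
  have h4 : ∀ i, X.diag i * (M x).det = ∑ σ : Equiv.Perm n, ((Equiv.Perm.sign σ : ℤ) : ℂ) *
      ∏ j, (M x).updateRow i (∑ k, X i k • M x k) j (σ j) := fun i => by
    rw [Matrix.diag_apply, ← h3, h1]
  simp only [h4, Finset.mul_sum]
  rw [Finset.sum_comm]
  refine Finset.sum_congr rfl fun i _ => Finset.sum_congr rfl fun σ _ => ?_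
  congr 1
  rw [← Finset.prod_erase_mul _ _ (Finset.mem_univ i), smul_eq_mul]
  congr 1
  · refine Finset.prod_congr rfl fun j hj => ?_
    rw [Matrix.updateRow_ne (Finset.ne_of_mem_erase hj)]
  · simp [Matrix.updateRow_self, Matrix.mul_apply, Finset.sum_apply]
theorem hasDerivAt_matrix_mul {M N : ℝ → Matrix (Fin 4) (Fin 4) ℂ}
    {M' N' : Matrix (Fin 4) (Fin 4) ℂ} {x : ℝ}
    (hM : ∀ i j, HasDerivAt (fun x => M x i j) (M' i j) x)
    (hN : ∀ i j, HasDerivAt (fun x => N x i j) (N' i j) x) (i j : Fin 4) :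
    HasDerivAt (fun x => (M x * N x) i j) ((M' * N x + M x * N') i j) x := by
  simp only [Matrix.mul_apply, Matrix.add_apply, ← Finset.sum_add_distrib]
  exact HasDerivAt.fun_sum fun l _ => (hM i l).mul (hN l j)

theorem hasDerivAt_conjTranspose {M : ℝ → Matrix (Fin 4) (Fin 4) ℂ}
    {M' : Matrix (Fin 4) (Fin 4) ℂ} {x : ℝ}
    (hM : ∀ i j, HasDerivAt (fun x => M x i j) (M' i j) x) (i j : Fin 4) :
    HasDerivAt (fun x => (M x).conjTranspose i j) (M'.conjTranspose i j) x :=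
  (hM j i).star

theorem eq_const_of_hasDerivAt_zero {f : ℝ → ℂ} (hf : ∀ x, HasDerivAt f 0 x) (x y : ℝ) :
    f x = f y :=
  is_const_of_deriv_eq_zero (fun x => (hf x).differentiableAt) (fun x => (hf x).deriv) x y

namespace Potential

variable {P : Potential}

/-! ### The reflection `x ↦ -x` -/

/-- The potential `-q(-x,t)`, for which `-∞` and `+∞` change places. -/
def refl (P : Potential) : Potential where
  qo := P.qo
  qm := -P.qp
  qp := -P.qm
  q := fun x t => -P.q (-x) t

theorem refl_refl : P.refl.refl = P := by
  cases P
  simp [refl]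

theorem bvec_neg (c : ℂ) : bvec (-c) = -bvec c := by
  funext i
  fin_cases i <;> simp [bvec]

theorem integrableOn_comp_neg {E : Type*} [NormedAddCommGroup E] {f : ℝ → E} {s s' : Set ℝ}
    (hf : IntegrableOn f s) (hs : Neg.neg ⁻¹' s = s') : IntegrableOn (fun x => f (-x)) s' := by
  rw [← hs]
  exact ((Measure.measurePreserving_neg (volume : Measure ℝ)).integrableOn_comp_preimage
    (Homeomorph.neg ℝ).measurableEmbedding).2 hf

theorem IsAdmissibleAt.refl {t : ℝ} (hP : P.IsAdmissibleAt t) : P.refl.IsAdmissibleAt t where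
  qo_pos := hP.qo_pos
  norm_qm := (norm_neg P.qp).trans hP.norm_qp
  norm_qp := (norm_neg P.qm).trans hP.norm_qm
  continuous_q := (hP.continuous_q.comp continuous_neg).neg
  tendsto_bot := by
    have := (hP.tendsto_top.comp tendsto_neg_atBot_atTop).neg
    rw [← bvec_neg] at this
    exact this
  tendsto_top := by
    have := (hP.tendsto_bot.comp tendsto_neg_atTop_atBot).neg
    rw [← bvec_neg] at this
    exact this
  integrable_bot := by
    have h := (integrableOn_comp_neg hP.integrable_top (s' := Iic 0) (by simp)).neg
    have e : (fun x => P.refl.q x t - bvec P.refl.qm) = -fun x => P.q (-x) t - bvec P.qp := by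
      funext x
      change -P.q (-x) t - bvec (-P.qp) = -(P.q (-x) t - bvec P.qp)
      rw [bvec_neg]; abel
    rw [e]
    exact h
  integrable_top := by
    have h := (integrableOn_comp_neg hP.integrable_bot (s' := Ici 0) (by simp)).neg
    have e : (fun x => P.refl.q x t - bvec P.refl.qp) = -fun x => P.q (-x) t - bvec P.qm := by
      funext x
      change -P.q (-x) t - bvec (-P.qm) = -(P.q (-x) t - bvec P.qm)
      rw [bvec_neg]; abel
    rw [e]
    exact h

theorem refl_k (z : ℂ) : P.refl.k (-z) = -P.k z := by
  simp only [k, refl]; ring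

theorem refl_lam (z : ℂ) : P.refl.lam (-z) = -P.lam z := by
  simp only [lam, refl]; ring

theorem refl_gam (z : ℂ) : P.refl.gam (-z) = P.gam z := gam_neg z

theorem Q_neg (v : Fin 3 → ℂ) : Q (-v) = -Q v := by
  ext i j
  fin_cases i <;> fin_cases j <;> simp [Q]

/-- Since `k` is odd, changing the signs of `z` and of the potential reverses the whole matrix,
which compensates the sign of `d/dx` under `x ↦ -x`. -/
theorem refl_X (x t : ℝ) (z : ℂ) : P.refl.X (-x) t (-z) = -P.X x t z := by
  have h : P.refl.q (-x) t = -P.q x t := by simp [refl]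
  rw [X, X, refl_k, h, Q_neg, mul_neg, neg_neg, neg_add, neg_smul, neg_neg]

theorem refl_expo (x t : ℝ) (z : ℂ) : P.refl.expo (-x) t (-z) = P.expo x t z := by
  simp only [expo, theta1, theta2, refl_k, refl_lam]
  push_cast
  congr 1
  · ring
  · congr 1
    · ring
    · congr 1
      · ring
      · congr 1
        ring

theorem E_neg (c z : ℂ) : E (-c) (-z) = E c z := by
  simp [E_eq, div_neg, neg_div]

theorem refl_expTheta (x t : ℝ) (z : ℂ) : P.refl.expTheta (-x) t (-z) = P.expTheta x t z := by
  rw [expTheta_eq, expTheta_eq, refl_expo]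

theorem IsSol.refl {t : ℝ} {z : ℂ} {φ : ℝ → Fin 4 → ℂ} (h : P.IsSol t z φ) :
    P.refl.IsSol t (-z) fun x => φ (-x) := by
  intro x i
  have h1 := (h (-x) i).scomp x (hasDerivAt_neg x)
  refine h1.congr_deriv ?_
  have h2 := refl_X (P := P) (-x) t z
  rw [neg_neg] at h2
  rw [h2, Matrix.neg_mulVec, Pi.neg_apply, neg_one_smul]

theorem IsJost.refl {l l' : Filter ℝ} (hl : Tendsto Neg.neg l' l) {c : ℂ} {t : ℝ} {z : ℂ}
    {Φ : ℝ → Matrix (Fin 4) (Fin 4) ℂ} (h : P.IsJost l c t z Φ) :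
    P.refl.IsJost l' (-c) t (-z) fun x => Φ (-x) := by
  refine ⟨fun x i j => ?_, fun i j => ?_⟩
  · exact IsSol.refl (φ := fun x i => Φ x i j) (fun x i => h.1 x i j) x i
  · refine ((h.2 i j).comp hl).congr fun x => ?_
    have := refl_expTheta (P := P) (-x) t z
    rw [neg_neg] at this
    rw [E_neg, this]
    rfl

/-! ### Jost eigenfunctions on the real line -/

theorem norm_exp_expo_ofReal (x t s : ℝ) (i : Fin 4) : ‖Complex.exp (P.expo x t s i)‖ = 1 := by
  rw [Complex.norm_exp, Real.exp_eq_one_iff]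
  fin_cases i <;> simp [expo, theta1, theta2, lam_ofReal_im, k_ofReal_im, pow_two]

theorem norm_exp_neg_expo_ofReal (x t s : ℝ) (i : Fin 4) :
    ‖Complex.exp (-P.expo x t s i)‖ = 1 := by
  rw [Complex.exp_neg, norm_inv, norm_exp_expo_ofReal, inv_one]

theorem re_mu_sub_mu_ofReal (s : ℝ) (i j : Fin 4) : (P.mu s i - P.mu s j).re ≤ 0 := by
  rw [Complex.sub_re, mu_ofReal_re, mu_ofReal_re, sub_zero]

theorem mul_expTheta_apply (M : Matrix (Fin 4) (Fin 4) ℂ) (x t : ℝ) (z : ℂ) (i j : Fin 4) :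
    (M * P.expTheta x t z) i j = M i j * Complex.exp (P.expo x t z j) := by
  rw [expTheta_eq, Matrix.mul_diagonal]

/-- The exponentials are unimodular for real `s`, so multiplying by them does not affect an error
`o(1)`. -/
theorem IsJost.tendsto_normalized {l : Filter ℝ} {c : ℂ} {t s : ℝ}
    {Φ : ℝ → Matrix (Fin 4) (Fin 4) ℂ} (h : P.IsJost l c t s Φ) (i j : Fin 4) :
    Tendsto (fun x => Complex.exp (-P.expo x t s j) * Φ x i j) l (𝓝 (E c s i j)) := by
  rw [tendsto_iff_norm_sub_tendsto_zero]
  refine (tendsto_zero_iff_norm_tendsto_zero.1 (h.2 i j)).congr fun x => ?_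
  rw [← one_mul ‖Φ x i j - _‖, ← norm_exp_neg_expo_ofReal (P := P) x t s j, ← norm_mul, mul_sub,
    mul_expTheta_apply, mul_left_comm, ← Complex.exp_add, neg_add_cancel, Complex.exp_zero, mul_one]

theorem isJost_jostCol {t : ℝ} (hP : P.IsAdmissibleAt t) {s : ℝ} (hs : s ∈ P.spec) :
    P.IsJost atBot P.qm t s fun x => Matrix.of fun i j => P.jostCol t s j x i := by
  have hz := ofReal_mem_dom hs upper
  refine ⟨fun x i j => isSol_jostCol hP (ne_zero_of_mem_dom_upper hz)
    (gam_ne_zero_of_mem_dom_upper hz) (re_mu_sub_mu_ofReal s · j) x i, fun i j => ?_⟩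
  have h := tendsto_jostCol hP (z := s) (j := j) (re_mu_sub_mu_ofReal s · j) i
  rw [tendsto_iff_norm_sub_tendsto_zero] at h
  refine tendsto_zero_iff_norm_tendsto_zero.2 (h.congr fun x => ?_)
  rw [← one_mul ‖Matrix.of _ i j - _‖, ← norm_exp_neg_expo_ofReal (P := P) x t s j, ← norm_mul,
    mul_sub, mul_expTheta_apply, mul_left_comm, ← Complex.exp_add, neg_add_cancel,
    Complex.exp_zero, mul_one]
  rfl

theorem IsJost.unique {t : ℝ} (hP : P.IsAdmissibleAt t) {s : ℝ} (hs : s ∈ P.spec)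
    {Φ Ψ : ℝ → Matrix (Fin 4) (Fin 4) ℂ} (h : P.IsJost atBot P.qm t s Φ)
    (h' : P.IsJost atBot P.qm t s Ψ) : Φ = Ψ := by
  have hz := ofReal_mem_dom hs upper
  have key : ∀ j, (fun x i => Φ x i j) = fun x i => Ψ x i j := fun j =>
    IsSol.eq_of_tendsto hP (z := s) (ne_zero_of_mem_dom_upper hz) (gam_ne_zero_of_mem_dom_upper hz)
      (re_mu_sub_mu_ofReal s · j) (fun x i => h.1 x i j) (fun x i => h'.1 x i j) fun i => by
        have := (h.tendsto_normalized i j).sub (h'.tendsto_normalized i j)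
        rw [sub_self] at this
        exact this.congr fun x => (mul_sub _ _ _).symm
  funext x
  ext i j
  exact congrFun (congrFun (key j) x) i

theorem jostMinus_eq {t : ℝ} (hP : P.IsAdmissibleAt t) {s : ℝ} (hs : s ∈ P.spec) :
    P.jostMinus t s = fun x => Matrix.of fun i j => P.jostCol t s j x i :=
  IsJost.unique hP hs
    (Classical.epsilon_spec (p := P.IsJost atBot P.qm t s) ⟨_, isJost_jostCol hP hs⟩)
    (isJost_jostCol hP hs)

/-- The column of `φ₊` with index `j`. -/
noncomputable def jostColP (P : Potential) (t : ℝ) (z : ℂ) (j : Fin 4) (x : ℝ) : Fin 4 → ℂ :=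
  P.refl.jostCol t (-z) j (-x)

/-- The 2-tensor `φ_{+,1} ∧ φ_{+,a}`. -/
noncomputable def jostTensorP (P : Potential) (t : ℝ) (z : ℂ) (a : Fin 4) (x : ℝ) :
    Matrix (Fin 4) (Fin 4) ℂ :=
  P.refl.jostTensor t (-z) a (-x)

theorem isJost_jostColP {t : ℝ} (hP : P.IsAdmissibleAt t) {s : ℝ} (hs : s ∈ P.spec) :
    P.IsJost atTop P.qp t s fun x => Matrix.of fun i j => P.jostColP t s j x i := by
  have h := (isJost_jostCol hP.refl (s := -s) (neg_mem_spec hs)).refl tendsto_neg_atTop_atBot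
  rw [refl_refl] at h
  simpa [refl, jostColP] using h

theorem jostPlus_eq {t : ℝ} (hP : P.IsAdmissibleAt t) {s : ℝ} (hs : s ∈ P.spec) :
    P.jostPlus t s = fun x => Matrix.of fun i j => P.jostColP t s j x i := by
  have h : P.IsJost atTop P.qp t s (P.jostPlus t s) :=
    Classical.epsilon_spec (p := P.IsJost atTop P.qp t s) ⟨_, isJost_jostColP hP hs⟩
  have h1 := h.refl tendsto_neg_atBot_atTop
  have h2 := (isJost_jostColP hP hs).refl tendsto_neg_atBot_atTop
  rw [← Complex.ofReal_neg] at h1 h2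
  have h3 := IsJost.unique hP.refl (neg_mem_spec hs) h1 h2
  funext x
  simpa using congrFun h3 (-x)

theorem jostTensorP_eq_wedge {t : ℝ} (hP : P.IsAdmissibleAt t) {s : ℝ} (hs : s ∈ P.spec)
    {a : Fin 4} (ha : a = 1 ∨ a = 2) (x : ℝ) :
    P.jostTensorP t s a x = wedge (P.jostColP t s 0 x) (P.jostColP t s a x) := by
  have := jostTensor_eq_wedge hP.refl (s := -s) (neg_mem_spec hs) ha (-x)
  rw [Complex.ofReal_neg] at this
  exact this

theorem k_conj (z : ℂ) : P.k (conj z) = conj (P.k z) := by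
  simp [k, map_ofNat (starRingEnd ℂ) 2]

/-- Source of the symmetry `z ↦ conj z`: the form `u† J w` of solutions at `conj z` and at `z` has
zero derivative in `x`. -/
theorem X_conjTranspose_mul_J (x t : ℝ) (z : ℂ) :
    (P.X x t (conj z)).conjTranspose * J = -(J * P.X x t z) := by
  rw [X, X, smul_J_add_Q, smul_J_add_Q, J_eq, k_conj]
  ext i j
  fin_cases i <;> fin_cases j <;> simp [Matrix.mul_apply, Fin.sum_univ_four]

/-- The Gram matrix `diag(γ, -1, -1, -γ)` of the Jost eigenfunctions. -/
noncomputable def gram (P : Potential) (z : ℂ) : Matrix (Fin 4) (Fin 4) ℂ :=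
  Matrix.diagonal ![P.gam z, -1, -1, -P.gam z]

theorem E_conjTranspose_mul_J_mul_E {c : ℂ} (hc : ‖c‖ = P.qo) {s : ℝ} (hs : s ≠ 0) :
    (E c s).conjTranspose * J * E c s = P.gram s := by
  have h1 := mul_conj_eq hc
  have h2 := gam_mul_sq (P := P) (Complex.ofReal_ne_zero.2 hs)
  have h0 := Complex.ofReal_ne_zero.2 hs
  rw [J_eq, E_eq, gram]
  ext i j
  fin_cases i <;> fin_cases j <;>
    simp [Matrix.mul_apply, Fin.sum_univ_four] <;>
    field_simp <;> first | ring1 | (simp only [Complex.I_sq]; linear_combination -h1 - h2) |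
      (simp only [Complex.I_sq]; linear_combination h1 + h2)

theorem trace_X (x t : ℝ) (z : ℂ) : (P.X x t z).trace = 2 * (Complex.I * P.k z) := by
  rw [X, smul_J_add_Q]
  simp [Matrix.trace, Fin.sum_univ_four]
  ring

theorem det_E {c z : ℂ} (hc : ‖c‖ = P.qo) (h0 : z ≠ 0) : (E c z).det = P.gam z := by
  have h1 := mul_conj_eq hc
  have h2 := gam_mul_sq (P := P) h0
  rw [E_eq]
  simp [Matrix.det_succ_row_zero, Fin.sum_univ_succ, Fin.succAbove]
  field_simp
  simp only [Complex.I_sq]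
  linear_combination -h1 - h2

section

variable {t : ℝ} {s : ℝ} {l : Filter ℝ} {c : ℂ}
  {Φ : ℝ → Matrix (Fin 4) (Fin 4) ℂ}

theorem IsJost.hasDerivAt_gram (h : P.IsJost l c t s Φ) (i j : Fin 4) (x : ℝ) :
    HasDerivAt (fun x => ((Φ x).conjTranspose * J * Φ x) i j) 0 x := by
  have hJ : ∀ i j, HasDerivAt (fun _ : ℝ => J i j) ((0 : Matrix (Fin 4) (Fin 4) ℂ) i j) x :=
    fun i j => hasDerivAt_const _ _
  have h1 := hasDerivAt_matrix_mul (hasDerivAt_matrix_mul (hasDerivAt_conjTranspose (h.1 x)) hJ)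
    (h.1 x) i j
  refine h1.congr_deriv ?_
  have h2 := X_conjTranspose_mul_J (P := P) x t s
  rw [Complex.conj_ofReal] at h2
  rw [mul_zero, add_zero, Matrix.conjTranspose_mul, mul_assoc (Φ x).conjTranspose, h2, mul_neg,
    neg_mul, mul_assoc, mul_assoc, mul_assoc, neg_add_cancel]
  rfl

theorem IsJost.gram_eq [l.NeBot] (hc : ‖c‖ = P.qo) (hs : s ≠ 0) (h : P.IsJost l c t s Φ) (x : ℝ) :
    (Φ x).conjTranspose * J * Φ x = P.gram s := by
  ext a b
  have hl : Tendsto (fun x => conj (Complex.exp (-P.expo x t s a)) * Complex.exp (-P.expo x t s b) *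
      ((Φ x).conjTranspose * J * Φ x) a b) l (𝓝 (P.gram s a b)) := by
    rw [← E_conjTranspose_mul_J_mul_E hc hs]
    have : Tendsto (fun x => ∑ j, (∑ i, conj (Complex.exp (-P.expo x t s a) * Φ x i a) * J i j) *
        (Complex.exp (-P.expo x t s b) * Φ x j b)) l
        (𝓝 (∑ j, (∑ i, conj (E c s i a) * J i j) * E c s j b)) :=
      tendsto_finsetSum _ fun j _ => Tendsto.mul (tendsto_finsetSum _ fun i _ =>
        ((Complex.continuous_conj.tendsto _).comp (h.tendsto_normalized i a)).mul_const _)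
        (h.tendsto_normalized j b)
    have e : ∀ M : Matrix (Fin 4) (Fin 4) ℂ, (M.conjTranspose * J * M) a b =
        ∑ j, (∑ i, conj (M i a) * J i j) * M j b := fun M => by
      simp only [Matrix.mul_apply, Matrix.conjTranspose_apply]
      rfl
    rw [e]
    refine this.congr fun x => ?_
    rw [e, Finset.mul_sum]
    refine Finset.sum_congr rfl fun j _ => ?_
    rw [Finset.sum_mul, Finset.sum_mul, Finset.mul_sum]
    refine Finset.sum_congr rfl fun i _ => ?_
    rw [map_mul]
    ring
  have hconst : ∀ y, ((Φ y).conjTranspose * J * Φ y) a b =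
      ((Φ x).conjTranspose * J * Φ x) a b := fun y =>
    eq_const_of_hasDerivAt_zero (h.hasDerivAt_gram a b) y x
  -- The entry is constant, and its product with two phases converges. On the diagonal the phases
  -- cancel; off the diagonal the limit is 0 and the modulus is constant, so the entry vanishes.
  by_cases hab : a = b
  · subst hab
    have h1 : ∀ y, conj (Complex.exp (-P.expo y t s a)) * Complex.exp (-P.expo y t s a) = 1 :=
      fun y => by
        rw [mul_comm, Complex.mul_conj, Complex.normSq_eq_norm_sq, norm_exp_neg_expo_ofReal]
        simp
    simp only [h1, one_mul, hconst] at hl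
    exact tendsto_nhds_unique tendsto_const_nhds hl
  · have h0 : P.gram s a b = 0 := Matrix.diagonal_apply_ne _ hab
    have hn := hl.norm
    simp only [norm_mul, RCLike.norm_conj, norm_exp_neg_expo_ofReal, one_mul, hconst] at hn
    have := tendsto_nhds_unique tendsto_const_nhds hn
    rw [h0, norm_zero, norm_eq_zero] at this
    rw [this, h0]

/-- Liouville's formula with trace `2ik` makes `exp (-2iθ₂) det Φ` constant; its value is the limit
`det E = γ`. The same value at both ends later forces `det A = 1`. -/
theorem IsJost.det_eq [l.NeBot] (hc : ‖c‖ = P.qo) (hs : s ≠ 0) (h : P.IsJost l c t s Φ) (x : ℝ) :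
    (Φ x).det = P.gam s * Complex.exp (2 * (Complex.I * P.theta2 x t s)) := by
  have hd : ∀ x, HasDerivAt (fun x => Complex.exp (-(2 * (Complex.I * P.theta2 x t s))) *
      (Φ x).det) 0 x := fun x => by
    have h1 := hasDerivAt_det (h.1 x)
    have h2 := (((P.hasDerivAt_expo x t s 1).const_mul 2).neg.cexp).mul h1
    refine h2.congr_deriv ?_
    rw [trace_X]
    simp only [mu, expo, Matrix.cons_val_one, Matrix.cons_val_zero]
    ring
  have hl : Tendsto (fun x => Complex.exp (-(2 * (Complex.I * P.theta2 x t s))) *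
      (Φ x).det) l (𝓝 (P.gam s)) := by
    rw [← det_E hc (Complex.ofReal_ne_zero.2 hs)]
    have h1 : Tendsto (fun x => (Matrix.of fun i j => Complex.exp (-P.expo x t s j) * Φ x i j)) l
        (𝓝 (E c s)) := tendsto_pi_nhds.2 fun i => tendsto_pi_nhds.2 fun j =>
      h.tendsto_normalized i j
    have h2 := ((Continuous.matrix_det continuous_id).tendsto _).comp h1
    refine h2.congr fun x => ?_
    have h3 : (Matrix.of fun i j => Complex.exp (-P.expo x t s j) * Φ x i j) =
        Φ x * Matrix.diagonal fun j => Complex.exp (-P.expo x t s j) := by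
      ext i j
      rw [Matrix.mul_diagonal, mul_comm]
      rfl
    simp only [Function.comp_apply, id, h3, Matrix.det_mul, Matrix.det_diagonal, Fin.prod_univ_four,
      ← Complex.exp_add]
    rw [mul_comm]
    congr 2
    simp only [expo]
    simp
    ring
  have := tendsto_nhds_unique (tendsto_const_nhds (x := Complex.exp (-(2 * (Complex.I *
    P.theta2 x t s))) * (Φ x).det)) (hl.congr fun y => eq_const_of_hasDerivAt_zero hd y x)
  rw [← this, mul_right_comm, ← Complex.exp_add, neg_add_cancel, Complex.exp_zero, one_mul]

end

end Potential

/-! ### Minors of `4 × 4` matrices -/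

theorem det_fin_four (A : Matrix (Fin 4) (Fin 4) ℂ) : A.det =
    A 0 0 * (A 1 1 * (A 2 2 * A 3 3 - A 2 3 * A 3 2) - A 1 2 * (A 2 1 * A 3 3 - A 2 3 * A 3 1) +
      A 1 3 * (A 2 1 * A 3 2 - A 2 2 * A 3 1)) -
    A 0 1 * (A 1 0 * (A 2 2 * A 3 3 - A 2 3 * A 3 2) - A 1 2 * (A 2 0 * A 3 3 - A 2 3 * A 3 0) +
      A 1 3 * (A 2 0 * A 3 2 - A 2 2 * A 3 0)) +
    A 0 2 * (A 1 0 * (A 2 1 * A 3 3 - A 2 3 * A 3 1) - A 1 1 * (A 2 0 * A 3 3 - A 2 3 * A 3 0) +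
      A 1 3 * (A 2 0 * A 3 1 - A 2 1 * A 3 0)) -
    A 0 3 * (A 1 0 * (A 2 1 * A 3 2 - A 2 2 * A 3 1) - A 1 1 * (A 2 0 * A 3 2 - A 2 2 * A 3 0) +
      A 1 2 * (A 2 0 * A 3 1 - A 2 1 * A 3 0)) := by
  rw [Matrix.det_succ_row_zero]
  simp [Fin.sum_univ_succ, Matrix.det_fin_three, Fin.succAbove, Fin.succ]
  ring

/-- The minor of a matrix with two rows `i, j` and two columns `k, l`. -/
def minor2 (A : Matrix (Fin 4) (Fin 4) ℂ) (i j k l : Fin 4) : ℂ := A i k * A j l - A i l * A j k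

section Jacobi

variable {A B : Matrix (Fin 4) (Fin 4) ℂ}

theorem eq_adjugate (hAB : A * B = 1) (hA : A.det = 1) : B = A.adjugate := by
  have h := Matrix.adjugate_mul A
  rw [hA, one_smul] at h
  calc B = A.adjugate * A * B := by rw [h, one_mul]
    _ = A.adjugate := by rw [mul_assoc, hAB, mul_one]

/-- Jacobi's identity for the complementary `2 × 2` minors of inverse matrices. -/
theorem minor2_eq_complement (hAB : A * B = 1) (hA : A.det = 1) :
    minor2 B 0 1 0 1 = minor2 A 2 3 2 3 ∧ minor2 B 0 2 0 1 = -minor2 A 2 3 1 3 ∧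
    minor2 B 0 3 0 1 = minor2 A 2 3 1 2 ∧ minor2 B 2 3 2 3 = minor2 A 0 1 0 1 ∧
    minor2 B 1 3 2 3 = -minor2 A 0 1 0 2 ∧ minor2 B 0 3 2 3 = minor2 A 0 1 1 2 ∧
    minor2 B 1 3 1 3 = minor2 A 0 2 0 2 := by
  rw [eq_adjugate hAB hA]
  refine ⟨?_, ?_, ?_, ?_, ?_, ?_, ?_⟩
  -- Replacing 1 by the determinant makes both sides homogeneous, and the claim becomes a polynomial
  -- identity in the entries of `A`.
  · rw [← one_mul (minor2 A 2 3 2 3), ← hA, det_fin_four]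
    simp only [minor2, Matrix.adjugate_fin_succ_eq_det_submatrix, Matrix.det_fin_three]
    simp [Fin.succAbove, Fin.succ, Fin.lt_def]
    ring
  · rw [← one_mul (minor2 A 2 3 1 3), ← hA, det_fin_four]
    simp only [minor2, Matrix.adjugate_fin_succ_eq_det_submatrix, Matrix.det_fin_three]
    simp [Fin.succAbove, Fin.succ, Fin.lt_def]
    ring
  · rw [← one_mul (minor2 A 2 3 1 2), ← hA, det_fin_four]
    simp only [minor2, Matrix.adjugate_fin_succ_eq_det_submatrix, Matrix.det_fin_three]
    simp [Fin.succAbove, Fin.succ, Fin.lt_def]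
    ring
  · rw [← one_mul (minor2 A 0 1 0 1), ← hA, det_fin_four]
    simp only [minor2, Matrix.adjugate_fin_succ_eq_det_submatrix, Matrix.det_fin_three]
    simp [Fin.succAbove, Fin.succ, Fin.lt_def]
    ring
  · rw [← one_mul (minor2 A 0 1 0 2), ← hA, det_fin_four]
    simp only [minor2, Matrix.adjugate_fin_succ_eq_det_submatrix, Matrix.det_fin_three]
    simp [Fin.succAbove, Fin.succ, Fin.lt_def]
    ring
  · rw [← one_mul (minor2 A 0 1 1 2), ← hA, det_fin_four]
    simp only [minor2, Matrix.adjugate_fin_succ_eq_det_submatrix, Matrix.det_fin_three]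
    simp [Fin.succAbove, Fin.succ, Fin.lt_def]
    ring
  · rw [← one_mul (minor2 A 0 2 0 2), ← hA, det_fin_four]
    simp only [minor2, Matrix.adjugate_fin_succ_eq_det_submatrix, Matrix.det_fin_three]
    simp [Fin.succAbove, Fin.succ, Fin.lt_def]
    ring

theorem minor3_eq (hAB : A * B = 1) (hA : A.det = 1) :
    (A.submatrix ![0, 1, 2] ![0, 1, 2]).det = B 3 3 ∧
    (A.submatrix ![1, 2, 3] ![1, 2, 3]).det = B 0 0 := by
  rw [eq_adjugate hAB hA]
  simp only [Matrix.adjugate_fin_succ_eq_det_submatrix, Matrix.det_fin_three]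
  constructor <;> simp [Fin.succAbove, Fin.succ, Fin.lt_def] <;> ring

/-- Sylvester's identity for the minors which contain the first row and column. -/
theorem minor2_mul_minor2 (A : Matrix (Fin 4) (Fin 4) ℂ) :
    minor2 A 0 1 0 1 * minor2 A 0 2 0 2 - minor2 A 0 1 0 2 * minor2 A 0 2 0 1 =
      A 0 0 * (A.submatrix ![0, 1, 2] ![0, 1, 2]).det := by
  simp only [minor2, Matrix.det_fin_three]
  simp
  ring

end Jacobi

/-! ### The indefinite hermitian form -/

/-- The form `u† J w`. -/
def pair (u w : Fin 4 → ℂ) : ℂ := ∑ j, conj (u j) * J j j * w j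

/-- The contraction of a 2-tensor with the form. -/
def contr (u : Fin 4 → ℂ) (W : Matrix (Fin 4) (Fin 4) ℂ) (i : Fin 4) : ℂ :=
  ∑ j, conj (u j) * J j j * W j i

/-- The form on 2-tensors. -/
noncomputable def pair2 (V W : Matrix (Fin 4) (Fin 4) ℂ) : ℂ :=
  (∑ i, ∑ j, conj (V i j) * J i i * J j j * W i j) / 2

theorem contr_wedge (v u w : Fin 4 → ℂ) : contr v (wedge u w) = pair v u • w - pair v w • u := by
  funext i
  simp only [contr, wedge_apply, pair, Pi.sub_apply, Pi.smul_apply, smul_eq_mul, Finset.sum_mul,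
    ← Finset.sum_sub_distrib]
  refine Finset.sum_congr rfl fun j _ => ?_
  ring

theorem pair2_wedge (v v' u w : Fin 4 → ℂ) :
    pair2 (wedge v v') (wedge u w) = pair v u * pair v' w - pair v w * pair v' u := by
  simp only [pair2, pair, wedge_apply, map_sub, map_mul, Fin.sum_univ_four]
  ring

theorem conj_J (i : Fin 4) : conj (J i i) = J i i := by
  rw [Potential.J_eq]; fin_cases i <;> simp

theorem conj_pair (u w : Fin 4 → ℂ) : conj (pair u w) = pair w u := by
  simp only [pair, map_sum, map_mul, Complex.conj_conj, conj_J]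
  exact Finset.sum_congr rfl fun j _ => by ring

theorem conjTranspose_mul_J_mul_apply (M N : Matrix (Fin 4) (Fin 4) ℂ) (a b : Fin 4) :
    (M.conjTranspose * J * N) a b = pair (fun i => M i a) fun i => N i b := by
  simp only [pair, Matrix.mul_apply, Matrix.conjTranspose_apply]
  refine Finset.sum_congr rfl fun j _ => ?_
  congr 1
  rw [Finset.sum_eq_single j]
  · rfl
  · intro i _ hij
    rw [J, Matrix.diagonal_apply_ne _ hij, mul_zero]
  · simp

namespace Potential

variable {P : Potential}

/-! ### The scattering matrix on the real line -/

theorem IsJost.hasDerivAt_pairing {t s : ℝ} {l l' : Filter ℝ} {c c' : ℂ}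
    {Φ Ψ : ℝ → Matrix (Fin 4) (Fin 4) ℂ} (h : P.IsJost l c t s Φ) (h' : P.IsJost l' c' t s Ψ)
    (i j : Fin 4) (x : ℝ) :
    HasDerivAt (fun x => ((Φ x).conjTranspose * J * Ψ x) i j) 0 x := by
  have hJ : ∀ i j, HasDerivAt (fun _ : ℝ => J i j) ((0 : Matrix (Fin 4) (Fin 4) ℂ) i j) x :=
    fun i j => hasDerivAt_const _ _
  have h1 := hasDerivAt_matrix_mul (hasDerivAt_matrix_mul (hasDerivAt_conjTranspose (h.1 x)) hJ)
    (h'.1 x) i j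
  refine h1.congr_deriv ?_
  have h2 := X_conjTranspose_mul_J (P := P) x t s
  rw [Complex.conj_ofReal] at h2
  rw [mul_zero, add_zero, Matrix.conjTranspose_mul, mul_assoc (Φ x).conjTranspose, h2, mul_neg,
    neg_mul, mul_assoc, mul_assoc, mul_assoc, neg_add_cancel]
  rfl

/-- The inverse of the Gram matrix. -/
noncomputable def gramInv (P : Potential) (z : ℂ) : Matrix (Fin 4) (Fin 4) ℂ :=
  Matrix.diagonal ![1 / P.gam z, -1, -1, -(1 / P.gam z)]

theorem gramInv_mul_gram {z : ℂ} (hg : P.gam z ≠ 0) : P.gramInv z * P.gram z = 1 := by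
  rw [gramInv, gram, Matrix.diagonal_mul_diagonal, ← Matrix.diagonal_one]
  congr 1
  funext i
  fin_cases i <;> simp [hg]

/-- The eigenfunctions and the scattering data at one point of the spectrum, with the inverse
`B` of the scattering matrix `A`. -/
structure Scattering (P : Potential) (t s : ℝ) (B : Matrix (Fin 4) (Fin 4) ℂ) : Prop where
  minus : P.IsJost atBot P.qm t s (P.jostMinus t s)
  plus : P.IsJost atTop P.qp t s (P.jostPlus t s)
  minus_eq : ∀ x, P.jostMinus t s x = P.jostPlus t s x * P.scat t s
  plus_eq : ∀ x, P.jostPlus t s x = P.jostMinus t s x * B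
  mul_inv : P.scat t s * B = 1
  inv_mul : B * P.scat t s = 1
  det : (P.scat t s).det = 1
  inv_apply : ∀ i j, P.gram s i i * B i j = conj (P.scat t s j i) * P.gram s j j
  pair_plus_minus : ∀ x i j, pair (fun a => P.jostPlus t s x a i) (fun a => P.jostMinus t s x a j) =
    P.gram s i i * P.scat t s i j
  pair_minus_plus : ∀ x i j, pair (fun a => P.jostMinus t s x a i) (fun a => P.jostPlus t s x a j) =
    P.gram s i i * B i j

/-- Let `G` be the common Gram matrix. Then `φ₊` has inverse `G⁻¹ φ₊† J`, so `A = G⁻¹ φ₊† J φ₋`,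
which is constant because the pairing is. Comparing Gram matrices gives `A† G A = G`, hence the
inverse `B = G⁻¹ A† G`. -/
theorem exists_scattering {t : ℝ} (hP : P.IsAdmissibleAt t) {s : ℝ} (hs : s ∈ P.spec) :
    ∃ B, P.Scattering t s B := by
  have hg : P.gam s ≠ 0 := gam_ne_zero_of_mem_dom_upper (ofReal_mem_dom hs upper)
  have hs0 : s ≠ 0 := hs.1
  have hm : P.IsJost atBot P.qm t s (P.jostMinus t s) :=
    Classical.epsilon_spec (p := P.IsJost atBot P.qm t s) ⟨_, isJost_jostCol hP hs⟩
  have hp : P.IsJost atTop P.qp t s (P.jostPlus t s) :=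
    Classical.epsilon_spec (p := P.IsJost atTop P.qp t s) ⟨_, isJost_jostColP hP hs⟩
  have gm := hm.gram_eq hP.norm_qm hs0
  have gp := hp.gram_eq hP.norm_qp hs0
  have hGi : P.gram s * P.gramInv s = 1 := mul_eq_one_comm.1 (gramInv_mul_gram hg)
  set Φ := P.jostMinus t s with hΦ
  set Ψ := P.jostPlus t s with hΨ
  have inv : ∀ {M : Matrix (Fin 4) (Fin 4) ℂ}, M.conjTranspose * J * M = P.gram s →
      M * (P.gramInv s * (M.conjTranspose * J)) = 1 := by
    intro M h
    refine mul_eq_one_comm.1 ?_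
    rw [mul_assoc, h, gramInv_mul_gram hg]
  have hA : ∃ A, ∀ x, Φ x = Ψ x * A := by
    refine ⟨P.gramInv s * ((Ψ 0).conjTranspose * J * Φ 0), fun x => ?_⟩
    have hc : (Ψ 0).conjTranspose * J * Φ 0 = (Ψ x).conjTranspose * J * Φ x := by
      ext i j
      exact eq_const_of_hasDerivAt_zero (hp.hasDerivAt_pairing hm i j) 0 x
    rw [hc, ← mul_assoc (P.gramInv s), ← mul_assoc (Ψ x), inv (gp x), one_mul]
  have hscat : ∀ x, Φ x = Ψ x * P.scat t s := by
    have := Classical.epsilon_spec (p := fun A => ∀ x, P.jostMinus t s x = P.jostPlus t s x * A) hA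
    exact this
  set A := P.scat t s with hAdef
  have hG : A.conjTranspose * P.gram s * A = P.gram s := by
    have h1 : A.conjTranspose * ((Ψ 0).conjTranspose * J * Ψ 0) * A =
        (Φ 0).conjTranspose * J * Φ 0 := by
      rw [hscat 0, Matrix.conjTranspose_mul]
      simp only [mul_assoc]
    rwa [gm 0, gp 0] at h1
  have hBA : (P.gramInv s * (A.conjTranspose * P.gram s)) * A = 1 := by
    rw [mul_assoc, hG, gramInv_mul_gram hg]
  have hAB := mul_eq_one_comm.1 hBA
  refine ⟨P.gramInv s * (A.conjTranspose * P.gram s), hm, hp, hscat, fun x => ?_, hAB, hBA, ?_,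
    fun i j => ?_, fun x i j => ?_, fun x i j => ?_⟩
  · change Ψ x = Φ x * _
    rw [hscat x, mul_assoc, hAB, mul_one]
  · have h1 := hm.det_eq hP.norm_qm hs0 0
    have h2 := hp.det_eq hP.norm_qp hs0 0
    change (Φ 0).det = _ at h1
    rw [hscat 0, Matrix.det_mul, h2] at h1
    exact mul_left_cancel₀ (mul_ne_zero hg (Complex.exp_ne_zero _)) (h1.trans (mul_one _).symm)
  · have h1 : P.gram s * (P.gramInv s * (A.conjTranspose * P.gram s)) =
        A.conjTranspose * P.gram s := by rw [← mul_assoc, hGi, one_mul]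
    have h2 := congrFun (congrFun h1 i) j
    rw [gram, Matrix.diagonal_mul, Matrix.mul_diagonal] at h2
    rw [gram, Matrix.diagonal_apply_eq, Matrix.diagonal_apply_eq, h2]
    rfl
  · rw [← conjTranspose_mul_J_mul_apply (Ψ x) (Φ x), hscat x, ← mul_assoc, gp x, gram,
      Matrix.diagonal_mul, Matrix.diagonal_apply_eq]
  · have h1 : (Φ x).conjTranspose * J * Ψ x = A.conjTranspose * P.gram s := by
      rw [hscat x, Matrix.conjTranspose_mul, mul_assoc, mul_assoc, ← mul_assoc _ J, gp x]
    have h3 : P.gram s * (P.gramInv s * (A.conjTranspose * P.gram s)) =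
        A.conjTranspose * P.gram s := by rw [← mul_assoc, hGi, one_mul]
    have h2 := congrFun (congrFun h3 i) j
    rw [gram, Matrix.diagonal_mul] at h2
    rw [← conjTranspose_mul_J_mul_apply (Φ x) (Ψ x), h1, gram, Matrix.diagonal_apply_eq, h2]

/-! ### The symmetry `z ↦ q_o² / z` -/

/-- The matrix which relates the Jost eigenfunctions at `z` and at `q_o² / z`. -/
noncomputable def swap (c z : ℂ) : Matrix (Fin 4) (Fin 4) ℂ :=
  !![0, 0, 0, -(Complex.I * conj c) / z;
     0, 1, 0, 0;
     0, 0, 1, 0;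
     Complex.I * c / z, 0, 0, 0]

theorem k_inv (hq : P.qo ≠ 0) {z : ℂ} (hz : z ≠ 0) : P.k ((P.qo : ℂ) ^ 2 / z) = P.k z := by
  have : (P.qo : ℂ) ≠ 0 := Complex.ofReal_ne_zero.2 hq
  simp only [k]
  field_simp
  ring

theorem lam_inv (hq : P.qo ≠ 0) {z : ℂ} (hz : z ≠ 0) : P.lam ((P.qo : ℂ) ^ 2 / z) = -P.lam z := by
  have : (P.qo : ℂ) ≠ 0 := Complex.ofReal_ne_zero.2 hq
  simp only [lam]
  field_simp
  ring

/-- The inversion fixes `k` and reverses `λ`. It therefore fixes `θ₂`, reverses `θ₁`, and exchanges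
the first and last eigenvectors up to scalars, which `swap` records. -/
theorem E_mul_expTheta_inv (hq : P.qo ≠ 0) {c : ℂ} (hc : ‖c‖ = P.qo) (x t : ℝ) {z : ℂ}
    (hz : z ≠ 0) :
    E c ((P.qo : ℂ) ^ 2 / z) * P.expTheta x t ((P.qo : ℂ) ^ 2 / z) * swap c z =
      E c z * P.expTheta x t z := by
  have h0 : (P.qo : ℂ) ≠ 0 := Complex.ofReal_ne_zero.2 hq
  have h1 := mul_conj_eq hc
  have e1 : P.theta1 x t ((P.qo : ℂ) ^ 2 / z) = -P.theta1 x t z := by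
    simp only [theta1, k_inv hq hz, lam_inv hq hz]; ring
  have e2 : P.theta2 x t ((P.qo : ℂ) ^ 2 / z) = P.theta2 x t z := by
    simp only [theta2, k_inv hq hz, lam_inv hq hz]; ring
  have h2 := Complex.I_sq
  have h3 : ∀ a b c : ℂ, Matrix.diagonal ![a, b, b, c] =
      !![a, 0, 0, 0; 0, b, 0, 0; 0, 0, b, 0; 0, 0, 0, c] := by
    intro a b c
    ext i j
    fin_cases i <;> fin_cases j <;> rfl
  rw [E_eq, E_eq, expTheta, expTheta, e1, e2, h3, h3, mul_neg, neg_neg]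
  generalize Complex.exp (Complex.I * P.theta1 x t z) = a
  generalize Complex.exp (-(Complex.I * P.theta1 x t z)) = b
  ext i j
  fin_cases i <;> fin_cases j <;>
    simp [swap, Matrix.mul_apply, Fin.sum_univ_four] <;> field_simp
  · linear_combination a * h1 - a * c * conj c * h2
  · linear_combination b * h1 - b * c * conj c * h2

theorem IsJost.inv (hq : P.qo ≠ 0) {l : Filter ℝ} {c : ℂ} (hc : ‖c‖ = P.qo) {t : ℝ} {z : ℂ}
    (hz : z ≠ 0) {Φ : ℝ → Matrix (Fin 4) (Fin 4) ℂ} (h : P.IsJost l c t ((P.qo : ℂ) ^ 2 / z) Φ) :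
    P.IsJost l c t z fun x => Φ x * swap c z := by
  refine ⟨fun x i j => ?_, fun i j => ?_⟩
  · have h1 := hasDerivAt_matrix_mul_mul (M := 1) (N := swap c z) (h.1 x) i j
    simp only [one_mul] at h1
    refine h1.congr_deriv ?_
    rw [X, X, k_inv hq hz, mul_assoc]
  · have h1 : Tendsto (fun x => ∑ m, (Φ x i m - (E c ((P.qo : ℂ) ^ 2 / z) *
        P.expTheta x t ((P.qo : ℂ) ^ 2 / z)) i m) * swap c z m j) l (𝓝 (∑ m, 0 * swap c z m j)) :=
      tendsto_finsetSum _ fun m _ => (h.2 i m).mul_const _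
    simp only [zero_mul, Finset.sum_const_zero] at h1
    refine h1.congr fun x => ?_
    change _ = (Φ x * swap c z) i j - _
    rw [← E_mul_expTheta_inv hq hc x t hz, Matrix.mul_apply, Matrix.mul_apply,
      ← Finset.sum_sub_distrib]
    exact Finset.sum_congr rfl fun m _ => sub_mul _ _ _

theorem IsJost.unique_top {t : ℝ} (hP : P.IsAdmissibleAt t) {s : ℝ} (hs : s ∈ P.spec)
    {Φ Ψ : ℝ → Matrix (Fin 4) (Fin 4) ℂ} (h : P.IsJost atTop P.qp t s Φ)
    (h' : P.IsJost atTop P.qp t s Ψ) : Φ = Ψ := by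
  have h1 := h.refl tendsto_neg_atBot_atTop
  have h2 := h'.refl tendsto_neg_atBot_atTop
  rw [← Complex.ofReal_neg] at h1 h2
  have h3 := IsJost.unique hP.refl (neg_mem_spec hs) h1 h2
  funext x
  simpa using congrFun h3 (-x)

section

variable {t : ℝ} (hP : P.IsAdmissibleAt t) {s : ℝ} (hs : s ∈ P.spec)

include hP hs

theorem jostMinus_inv (x : ℝ) :
    P.jostMinus t s x = P.jostMinus t (P.qo ^ 2 / s) x * swap P.qm s := by
  have hq := hP.qo_pos.ne'
  obtain ⟨B, hB⟩ := exists_scattering hP hs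
  obtain ⟨B', hB'⟩ := exists_scattering hP (inv_mem_spec hq hs)
  have h := hB'.minus
  push_cast at h
  exact congrFun (hB.minus.unique hP hs (h.inv hq hP.norm_qm (Complex.ofReal_ne_zero.2 hs.1))) x

theorem jostPlus_inv (x : ℝ) :
    P.jostPlus t s x = P.jostPlus t (P.qo ^ 2 / s) x * swap P.qp s := by
  have hq := hP.qo_pos.ne'
  obtain ⟨B, hB⟩ := exists_scattering hP hs
  obtain ⟨B', hB'⟩ := exists_scattering hP (inv_mem_spec hq hs)
  have h := hB'.plus
  push_cast at h
  exact congrFun (hB.plus.unique_top hP hs (h.inv hq hP.norm_qp (Complex.ofReal_ne_zero.2 hs.1))) x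

/-- Both families of Jost solutions transform by a constant right factor under inversion; cancelling
the invertible `φ₊` in `φ₋ = φ₊ A` leaves this intertwining relation. -/
theorem swap_mul_scat : swap P.qp s * P.scat t s = P.scat t (P.qo ^ 2 / s) * swap P.qm s := by
  have hq := hP.qo_pos.ne'
  have hs' := inv_mem_spec hq hs
  obtain ⟨B, hB⟩ := exists_scattering hP hs
  obtain ⟨B', hB'⟩ := exists_scattering hP hs'
  have h1 := hB.minus_eq 0
  rw [jostMinus_inv hP hs, jostPlus_inv hP hs, hB'.minus_eq] at h1
  have hdet : IsUnit (P.jostPlus t (P.qo ^ 2 / s) 0).det := by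
    rw [hB'.plus.det_eq hP.norm_qp hs'.1]
    exact (mul_ne_zero (gam_ne_zero_of_mem_dom_upper (ofReal_mem_dom hs' upper))
      (Complex.exp_ne_zero _)).isUnit
  have h2 := congrArg (fun M => (P.jostPlus t (P.qo ^ 2 / s) 0)⁻¹ * M) h1
  simp only [mul_assoc] at h2
  rw [Matrix.nonsing_inv_mul_cancel_left _ _ hdet, Matrix.nonsing_inv_mul_cancel_left _ _ hdet] at h2
  exact h2.symm

end

/-! ### Closed forms of the analytic continuations -/

theorem Reg.of_refl {V : Type} [NormedAddCommGroup V] [NormedSpace ℂ V] {U : Set ℂ} {F : ℂ → V}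
    (h : P.refl.Reg U F) : P.Reg U F :=
  ⟨h.diff, h.cont⟩

theorem Reg.jostColP_lower {t : ℝ} (hP : P.IsAdmissibleAt t) (x : ℝ) :
    P.Reg lower fun z => P.jostColP t z 0 x :=
  (Reg.of_refl (Reg.jostCol_upper hP.refl (-x))).comp_neg_upper

theorem Reg.jostTensorP_lower {t : ℝ} (hP : P.IsAdmissibleAt t) {a : Fin 4} (ha : a = 1 ∨ a = 2)
    (x : ℝ) (i j : Fin 4) : P.Reg lower fun z => P.jostTensorP t z a x i j :=
  (Reg.of_refl (Reg.jostTensor_upper hP.refl ha (-x) i j)).comp_neg_upper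

/-- The minor with first row and column `1`. -/
noncomputable def minorOne (P : Potential) (t : ℝ) (z : ℂ) : ℂ :=
  pair (P.jostColP t (conj z) 0 0) (P.jostCol t z 0 0) / P.gam z

/-- The principal minor with rows and columns `1` and `a + 1`. -/
noncomputable def minorTwo (P : Potential) (t : ℝ) (a : Fin 4) (z : ℂ) : ℂ :=
  -pair2 (P.jostTensorP t (conj z) a 0) (P.jostTensor t z a 0) / P.gam z

/-- The auxiliary eigenfunctions `a₁₁ φ₋ₐ - a₁ₐ φ₋₁` in the upper half plane. -/
noncomputable def chiP (P : Potential) (t : ℝ) (a : Fin 4) (x : ℝ) (z : ℂ) : Fin 4 → ℂ :=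
  (1 / P.gam z) • contr (P.jostColP t (conj z) 0 x) (P.jostTensor t z a x)

/-- The auxiliary eigenfunctions `b₁₁ φ₊ₐ - b₁ₐ φ₊₁` in the lower half plane, where `b` is the
inverse of the scattering matrix. -/
noncomputable def chiM (P : Potential) (t : ℝ) (a : Fin 4) (x : ℝ) (z : ℂ) : Fin 4 → ℂ :=
  (1 / P.gam z) • contr (P.jostCol t (conj z) 0 x) (P.jostTensorP t z a x)

theorem jostColP_refl (t : ℝ) (z : ℂ) (j : Fin 4) (x : ℝ) :
    P.refl.jostColP t (-z) j (-x) = P.jostCol t z j x := by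
  rw [jostColP, refl_refl, neg_neg, neg_neg]

theorem chiP_refl (t : ℝ) (a : Fin 4) (x : ℝ) (z : ℂ) :
    P.refl.chiP t a (-x) (-z) = P.chiM t a x z := by
  rw [chiP, chiM, map_neg, jostColP_refl, refl_gam]
  rfl

theorem Reg.pair {U : Set ℂ} {f g : ℂ → Fin 4 → ℂ} (hf : ∀ i, P.Reg U fun z => conj (f z i))
    (hg : ∀ i, P.Reg U fun z => g z i) : P.Reg U fun z => pair (f z) (g z) :=
  Reg.sum _ fun i => ((hf i).mul (Reg.const _)).mul (hg i)

/-- The left entry of the pairing is evaluated at `conj z` and conjugated, which makes it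
holomorphic in `z`; no other Jost column enters. -/
theorem Reg.minorOne_upper {t : ℝ} (hP : P.IsAdmissibleAt t) : P.Reg upper (P.minorOne t) :=
  (Reg.pair (fun i => ((Reg.jostColP_lower hP 0).apply i).conj_conj_lower)
    fun i => (Reg.jostCol_upper hP 0).apply i).div Reg.gam_upper
      fun _ hz => gam_ne_zero_of_mem_dom_upper hz

theorem Reg.minorTwo_upper {t : ℝ} (hP : P.IsAdmissibleAt t) {a : Fin 4} (ha : a = 1 ∨ a = 2) :
    P.Reg upper (P.minorTwo t a) := by
  refine Reg.div (Reg.neg ?_) Reg.gam_upper fun _ hz => gam_ne_zero_of_mem_dom_upper hz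
  refine Reg.div ?_ (Reg.const 2) fun _ _ => two_ne_zero
  exact Reg.sum _ fun i => Reg.sum _ fun j =>
    ((((Reg.jostTensorP_lower hP ha 0 i j).conj_conj_lower).mul (Reg.const _)).mul
      (Reg.const _)).mul (Reg.jostTensor_upper hP ha 0 i j)

theorem Reg.chiP_upper {t : ℝ} (hP : P.IsAdmissibleAt t) {a : Fin 4} (ha : a = 1 ∨ a = 2) (x : ℝ) :
    P.Reg upper (P.chiP t a x) := by
  refine Reg.smul ((Reg.const 1).div Reg.gam_upper fun _ hz => gam_ne_zero_of_mem_dom_upper hz)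
    (Reg.pi fun i => ?_)
  exact Reg.sum _ fun j => ((((Reg.jostColP_lower hP x).apply j).conj_conj_lower).mul
    (Reg.const _)).mul (Reg.jostTensor_upper hP ha x j i)

theorem Reg.chiM_lower {t : ℝ} (hP : P.IsAdmissibleAt t) {a : Fin 4} (ha : a = 1 ∨ a = 2) (x : ℝ) :
    P.Reg lower (P.chiM t a x) := by
  have h := (Reg.of_refl (Reg.chiP_upper hP.refl ha (-x))).comp_neg_upper
  simpa only [chiP_refl] using h

/-! ### Values on the real line -/

/-- The quotient of the boundary values. -/
noncomputable def rho (P : Potential) : ℂ := conj P.qp / conj P.qm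

theorem qm_ne_zero {t : ℝ} (hP : P.IsAdmissibleAt t) : P.qm ≠ 0 := by
  rw [← norm_ne_zero_iff, hP.norm_qm]; exact hP.qo_pos.ne'

theorem qp_ne_zero {t : ℝ} (hP : P.IsAdmissibleAt t) : P.qp ≠ 0 := by
  rw [← norm_ne_zero_iff, hP.norm_qp]; exact hP.qo_pos.ne'

theorem conj_ne_zero {z : ℂ} (hz : z ≠ 0) : conj z ≠ 0 := by simpa using hz

theorem rho_ne_zero {t : ℝ} (hP : P.IsAdmissibleAt t) : P.rho ≠ 0 :=
  div_ne_zero (conj_ne_zero (qp_ne_zero hP)) (conj_ne_zero (qm_ne_zero hP))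

/-- The two boundary values have the same modulus, so their quotient is unimodular. -/
theorem conj_rho {t : ℝ} (hP : P.IsAdmissibleAt t) : conj P.rho = P.rho⁻¹ := by
  have h1 := mul_conj_eq hP.norm_qm
  have h2 := mul_conj_eq hP.norm_qp
  have h3 := conj_ne_zero (qp_ne_zero hP)
  rw [rho, inv_div, map_div₀, Complex.conj_conj, Complex.conj_conj,
    div_eq_div_iff (qm_ne_zero hP) h3, mul_comm (conj P.qm), h1, h2]

/-- Entrywise form of the intertwining relation: indices 0 and 3 trade places, and the middle block
is unchanged. It serves `A` and, with `q₊` and `q₋` exchanged, its inverse. -/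
theorem swap_entries {M N : Matrix (Fin 4) (Fin 4) ℂ} {c d z : ℂ} (hd : d ≠ 0) (hz : z ≠ 0)
    (h : swap c z * M = N * swap d z) :
    N 0 0 = conj c / conj d * M 3 3 ∧
    (∀ j, j = 1 ∨ j = 2 → N 0 j = -(Complex.I * conj c) / z * M 3 j) ∧
    (∀ i, i = 1 ∨ i = 2 → N i 0 * (-(Complex.I * conj d) / z) = M i 3) ∧
    ∀ i j, (i = 1 ∨ i = 2) → (j = 1 ∨ j = 2) → N i j = M i j := by
  have hI := Complex.I_ne_zero
  have hd' := conj_ne_zero hd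
  have e : ∀ i j, (swap c z * M) i j = (N * swap d z) i j := fun i j => by rw [h]
  simp only [Matrix.mul_apply, Fin.sum_univ_four] at e
  refine ⟨?_, ?_, ?_, ?_⟩
  · have := e 0 3
    simp [swap] at this
    field_simp at this ⊢
    linear_combination this
  · rintro j (rfl | rfl)
    · have := e 0 1
      simp [swap] at this
      exact this.symm
    · have := e 0 2
      simp [swap] at this
      exact this.symm
  · rintro i (rfl | rfl)
    · have := e 1 3
      simp [swap] at this
      exact this.symm
    · have := e 2 3
      simp [swap] at this
      exact this.symm
  · rintro i j (rfl | rfl) (rfl | rfl)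
    · simpa [swap] using (e 1 1).symm
    · simpa [swap] using (e 1 2).symm
    · simpa [swap] using (e 2 1).symm
    · simpa [swap] using (e 2 2).symm

theorem pair_jost_apply {t s : ℝ} {B : Matrix (Fin 4) (Fin 4) ℂ} (hP : P.IsAdmissibleAt t)
    (hs : s ∈ P.spec) (hB : P.Scattering t s B) (x : ℝ) (i j : Fin 4) :
    pair (P.jostColP t s i x) (P.jostCol t s j x) = P.gram s i i * P.scat t s i j ∧
    pair (P.jostCol t s i x) (P.jostColP t s j x) = P.gram s i i * B i j := by
  have h1 := hB.pair_plus_minus x i j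
  have h2 := hB.pair_minus_plus x i j
  rw [jostMinus_eq hP hs, jostPlus_eq hP hs] at h1 h2
  exact ⟨h1, h2⟩

theorem gram_zero (z : ℂ) : P.gram z 0 0 = P.gam z := rfl
theorem gram_three (z : ℂ) : P.gram z 3 3 = -P.gam z := rfl
theorem gram_mid (z : ℂ) {a : Fin 4} (ha : a = 1 ∨ a = 2) : P.gram z a a = -1 := by
  rcases ha with rfl | rfl <;> rfl

section

variable {t : ℝ} (hP : P.IsAdmissibleAt t) {s : ℝ} (hs : s ∈ P.spec)

include hP hs

theorem minorOne_ofReal : P.minorOne t s = P.scat t s 0 0 := by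
  obtain ⟨B, hB⟩ := exists_scattering hP hs
  have hg : P.gam s ≠ 0 := gam_ne_zero_of_mem_dom_upper (ofReal_mem_dom hs upper)
  rw [minorOne, Complex.conj_ofReal, (pair_jost_apply hP hs hB 0 0 0).1, gram_zero,
    mul_div_cancel_left₀ _ hg]

theorem minorTwo_ofReal {a : Fin 4} (ha : a = 1 ∨ a = 2) :
    P.minorTwo t a s = minor2 (P.scat t s) 0 a 0 a := by
  obtain ⟨B, hB⟩ := exists_scattering hP hs
  have hg : P.gam s ≠ 0 := gam_ne_zero_of_mem_dom_upper (ofReal_mem_dom hs upper)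
  rw [minorTwo, Complex.conj_ofReal, jostTensorP_eq_wedge hP hs ha, jostTensor_eq_wedge hP hs ha,
    pair2_wedge, (pair_jost_apply hP hs hB 0 0 0).1, (pair_jost_apply hP hs hB 0 a a).1,
    (pair_jost_apply hP hs hB 0 0 a).1, (pair_jost_apply hP hs hB 0 a 0).1, gram_zero,
    gram_mid _ ha, minor2, div_eq_iff hg]
  ring

theorem chiP_ofReal {a : Fin 4} (ha : a = 1 ∨ a = 2) (x : ℝ) :
    P.chiP t a x s = P.scat t s 0 0 • P.jostCol t s a x - P.scat t s 0 a • P.jostCol t s 0 x := by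
  obtain ⟨B, hB⟩ := exists_scattering hP hs
  have hg : P.gam s ≠ 0 := gam_ne_zero_of_mem_dom_upper (ofReal_mem_dom hs upper)
  rw [chiP, Complex.conj_ofReal, jostTensor_eq_wedge hP hs ha, contr_wedge,
    (pair_jost_apply hP hs hB x 0 0).1, (pair_jost_apply hP hs hB x 0 a).1, gram_zero, smul_sub,
    smul_smul, smul_smul, ← mul_assoc, ← mul_assoc, one_div, inv_mul_cancel₀ hg, one_mul, one_mul]

theorem chiM_ofReal {B : Matrix (Fin 4) (Fin 4) ℂ} (hB : P.Scattering t s B) {a : Fin 4}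
    (ha : a = 1 ∨ a = 2) (x : ℝ) :
    P.chiM t a x s = B 0 0 • P.jostColP t s a x - B 0 a • P.jostColP t s 0 x := by
  have hg : P.gam s ≠ 0 := gam_ne_zero_of_mem_dom_upper (ofReal_mem_dom hs upper)
  rw [chiM, Complex.conj_ofReal, jostTensorP_eq_wedge hP hs ha, contr_wedge,
    (pair_jost_apply hP hs hB x 0 0).2, (pair_jost_apply hP hs hB x 0 a).2, gram_zero, smul_sub,
    smul_smul, smul_smul, ← mul_assoc, ← mul_assoc, one_div, inv_mul_cancel₀ hg, one_mul, one_mul]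

theorem swap_mul_inv {B B' : Matrix (Fin 4) (Fin 4) ℂ} (hB : P.Scattering t s B)
    (hB' : P.Scattering t (P.qo ^ 2 / s) B') : swap P.qm s * B = B' * swap P.qp s := by
  have h := congrArg (fun M => B' * M * B) (swap_mul_scat hP hs)
  simp only [mul_assoc] at h
  rw [hB.mul_inv, mul_one, ← mul_assoc B', hB'.inv_mul, one_mul] at h
  exact h.symm

theorem jostCol_inv (x : ℝ) :
    (∀ a, a = 1 ∨ a = 2 → P.jostCol t ((P.qo ^ 2 / s : ℝ) : ℂ) a x = P.jostCol t s a x) ∧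
    P.jostCol t s 3 x =
      (-(Complex.I * conj P.qm) / s) • P.jostCol t ((P.qo ^ 2 / s : ℝ) : ℂ) 0 x := by
  have h := jostMinus_inv hP hs x
  rw [jostMinus_eq hP hs, jostMinus_eq hP (inv_mem_spec hP.qo_pos.ne' hs)] at h
  have e : ∀ i j, _ := fun i j => congrFun (congrFun h i) j
  simp only [Matrix.mul_apply, Fin.sum_univ_four] at e
  refine ⟨?_, ?_⟩
  · rintro a (rfl | rfl)
    · funext i
      have := e i 1
      simp [swap] at this ⊢
      exact this.symm
    · funext i
      have := e i 2
      simp [swap] at this ⊢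
      exact this.symm
  · funext i
    have := e i 3
    simp [swap] at this ⊢
    rw [this, mul_comm]

theorem jostColP_inv (x : ℝ) :
    (∀ a, a = 1 ∨ a = 2 → P.jostColP t ((P.qo ^ 2 / s : ℝ) : ℂ) a x = P.jostColP t s a x) ∧
    P.jostColP t s 3 x =
      (-(Complex.I * conj P.qp) / s) • P.jostColP t ((P.qo ^ 2 / s : ℝ) : ℂ) 0 x := by
  have h := jostPlus_inv hP hs x
  rw [jostPlus_eq hP hs, jostPlus_eq hP (inv_mem_spec hP.qo_pos.ne' hs)] at h
  have e : ∀ i j, _ := fun i j => congrFun (congrFun h i) j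
  simp only [Matrix.mul_apply, Fin.sum_univ_four] at e
  refine ⟨?_, ?_⟩
  · rintro a (rfl | rfl)
    · funext i
      have := e i 1
      simp [swap] at this ⊢
      exact this.symm
    · funext i
      have := e i 2
      simp [swap] at this ⊢
      exact this.symm
  · funext i
    have := e i 3
    simp [swap] at this ⊢
    rw [this, mul_comm]

end

/-! ### Scattering data at `s` and at `q_o² / s` -/

theorem mulVec_cols (M : Matrix (Fin 4) (Fin 4) ℂ) (v : Fin 4 → ℂ) :
    M.mulVec v = v 0 • M.col 0 + v 1 • M.col 1 + v 2 • M.col 2 + v 3 • M.col 3 := by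
  funext i
  simp only [Matrix.mulVec, dotProduct, Fin.sum_univ_four, Pi.add_apply, Pi.smul_apply,
    smul_eq_mul, Matrix.col_apply]
  ring

section

variable {t : ℝ} (hP : P.IsAdmissibleAt t) {s : ℝ} (hs : s ∈ P.spec)
  {B : Matrix (Fin 4) (Fin 4) ℂ} (hB : P.Scattering t s B)

include hP hs

theorem jostMinus_col (x : ℝ) (j : Fin 4) : (P.jostMinus t s x).col j = P.jostCol t s j x := by
  rw [jostMinus_eq hP hs]; rfl

theorem jostPlus_col (x : ℝ) (j : Fin 4) : (P.jostPlus t s x).col j = P.jostColP t s j x := by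
  rw [jostPlus_eq hP hs]; rfl

include hB

theorem jostCol_eq_sum (x : ℝ) (j : Fin 4) : P.jostCol t s j x =
    P.scat t s 0 j • P.jostColP t s 0 x + P.scat t s 1 j • P.jostColP t s 1 x +
    P.scat t s 2 j • P.jostColP t s 2 x + P.scat t s 3 j • P.jostColP t s 3 x := by
  have h := hB.minus_eq x
  rw [← jostMinus_col hP hs, h]
  simp only [← jostPlus_col hP hs]
  rw [← mulVec_cols _ fun i => P.scat t s i j]
  rfl

theorem jostColP_eq_sum (x : ℝ) (j : Fin 4) : P.jostColP t s j x =
    B 0 j • P.jostCol t s 0 x + B 1 j • P.jostCol t s 1 x +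
    B 2 j • P.jostCol t s 2 x + B 3 j • P.jostCol t s 3 x := by
  have h := hB.plus_eq x
  rw [← jostPlus_col hP hs, h]
  simp only [← jostMinus_col hP hs]
  rw [← mulVec_cols _ fun i => B i j]
  rfl

omit hP in
theorem inv_zero_zero : B 0 0 = conj (P.scat t s 0 0) := by
  have hg : P.gam s ≠ 0 := gam_ne_zero_of_mem_dom_upper (ofReal_mem_dom hs upper)
  have h := hB.inv_apply 0 0
  rw [gram_zero, mul_comm] at h
  exact mul_right_cancel₀ hg h

omit hP in
theorem inv_three_three : B 3 3 = conj (P.scat t s 3 3) := by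
  have hg : P.gam s ≠ 0 := gam_ne_zero_of_mem_dom_upper (ofReal_mem_dom hs upper)
  have h := hB.inv_apply 3 3
  rw [gram_three, mul_comm] at h
  exact mul_right_cancel₀ (neg_ne_zero.2 hg) h

/-- In `B = G⁻¹ A† G` with `G` diagonal, the Gram factors cancel from every principal minor. -/
theorem minor2_inv {a : Fin 4} (ha : a = 1 ∨ a = 2) :
    minor2 B 0 a 0 a = conj (minor2 (P.scat t s) 0 a 0 a) := by
  have hg : P.gam s ≠ 0 := gam_ne_zero_of_mem_dom_upper (ofReal_mem_dom hs upper)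
  have h0 := hB.inv_apply 0 a
  have h1 := hB.inv_apply a 0
  have h2 := hB.inv_apply a a
  rw [gram_zero, gram_mid _ ha] at h0 h1
  rw [gram_mid _ ha] at h2
  have h3 := inv_zero_zero hs hB
  refine mul_left_cancel₀ hg ?_
  simp only [minor2, map_sub, map_mul]
  rw [← h3]
  linear_combination (-P.gam s * B 0 0) * h2 + (-B a 0) * h0 - conj (P.scat t s a 0) * h1

omit hP hs hB in
theorem minor_eq_minor2 (i j k l : Fin 4) :
    P.minor ![i, j] ![k, l] t s = minor2 (P.scat t s) i j k l := by
  rw [minor, Matrix.det_fin_two]; rfl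

end

/-! ### The functions of the statement -/

section

variable {t : ℝ} (hP : P.IsAdmissibleAt t)

include hP

theorem phiM1_spec (x : ℝ) : ∀ s ∈ P.spec,
    P.jostCol t (s : ℂ) 0 x = fun i => P.jostMinus t s x i 0 := by
  intro s hs
  rw [jostMinus_eq hP hs]; rfl

theorem phiP1_spec (x : ℝ) : ∀ s ∈ P.spec,
    P.jostColP t (s : ℂ) 0 x = fun i => P.jostPlus t s x i 0 := by
  intro s hs
  rw [jostPlus_eq hP hs]; rfl

theorem phiM1_eq (x : ℝ) {z : ℂ} (hz : z ∈ upper) : P.phiM1 x t z = P.jostCol t z 0 x :=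
  Reg.extUp_eq (Reg.jostCol_upper hP x) (phiM1_spec hP x) hz

theorem phiP1_eq (x : ℝ) {z : ℂ} (hz : z ∈ lower) : P.phiP1 x t z = P.jostColP t z 0 x :=
  Reg.extDown_eq (Reg.jostColP_lower hP x) (phiP1_spec hP x) hz

omit hP in
theorem Reg.coeff_upper (c : ℂ) : P.Reg upper fun z => -(Complex.I * conj c) / z :=
  (Reg.const _).div Reg.id fun _ hz => ne_zero_of_mem_dom_upper hz

omit hP in
theorem Reg.coeff_lower (c : ℂ) : P.Reg lower fun z => -(Complex.I * conj c) / z :=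
  (Reg.const _).div Reg.id fun _ hz => ne_zero_of_mem_dom_lower hz

theorem phiP4_eq (x : ℝ) {z : ℂ} (hz : z ∈ upper) :
    P.phiP4 x t z = (-(Complex.I * conj P.qp) / z) • P.jostColP t ((P.qo : ℂ) ^ 2 / z) 0 x := by
  refine Reg.extUp_eq (F := fun z => (-(Complex.I * conj P.qp) / z) •
    P.jostColP t ((P.qo : ℂ) ^ 2 / z) 0 x) (Reg.smul (Reg.coeff_upper _)
    (Reg.comp_inv_lower hP.qo_pos.ne' (Reg.jostColP_lower hP x))) (fun s hs => ?_) hz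
  have h := (jostColP_inv hP hs x).2
  push_cast at h
  rw [← h, ← jostPlus_col hP hs]
  rfl

theorem phiM4_eq (x : ℝ) {z : ℂ} (hz : z ∈ lower) :
    P.phiM4 x t z = (-(Complex.I * conj P.qm) / z) • P.jostCol t ((P.qo : ℂ) ^ 2 / z) 0 x := by
  refine Reg.extDown_eq (F := fun z => (-(Complex.I * conj P.qm) / z) •
    P.jostCol t ((P.qo : ℂ) ^ 2 / z) 0 x) (Reg.smul (Reg.coeff_lower _)
    (Reg.comp_inv_upper hP.qo_pos.ne' (Reg.jostCol_upper hP x))) (fun s hs => ?_) hz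
  have h := (jostCol_inv hP hs x).2
  push_cast at h
  rw [← h, ← jostMinus_col hP hs]
  rfl

theorem minorOne_spec : ∀ s ∈ P.spec, P.minorOne t s = P.minor ![0] ![0] t s := by
  intro s hs
  rw [minorOne_ofReal hP hs, minor, Matrix.det_fin_one]; rfl

theorem A1_eq {z : ℂ} (hz : z ∈ upper) : P.A1 t z = P.minorOne t z :=
  Reg.extUp_eq (Reg.minorOne_upper hP) (minorOne_spec hP) hz

theorem deriv_A1_eq {z : ℂ} (hz : z ∈ upper) : deriv (P.A1 t) z = deriv (P.minorOne t) z :=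
  Reg.deriv_extUp_eq (Reg.minorOne_upper hP) (minorOne_spec hP) hz

theorem minorTwo_spec : ∀ s ∈ P.spec, P.minorTwo t 1 s = P.minor ![0, 1] ![0, 1] t s := by
  intro s hs
  obtain ⟨B, hB⟩ := exists_scattering hP hs
  rw [minorTwo_ofReal hP hs (.inl rfl), minor_eq_minor2]

theorem A12_eq {z : ℂ} (hz : z ∈ upper) : P.A12 t z = P.minorTwo t 1 z :=
  Reg.extUp_eq (Reg.minorTwo_upper hP (.inl rfl)) (minorTwo_spec hP) hz

theorem deriv_A12_eq {z : ℂ} (hz : z ∈ upper) : deriv (P.A12 t) z = deriv (P.minorTwo t 1) z :=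
  Reg.deriv_extUp_eq (Reg.minorTwo_upper hP (.inl rfl)) (minorTwo_spec hP) hz

theorem A234_spec : ∀ s ∈ P.spec,
    conj (P.minorOne t (conj (s : ℂ))) = P.minor ![1, 2, 3] ![1, 2, 3] t s := by
  intro s hs
  obtain ⟨B, hB⟩ := exists_scattering hP hs
  rw [Complex.conj_ofReal, minorOne_ofReal hP hs, minor, (minor3_eq hB.mul_inv hB.det).2,
    inv_zero_zero hs hB]

theorem A234_eq {z : ℂ} (hz : z ∈ lower) : P.A234 t z = conj (P.minorOne t (conj z)) :=
  Reg.extDown_eq (Reg.minorOne_upper hP).conj_conj_upper (A234_spec hP) hz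

theorem deriv_A234_eq {z : ℂ} (hz : z ∈ lower) :
    deriv (P.A234 t) z = deriv (fun z => conj (P.minorOne t (conj z))) z :=
  Reg.deriv_extDown_eq (Reg.minorOne_upper hP).conj_conj_upper (A234_spec hP) hz

theorem A34_spec : ∀ s ∈ P.spec,
    conj (P.minorTwo t 1 (conj (s : ℂ))) = P.minor ![2, 3] ![2, 3] t s := by
  intro s hs
  obtain ⟨B, hB⟩ := exists_scattering hP hs
  rw [Complex.conj_ofReal, minorTwo_ofReal hP hs (.inl rfl), minor_eq_minor2,
    ← (minor2_eq_complement hB.mul_inv hB.det).1, minor2_inv hP hs hB (.inl rfl)]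

theorem A34_eq {z : ℂ} (hz : z ∈ lower) : P.A34 t z = conj (P.minorTwo t 1 (conj z)) :=
  Reg.extDown_eq (Reg.minorTwo_upper hP (.inl rfl)).conj_conj_upper (A34_spec hP) hz

theorem deriv_A34_eq {z : ℂ} (hz : z ∈ lower) :
    deriv (P.A34 t) z = deriv (fun z => conj (P.minorTwo t 1 (conj z))) z :=
  Reg.deriv_extDown_eq (Reg.minorTwo_upper hP (.inl rfl)).conj_conj_upper (A34_spec hP) hz

theorem Reg.minorOne_inv_lower : P.Reg lower fun z => P.rho⁻¹ * P.minorOne t ((P.qo : ℂ) ^ 2 / z) :=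
  (Reg.const _).mul ((Reg.minorOne_upper hP).comp_inv_upper hP.qo_pos.ne')

theorem scat_three_three {s : ℝ} (hs : s ∈ P.spec) :
    P.rho⁻¹ * P.minorOne t ((P.qo : ℂ) ^ 2 / s) = P.scat t s 3 3 := by
  have h := minorOne_ofReal hP (inv_mem_spec hP.qo_pos.ne' hs)
  push_cast at h
  rw [h, (swap_entries (qm_ne_zero hP) (Complex.ofReal_ne_zero.2 hs.1) (swap_mul_scat hP hs)).1,
    ← rho, inv_mul_cancel_left₀ (rho_ne_zero hP)]

theorem A4_spec : ∀ s ∈ P.spec,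
    P.rho⁻¹ * P.minorOne t ((P.qo : ℂ) ^ 2 / (s : ℂ)) = P.minor ![3] ![3] t s := by
  intro s hs
  rw [scat_three_three hP hs, minor, Matrix.det_fin_one]; rfl

theorem deriv_A4_eq {z : ℂ} (hz : z ∈ lower) : deriv (P.A4 t) z =
    deriv (fun z => P.rho⁻¹ * P.minorOne t ((P.qo : ℂ) ^ 2 / z)) z :=
  Reg.deriv_extDown_eq (Reg.minorOne_inv_lower hP) (A4_spec hP) hz

theorem A123_spec : ∀ s ∈ P.spec,
    conj (P.rho⁻¹ * P.minorOne t ((P.qo : ℂ) ^ 2 / conj (s : ℂ))) =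
      P.minor ![0, 1, 2] ![0, 1, 2] t s := by
  intro s hs
  obtain ⟨B, hB⟩ := exists_scattering hP hs
  rw [Complex.conj_ofReal, scat_three_three hP hs, minor, (minor3_eq hB.mul_inv hB.det).1,
    inv_three_three hs hB]

theorem A123_eq {z : ℂ} (hz : z ∈ upper) :
    P.A123 t z = conj (P.rho⁻¹ * P.minorOne t ((P.qo : ℂ) ^ 2 / conj z)) :=
  Reg.extUp_eq (Reg.minorOne_inv_lower hP).conj_conj_lower (A123_spec hP) hz

theorem chi2Up_eq (x : ℝ) {z : ℂ} (hz : z ∈ upper) : P.chi2Up x t z = P.chiP t 1 x z := by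
  refine Reg.extUp_eq (Reg.chiP_upper hP (.inl rfl) x) (fun s hs => ?_) hz
  rw [mulVec_cols, chiP_ofReal hP hs (.inl rfl)]
  simp [jostMinus_col hP hs]
  module

/-- The inversion carries `a₁₁ φ_{-,3} - a₁₃ φ_{-,1}` to `ρ` times `a₄₄ φ_{-,3} - a₄₃ φ_{-,4}`. This
reduces type IV to the type I construction with another middle index. -/
theorem chi3Down_eq (x : ℝ) {z : ℂ} (hz : z ∈ lower) :
    P.chi3Down x t z = P.rho⁻¹ • P.chiP t 2 x ((P.qo : ℂ) ^ 2 / z) := by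
  refine Reg.extDown_eq (F := fun z => P.rho⁻¹ • P.chiP t 2 x ((P.qo : ℂ) ^ 2 / z))
    (Reg.smul (Reg.const _) ((Reg.chiP_upper hP (.inr rfl) x).comp_inv_upper hP.qo_pos.ne'))
    (fun s hs => ?_) hz
  have hs' := inv_mem_spec hP.qo_pos.ne' hs
  have h0 : (s : ℂ) ≠ 0 := Complex.ofReal_ne_zero.2 hs.1
  have h := chiP_ofReal hP hs' (.inr rfl) x
  obtain ⟨e1, e2⟩ := jostCol_inv hP hs x
  obtain ⟨f1, f2, -⟩ := swap_entries (qm_ne_zero hP) h0 (swap_mul_scat hP hs)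
  rw [e1 2 (.inr rfl), f1, f2 2 (.inr rfl)] at h
  push_cast at h
  push_cast at e2
  rw [h, mulVec_cols]
  simp only [jostMinus_col hP hs, e2]
  have hm := conj_ne_zero (qm_ne_zero hP)
  have hp := conj_ne_zero (qp_ne_zero hP)
  simp only [smul_sub, smul_smul, rho]
  simp
  rw [← sub_eq_add_neg]
  congr 1
  · congr 1
    field_simp
  · congr 1
    field_simp

/-- Expanding `b₁₁ φ_{+,2} - b₁₂ φ_{+,1}` in the columns of `φ₋` gives 2 × 2 minors of `B`, which
Jacobi's identity turns into the complementary minors of `A`. -/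
theorem chi2Down_eq (x : ℝ) {z : ℂ} (hz : z ∈ lower) : P.chi2Down x t z = P.chiM t 1 x z := by
  refine Reg.extDown_eq (Reg.chiM_lower hP (.inl rfl) x) (fun s hs => ?_) hz
  obtain ⟨B, hB⟩ := exists_scattering hP hs
  obtain ⟨m1, m2, m3, -⟩ := minor2_eq_complement hB.mul_inv hB.det
  rw [mulVec_cols, chiM_ofReal hP hs hB (.inl rfl)]
  simp only [minor_eq_minor2, ← m1, ← m2, ← m3, jostMinus_col hP hs]
  rw [jostColP_eq_sum hP hs hB x 0, jostColP_eq_sum hP hs hB x 1]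
  funext i
  simp [minor2]
  ring

/-- On the spectrum the right side becomes `b₄₄ φ_{+,3} - b₄₃ φ_{+,4}` by inversion; its
coefficients in the columns of `φ₋` are again complementary minors. -/
theorem chi3Up_eq (x : ℝ) {z : ℂ} (hz : z ∈ upper) :
    P.chi3Up x t z = P.rho • P.chiM t 2 x ((P.qo : ℂ) ^ 2 / z) := by
  refine Reg.extUp_eq (F := fun z => P.rho • P.chiM t 2 x ((P.qo : ℂ) ^ 2 / z))
    (Reg.smul (Reg.const _) ((Reg.chiM_lower hP (.inr rfl) x).comp_inv_lower hP.qo_pos.ne'))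
    (fun s hs => ?_) hz
  have hs' := inv_mem_spec hP.qo_pos.ne' hs
  have h0 : (s : ℂ) ≠ 0 := Complex.ofReal_ne_zero.2 hs.1
  obtain ⟨B, hB⟩ := exists_scattering hP hs
  obtain ⟨B', hB'⟩ := exists_scattering hP hs'
  obtain ⟨-, -, -, m1, m2, m3, -⟩ := minor2_eq_complement hB.mul_inv hB.det
  have h := chiM_ofReal hP hs' hB' (.inr rfl) x
  obtain ⟨e1, e2⟩ := jostColP_inv hP hs x
  obtain ⟨f1, f2, -⟩ := swap_entries (qp_ne_zero hP) h0 (swap_mul_inv hP hs hB hB')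
  have hm := conj_ne_zero (qm_ne_zero hP)
  have hp := conj_ne_zero (qp_ne_zero hP)
  have h1 : P.rho • P.chiM t 2 x ((P.qo : ℂ) ^ 2 / s) =
      B 3 3 • P.jostColP t s 2 x - B 3 2 • P.jostColP t s 3 x := by
    rw [e1 2 (.inr rfl), f1, f2 2 (.inr rfl)] at h
    push_cast at h
    push_cast at e2
    rw [h, e2]
    simp only [smul_sub, smul_smul, rho]
    congr 2 <;> field_simp
  rw [h1, mulVec_cols]
  simp only [minor_eq_minor2, ← m1, ← m2, ← m3, jostMinus_col hP hs]
  rw [jostColP_eq_sum hP hs hB x 2, jostColP_eq_sum hP hs hB x 3]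
  funext i
  simp [minor2]
  ring

end

/-! ### Solutions of the linear system -/

theorem continuous_X {t : ℝ} (hP : P.IsAdmissibleAt t) (z : ℂ) (i j : Fin 4) :
    Continuous fun x => P.X x t z i j := by
  simp only [X_eq, Matrix.add_apply]
  exact continuous_const.add (continuous_pert hP i j)

theorem norm_mulVec_le (M : Matrix (Fin 4) (Fin 4) ℂ) (v : Fin 4 → ℂ) :
    ‖M.mulVec v‖ ≤ (∑ i, ∑ j, ‖M i j‖) * ‖v‖ := by
  refine (pi_norm_le_iff_of_nonneg (by positivity)).2 fun i => ?_
  calc ‖M.mulVec v i‖ = ‖∑ j, M i j * v j‖ := rfl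
    _ ≤ ∑ j, ‖M i j * v j‖ := norm_sum_le _ _
    _ ≤ ∑ j, ‖M i j‖ * ‖v‖ := Finset.sum_le_sum fun j _ => by
        rw [norm_mul]; exact mul_le_mul_of_nonneg_left (norm_le_pi_norm v j) (norm_nonneg _)
    _ = (∑ j, ‖M i j‖) * ‖v‖ := (Finset.sum_mul ..).symm
    _ ≤ (∑ i, ∑ j, ‖M i j‖) * ‖v‖ := by
        refine mul_le_mul_of_nonneg_right ?_ (norm_nonneg _)
        exact Finset.single_le_sum (f := fun i => ∑ j, ‖M i j‖)
          (fun i _ => Finset.sum_nonneg fun j _ => norm_nonneg _) (Finset.mem_univ i)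

theorem IsSol.ext {t : ℝ} (hP : P.IsAdmissibleAt t) {z : ℂ} {φ ψ : ℝ → Fin 4 → ℂ}
    (hφ : P.IsSol t z φ) (hψ : P.IsSol t z ψ) {x₀ : ℝ} (h : φ x₀ = ψ x₀) : φ = ψ := by
  funext x
  set a := min x x₀ - 1
  set b := max x x₀ + 1
  have hx : x ∈ Ioo a b := ⟨by grind, by grind⟩
  have hx₀ : x₀ ∈ Ioo a b := ⟨by grind, by grind⟩
  have hc : Continuous fun y => ∑ i, ∑ j, ‖P.X y t z i j‖ :=
    continuous_finsetSum _ fun i _ => continuous_finsetSum _ fun j _ => (continuous_X hP z i j).norm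
  obtain ⟨K, hK⟩ := isCompact_Icc.exists_bound_of_continuousOn (hc.continuousOn (s := Icc a b))
  refine ODE_solution_unique_of_mem_Ioo (v := fun y w => (P.X y t z).mulVec w) (s := fun _ => univ)
    (K := K.toNNReal) (fun y hy => (LipschitzWith.of_dist_le_mul fun w w' => ?_).lipschitzOnWith)
    hx₀ (fun y _ => ⟨hasDerivAt_pi.2 (hφ y), trivial⟩)
    (fun y _ => ⟨hasDerivAt_pi.2 (hψ y), trivial⟩)
    h hx
  rw [dist_eq_norm, dist_eq_norm, ← Matrix.mulVec_sub]
  refine (norm_mulVec_le _ _).trans (mul_le_mul_of_nonneg_right ?_ (norm_nonneg _))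
  exact ((le_abs_self _).trans (hK y (Ioo_subset_Icc_self hy))).trans (Real.le_coe_toNNReal K)

theorem IsSol.smul {t : ℝ} {z : ℂ} {φ : ℝ → Fin 4 → ℂ} (hφ : P.IsSol t z φ) (c : ℂ) :
    P.IsSol t z fun x => c • φ x := fun x i => by
  rw [Matrix.mulVec_smul]
  exact (hφ x i).const_mul c

theorem IsSol.zero (P : Potential) (t : ℝ) (z : ℂ) : P.IsSol t z fun _ => 0 := fun x i => by
  rw [Matrix.mulVec_zero]
  exact hasDerivAt_const _ _

/-- By uniqueness for the initial value problem, a proportionality at a single point persists with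
the same factor, so norming constants do not depend on `x`. -/
theorem IsSol.eq_smul {t : ℝ} (hP : P.IsAdmissibleAt t) {z : ℂ} {φ ψ : ℝ → Fin 4 → ℂ}
    (hφ : P.IsSol t z φ) (hψ : P.IsSol t z ψ) {c : ℂ} {x₀ : ℝ} (h : φ x₀ = c • ψ x₀) (x : ℝ) :
    φ x = c • ψ x :=
  congrFun (hφ.ext hP (hψ.smul c) h) x

section

variable {t : ℝ} (hP : P.IsAdmissibleAt t)

include hP

theorem isSol_jostCol_zero {z : ℂ} (hz : z ∈ P.dom upper) : P.IsSol t z (P.jostCol t z 0) :=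
  isSol_jostCol hP (ne_zero_of_mem_dom_upper hz) (gam_ne_zero_of_mem_dom_upper hz)
    (re_mu_sub_mu_zero hz)

theorem isSol_jostColP_zero {z : ℂ} (hz : z ∈ P.dom lower) : P.IsSol t z (P.jostColP t z 0) := by
  have h := (isSol_jostCol_zero hP.refl (z := -z) (neg_mem_dom_upper hz)).refl
  rw [refl_refl, neg_neg] at h
  exact h

/-- A zero at one point would make the column vanish identically, against the limit 1 of its
normalized first component at `-∞`. -/
theorem jostCol_ne_zero {z : ℂ} (hz : z ∈ P.dom upper) (x : ℝ) : P.jostCol t z 0 x ≠ 0 := by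
  intro h
  have h1 := (isSol_jostCol_zero hP hz).ext hP (IsSol.zero P t z) h
  have h2 := tendsto_jostCol hP (re_mu_sub_mu_zero hz) 0
  rw [h1] at h2
  have h3 : E P.qm z 0 0 = 1 := by rw [E_eq]; rfl
  rw [h3] at h2
  simp only [Pi.zero_apply, mul_zero] at h2
  exact zero_ne_one (tendsto_nhds_unique tendsto_const_nhds h2)

theorem jostColP_ne_zero {z : ℂ} (hz : z ∈ P.dom lower) (x : ℝ) : P.jostColP t z 0 x ≠ 0 :=
  jostCol_ne_zero hP.refl (neg_mem_dom_upper hz) (-x)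

/-- The covector `φ_{+,1}(conj z)† J` solves the adjoint equation. Contracting it with the tensor
cancels the action of `X` on the contracted index and leaves the action on the free one. -/
theorem isSol_chiP {z : ℂ} (hz : z ∈ P.dom upper) {a : Fin 4} (ha : a = 1 ∨ a = 2) :
    P.IsSol t z fun x => P.chiP t a x z := by
  have hv := isSol_jostColP_zero hP (conj_mem_dom_lower hz)
  have hX : ∀ x l j, conj (P.X x t (conj z) j l) * J j j = -(J l l * P.X x t z l j) := by
    intro x l j
    have h := congrFun (congrFun (X_conjTranspose_mul_J (P := P) x t z) l) j
    rw [J, Matrix.mul_diagonal, Matrix.neg_apply, Matrix.diagonal_mul] at h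
    rw [J, Matrix.diagonal_apply_eq, Matrix.diagonal_apply_eq]
    exact h
  intro x i
  have h1 : ∀ j, HasDerivAt (fun y => conj (P.jostColP t (conj z) 0 y j) * J j j)
      (-∑ l, conj (P.jostColP t (conj z) 0 x l) * J l l * P.X x t z l j) x := by
    intro j
    refine ((hv x j).star.mul_const (J j j)).congr_deriv ?_
    simp only [Matrix.mulVec, dotProduct, star_sum, Finset.sum_mul, ← Finset.sum_neg_distrib]
    refine Finset.sum_congr rfl fun l _ => ?_
    have := hX x l j
    simp only [← starRingEnd_apply, map_mul]
    linear_combination conj (P.jostColP t (conj z) 0 x l) * this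
  have h2 := HasDerivAt.fun_sum (u := Finset.univ) fun j _ =>
    (h1 j).mul (hasDerivAt_jostTensor hP hz ha x j i)
  refine (h2.const_mul (1 / P.gam z)).congr_deriv ?_
  simp only [chiP, Matrix.mulVec, dotProduct, Pi.smul_apply, smul_eq_mul, contr, Matrix.add_apply,
    Matrix.mul_apply, Matrix.transpose_apply, Fin.sum_univ_four]
  ring

theorem isSol_chiM {z : ℂ} (hz : z ∈ P.dom lower) {a : Fin 4} (ha : a = 1 ∨ a = 2) :
    P.IsSol t z fun x => P.chiM t a x z := by
  have h := (isSol_chiP hP.refl (z := -z) (neg_mem_dom_upper hz) ha).refl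
  rw [refl_refl, neg_neg] at h
  simpa only [chiP_refl] using h

end

/-! ### Decomposable tensors -/

/-- The hypothesis is `u ∧ W = 0`. If `u p ≠ 0`, the relation with first index `p` solves for `W` in
terms of its row `p`, so that row divided by `u p` is the other factor. -/
theorem exists_eq_wedge {u : Fin 4 → ℂ} (hu : u ≠ 0) {W : Matrix (Fin 4) (Fin 4) ℂ}
    (h : ∀ i j k, u i * W j k - u j * W i k + u k * W i j = 0) : ∃ w, W = wedge u w := by
  obtain ⟨p, hp⟩ := Function.ne_iff.1 hu
  change u p ≠ 0 at hp
  refine ⟨fun k => W p k / u p, ?_⟩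
  ext j k
  have h1 := h p j k
  rw [wedge_apply]
  field_simp
  linear_combination h1

/-- On the spectrum the tensor is a wedge containing the first column, and the relation is trivial;
it extends to the half plane by uniqueness of continuation. -/
theorem wedge_relation {t : ℝ} (hP : P.IsAdmissibleAt t) {z : ℂ} (hz : z ∈ upper) {a : Fin 4}
    (ha : a = 1 ∨ a = 2) (x : ℝ) (i j k : Fin 4) :
    P.jostCol t z 0 x i * P.jostTensor t z a x j k -
      P.jostCol t z 0 x j * P.jostTensor t z a x i k +
      P.jostCol t z 0 x k * P.jostTensor t z a x i j = 0 := by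
  have hu := Reg.jostCol_upper hP x
  have hW := Reg.jostTensor_upper hP ha x
  refine Reg.eq_zero_upper (P := P) ((((hu.apply i).mul (hW j k)).sub
    ((hu.apply j).mul (hW i k))).add
    ((hu.apply k).mul (hW i j))) (fun s hs => ?_) hz
  simp only [jostTensor_eq_wedge hP hs ha, wedge_apply]
  ring

theorem jostTensor_decomposable {t : ℝ} (hP : P.IsAdmissibleAt t) {z : ℂ} (hz : z ∈ upper)
    {a : Fin 4} (ha : a = 1 ∨ a = 2) (x : ℝ) :
    ∃ w, P.jostTensor t z a x = wedge (P.jostCol t z 0 x) w :=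
  exists_eq_wedge (jostCol_ne_zero hP (subset_dom _ hz) x) (wedge_relation hP hz ha x)

theorem jostTensorP_decomposable {t : ℝ} (hP : P.IsAdmissibleAt t) {z : ℂ} (hz : z ∈ lower)
    {a : Fin 4} (ha : a = 1 ∨ a = 2) (x : ℝ) :
    ∃ w, P.jostTensorP t z a x = wedge (P.jostColP t z 0 x) w :=
  jostTensor_decomposable hP.refl (by simpa using hz) ha (-x)

/-! ### Identities between the minors -/

section

variable {t : ℝ} (hP : P.IsAdmissibleAt t)

include hP

/-- By Jacobi's identity `A_{[1,3]}` is the minor `[2,4]` of the inverse. Inversion moves index 4 to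
1, and the adjoint symmetry turns the minor `[1,2]` of the inverse into the conjugate of
`A_{[1,2]}`. -/
theorem minorTwo_two {z : ℂ} (hz : z ∈ upper) :
    P.minorTwo t 2 z = P.rho * conj (P.minorTwo t 1 ((P.qo : ℂ) ^ 2 / conj z)) := by
  have hq := hP.qo_pos.ne'
  refine Reg.eq_of_eq_spec_upper (Reg.minorTwo_upper hP (.inr rfl)) ((Reg.const P.rho).mul
    ((Reg.minorTwo_upper hP (.inl rfl)).comp_inv_upper hq).conj_conj_lower) (fun s hs => ?_) hz
  have hs' := inv_mem_spec hq hs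
  have h0 : (s : ℂ) ≠ 0 := Complex.ofReal_ne_zero.2 hs.1
  obtain ⟨B, hB⟩ := exists_scattering hP hs
  obtain ⟨B', hB'⟩ := exists_scattering hP hs'
  have h1 := minorTwo_ofReal hP hs' (.inl rfl)
  push_cast at h1
  obtain ⟨f1, f2, f3, f4⟩ := swap_entries (qp_ne_zero hP) h0 (swap_mul_inv hP hs hB hB')
  obtain ⟨-, -, -, -, -, -, m⟩ := minor2_eq_complement hB.mul_inv hB.det
  have hcm := conj_ne_zero (qm_ne_zero hP)
  have hcp := conj_ne_zero (qp_ne_zero hP)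
  rw [Complex.conj_ofReal, h1, ← minor2_inv hP hs' hB' (.inl rfl), minorTwo_ofReal hP hs (.inr rfl),
    ← m, minor2, minor2, f1, f2 1 (.inl rfl), f4 1 1 (.inl rfl) (.inl rfl), ← f3 1 (.inl rfl), rho]
  field_simp

theorem minorTwo_one {z : ℂ} (hz : z ∈ upper) :
    P.minorTwo t 1 z = P.rho * conj (P.minorTwo t 2 ((P.qo : ℂ) ^ 2 / conj z)) := by
  have hq : (P.qo : ℂ) ≠ 0 := Complex.ofReal_ne_zero.2 hP.qo_pos.ne'
  have hz0 : z ≠ 0 := ne_zero_of_mem_dom_upper (P := P) (subset_dom _ hz)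
  have h := minorTwo_two hP (z := (P.qo : ℂ) ^ 2 / conj z)
    (inv_mem_upper hP.qo_pos.ne' (by simpa using hz))
  have e : (P.qo : ℂ) ^ 2 / conj ((P.qo : ℂ) ^ 2 / conj z) = z := by
    simp only [map_div₀, map_pow, Complex.conj_ofReal, Complex.conj_conj]
    field_simp
  rw [h, e, map_mul, Complex.conj_conj, conj_rho hP, mul_inv_cancel_left₀ (rho_ne_zero hP)]

variable (hm : P.NonprincipalMinorsVanish t)

include hm

/-- Sylvester's identity in which the vanishing of `A_{[12;13]}` removes the mixed product. -/
theorem minorTwo_mul_minorTwo {z : ℂ} (hz : z ∈ upper) :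
    P.minorTwo t 1 z * P.minorTwo t 2 z = P.minorOne t z * P.A123 t z := by
  rw [A123_eq hP hz]
  refine Reg.eq_of_eq_spec_upper (P := P) (F := fun z => P.minorTwo t 1 z * P.minorTwo t 2 z)
    (G := fun z => P.minorOne t z * conj (P.rho⁻¹ * P.minorOne t ((P.qo : ℂ) ^ 2 / conj z)))
    ((Reg.minorTwo_upper hP (.inl rfl)).mul (Reg.minorTwo_upper hP (.inr rfl)))
    ((Reg.minorOne_upper hP).mul (Reg.minorOne_inv_lower hP).conj_conj_lower) (fun s hs => ?_) hz
  obtain ⟨B, hB⟩ := exists_scattering hP hs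
  have h := minor2_mul_minor2 (P.scat t s)
  have h1 := (hm s hs).1
  rw [minor_eq_minor2] at h1
  rw [minorTwo_ofReal hP hs (.inl rfl), minorTwo_ofReal hP hs (.inr rfl), A123_spec hP s hs,
    minorOne_ofReal hP hs, minor, ← h, h1, zero_mul, sub_zero]

/-- In the columns of `φ₊`, `chiP` has as coefficients the minors of `A` with rows `0, i` and
columns `0, a`. The coefficient of column 0 is trivially zero and that of the other middle column is
a vanishing non-principal minor. Both sides thus lie in the span of columns `a` and 3; the
coefficients of column 3 agree by the last row of `B A = 1`. -/
theorem minorOne_smul_chiP {z : ℂ} (hz : z ∈ upper) {a : Fin 4} (ha : a = 1 ∨ a = 2) (x : ℝ) :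
    conj (P.minorOne t (conj ((P.qo : ℂ) ^ 2 / z))) • P.chiP t a x z =
      P.minorTwo t a z • P.chiM t a x ((P.qo : ℂ) ^ 2 / z) := by
  have hq := hP.qo_pos.ne'
  refine Reg.eq_of_eq_spec_upper (P := P)
    (F := fun z => conj (P.minorOne t (conj ((P.qo : ℂ) ^ 2 / z))) • P.chiP t a x z)
    (G := fun z => P.minorTwo t a z • P.chiM t a x ((P.qo : ℂ) ^ 2 / z))
    (Reg.smul ((Reg.minorOne_upper hP).conj_conj_upper.comp_inv_lower hq) (Reg.chiP_upper hP ha x))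
    (Reg.smul (Reg.minorTwo_upper hP ha) ((Reg.chiM_lower hP ha x).comp_inv_lower hq))
    (fun s hs => ?_) hz
  have hs' := inv_mem_spec hq hs
  have h0 : (s : ℂ) ≠ 0 := Complex.ofReal_ne_zero.2 hs.1
  obtain ⟨B, hB⟩ := exists_scattering hP hs
  obtain ⟨B', hB'⟩ := exists_scattering hP hs'
  have h := chiM_ofReal hP hs' hB' ha x
  obtain ⟨e1, e2⟩ := jostColP_inv hP hs x
  obtain ⟨f1, f2, -⟩ := swap_entries (qp_ne_zero hP) h0 (swap_mul_inv hP hs hB hB')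
  have hcm := conj_ne_zero (qm_ne_zero hP)
  have hcp := conj_ne_zero (qp_ne_zero hP)
  have h1 : P.chiM t a x ((P.qo : ℂ) ^ 2 / s) =
      P.rho⁻¹ • (B 3 3 • P.jostColP t s a x - B 3 a • P.jostColP t s 3 x) := by
    rw [e1 a ha, f1, f2 a ha] at h
    push_cast at h
    push_cast at e2
    rw [h, e2]
    simp only [smul_sub, smul_smul, rho]
    congr 2 <;> field_simp
  have h2 : conj (P.minorOne t (conj ((P.qo : ℂ) ^ 2 / s))) = P.rho⁻¹ * B 3 3 := by
    have e := minorOne_ofReal hP hs'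
    push_cast at e
    rw [map_div₀, map_pow, Complex.conj_ofReal, Complex.conj_ofReal, e, ← inv_zero_zero hs' hB',
      f1, rho, inv_div]
  have hr : ∀ j, j ≠ 3 → B 3 0 * P.scat t s 0 j + B 3 1 * P.scat t s 1 j + B 3 2 * P.scat t s 2 j +
      B 3 3 * P.scat t s 3 j = 0 := by
    intro j hj
    have e := congrFun (congrFun hB.inv_mul 3) j
    rwa [Matrix.mul_apply, Fin.sum_univ_four, Matrix.one_apply_ne hj.symm] at e
  have r0 := hr 0 (by decide)
  obtain ⟨m1, m2, -⟩ := hm s hs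
  rw [minor_eq_minor2, minor2] at m1 m2
  rw [h2, h1, chiP_ofReal hP hs ha, minorTwo_ofReal hP hs ha, jostCol_eq_sum hP hs hB x a,
    jostCol_eq_sum hP hs hB x 0]
  funext i
  rcases ha with rfl | rfl
  · have r1 := hr 1 (by decide)
    simp only [minor2, Pi.smul_apply, Pi.sub_apply, Pi.add_apply, smul_eq_mul]
    linear_combination P.rho⁻¹ * (B 3 3 * P.jostColP t s 2 x i * m2 + P.jostColP t s 3 x i *
      (P.scat t s 0 0 * r1 - P.scat t s 0 1 * r0 - B 3 2 * m2))
  · have r1 := hr 2 (by decide)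
    simp only [minor2, Pi.smul_apply, Pi.sub_apply, Pi.add_apply, smul_eq_mul]
    linear_combination P.rho⁻¹ * (B 3 3 * P.jostColP t s 1 x i * m1 + P.jostColP t s 3 x i *
      (P.scat t s 0 0 * r1 - P.scat t s 0 2 * r0 - B 3 1 * m1))

end

/-! ### Derivatives -/

theorem hasDerivAt_comp_div {V : Type} [NormedAddCommGroup V] [NormedSpace ℂ V] {F : ℂ → V}
    {c w : ℂ} (hw : w ≠ 0) (hF : DifferentiableAt ℂ F (c / w)) :
    HasDerivAt (fun w => F (c / w)) ((-c / w ^ 2) • deriv F (c / w)) w := by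
  have h : HasDerivAt (fun w : ℂ => c / w) (-c / w ^ 2) w :=
    ((hasDerivAt_const w c).fun_div (hasDerivAt_id' w) hw).congr_deriv (by simp)
  exact hF.hasDerivAt.scomp w h

theorem hasDerivAt_conj_conj {F : ℂ → ℂ} {w : ℂ} (hF : DifferentiableAt ℂ F (conj w)) :
    HasDerivAt (fun w => conj (F (conj w))) (conj (deriv F (conj w))) w := by
  simpa [Function.comp_def] using hF.hasDerivAt.conj_conj

theorem conj_hat (z : ℂ) : conj (P.hat z) = (P.qo : ℂ) ^ 2 / z := by
  rw [hat, map_div₀, map_pow, Complex.conj_ofReal, Complex.conj_conj]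

theorem inv_inv_eq (hq : P.qo ≠ 0) (z : ℂ) : (P.qo : ℂ) ^ 2 / ((P.qo : ℂ) ^ 2 / z) = z :=
  div_div_cancel₀ (pow_ne_zero 2 (Complex.ofReal_ne_zero.2 hq))

theorem hat_mem_upper (hq : P.qo ≠ 0) {z : ℂ} (hz : z ∈ upper) : P.hat z ∈ upper :=
  inv_mem_upper hq (by simpa using hz)

theorem conj_mem_lower {z : ℂ} (hz : z ∈ upper) : conj z ∈ lower := by simpa using hz

section

variable {t : ℝ} (hP : P.IsAdmissibleAt t)

include hP

theorem minorTwo_eq {a b : Fin 4} (hab : a = 1 ∧ b = 2 ∨ a = 2 ∧ b = 1) {z : ℂ} (hz : z ∈ upper) :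
    P.minorTwo t b z = P.rho * conj (P.minorTwo t a (P.hat z)) := by
  rcases hab with ⟨rfl, rfl⟩ | ⟨rfl, rfl⟩
  · exact minorTwo_two hP hz
  · exact minorTwo_one hP hz

theorem deriv_minorTwo_eq {a b : Fin 4} (hab : a = 1 ∧ b = 2 ∨ a = 2 ∧ b = 1) {z : ℂ}
    (hz : z ∈ upper) : deriv (P.minorTwo t b) z =
      P.rho * conj (-(P.qo : ℂ) ^ 2 / conj z ^ 2 * deriv (P.minorTwo t a) (P.hat z)) := by
  have ha : a = 1 ∨ a = 2 := hab.imp And.left And.left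
  have hz0 : conj z ≠ 0 := conj_ne_zero (ne_zero_of_mem_dom_upper (P := P) (subset_dom _ hz))
  have h1 := hasDerivAt_comp_div (c := (P.qo : ℂ) ^ 2) hz0
    ((Reg.minorTwo_upper hP ha).differentiableAt_upper (hat_mem_upper hP.qo_pos.ne' hz))
  have h2 := (hasDerivAt_conj_conj h1.differentiableAt).const_mul P.rho
  rw [h1.deriv] at h2
  refine HasDerivAt.deriv (h2.congr_of_eventuallyEq ?_)
  filter_upwards [isOpen_upper.mem_nhds hz] with w hw
  exact minorTwo_eq hP hab hw

theorem hasDerivAt_minorOne {z : ℂ} (hz : z ∈ upper) :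
    HasDerivAt (P.minorOne t) (deriv (P.minorOne t) z) z :=
  ((Reg.minorOne_upper hP).differentiableAt_upper hz).hasDerivAt

theorem deriv_A4_conj_hat {z : ℂ} (hz : z ∈ upper) : deriv (P.A4 t) (conj (P.hat z)) =
    P.rho⁻¹ * (-(P.qo : ℂ) ^ 2 / ((P.qo : ℂ) ^ 2 / z) ^ 2 * deriv (P.minorOne t) z) := by
  have hq := hP.qo_pos.ne'
  have hl := inv_mem_lower hq hz
  rw [conj_hat, deriv_A4_eq hP hl]
  have h := hasDerivAt_comp_div (c := (P.qo : ℂ) ^ 2) (w := (P.qo : ℂ) ^ 2 / z)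
    (F := P.minorOne t) (ne_zero_of_mem_dom_lower (P := P) (subset_dom _ hl))
    (by rw [inv_inv_eq hq]; exact (hasDerivAt_minorOne hP hz).differentiableAt)
  rw [inv_inv_eq hq] at h
  exact (h.const_mul _).deriv

theorem deriv_A234_conj {z : ℂ} (hz : z ∈ upper) :
    deriv (P.A234 t) (conj z) = conj (deriv (P.minorOne t) z) := by
  rw [deriv_A234_eq hP (conj_mem_lower hz)]
  have h := hasDerivAt_conj_conj (F := P.minorOne t) (w := conj z)
    (by rw [Complex.conj_conj]; exact (hasDerivAt_minorOne hP hz).differentiableAt)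
  rw [Complex.conj_conj] at h
  exact h.deriv

theorem deriv_A34_conj {z : ℂ} (hz : z ∈ upper) :
    deriv (P.A34 t) (conj z) = conj (deriv (P.minorTwo t 1) z) := by
  rw [deriv_A34_eq hP (conj_mem_lower hz)]
  have h := hasDerivAt_conj_conj (F := P.minorTwo t 1) (w := conj z)
    (by
      rw [Complex.conj_conj]
      exact (Reg.minorTwo_upper hP (.inl rfl)).differentiableAt_upper hz)
  rw [Complex.conj_conj] at h
  exact h.deriv

theorem hasDerivAt_minorOne_conj_inv {z : ℂ} (hz : z ∈ upper) :
    HasDerivAt (fun w => conj (P.minorOne t (conj ((P.qo : ℂ) ^ 2 / w))))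
      (-(P.qo : ℂ) ^ 2 / P.hat z ^ 2 * conj (deriv (P.minorOne t) z)) (P.hat z) := by
  have hq := hP.qo_pos.ne'
  have h := hasDerivAt_conj_conj (F := P.minorOne t) (w := conj z)
    (by rw [Complex.conj_conj]; exact (hasDerivAt_minorOne hP hz).differentiableAt)
  rw [Complex.conj_conj] at h
  have e : (P.qo : ℂ) ^ 2 / P.hat z = conj z := inv_inv_eq hq _
  have h1 := hasDerivAt_comp_div (c := (P.qo : ℂ) ^ 2) (w := P.hat z)
    (F := fun w => conj (P.minorOne t (conj w)))
    (ne_zero_of_mem_dom_upper (P := P) (subset_dom _ (hat_mem_upper hq hz)))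
    (by rw [e]; exact h.differentiableAt)
  rw [e, h.deriv] at h1
  exact h1

theorem A123_eq_rho {z : ℂ} (hz : z ∈ upper) :
    P.A123 t z = P.rho * conj (P.minorOne t (conj ((P.qo : ℂ) ^ 2 / z))) := by
  rw [A123_eq hP hz, map_mul, map_inv₀, conj_rho hP, inv_inv, map_div₀, map_pow,
    Complex.conj_ofReal]

theorem deriv_A123_hat {z : ℂ} (hz : z ∈ upper) : deriv (P.A123 t) (P.hat z) =
    P.rho * (-(P.qo : ℂ) ^ 2 / P.hat z ^ 2 * conj (deriv (P.minorOne t) z)) := by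
  refine HasDerivAt.deriv (((hasDerivAt_minorOne_conj_inv hP hz).const_mul
    P.rho).congr_of_eventuallyEq ?_)
  filter_upwards [isOpen_upper.mem_nhds (hat_mem_upper hP.qo_pos.ne' hz)] with w hw
  exact A123_eq_rho hP hw

/-! ### Proportionality of the eigenfunctions at a zero of the first minor -/

/-- Write the tensors as `u ∧ w` at `z` and `u' ∧ v` at `conj z`, with `u`, `u'` the first columns.
Since `⟨u', u⟩ = 0`, each contraction retains only a multiple of the first column, and `minorTwo`
equals `⟨u', w⟩ ⟨v, u⟩ / γ`. The two multiples therefore determine each other. -/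
theorem exists_proportional {z : ℂ} (hz : z ∈ upper) {a : Fin 4} (ha : a = 1 ∨ a = 2)
    (h0 : P.minorOne t z = 0) (h1 : P.minorTwo t a z ≠ 0) :
    ∃ κ : ℂ, κ ≠ 0 ∧ (∀ x, P.chiP t a x z = κ • P.jostCol t z 0 x) ∧
      ∀ x, P.chiM t a x (conj z) =
        (conj (P.minorTwo t a z / κ) / P.gam (conj z)) • P.jostColP t (conj z) 0 x := by
  have hz' := conj_mem_lower hz
  have hg : P.gam z ≠ 0 := gam_ne_zero_of_mem_dom_upper (subset_dom _ hz)
  obtain ⟨w, hw⟩ := jostTensor_decomposable hP hz ha 0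
  obtain ⟨v, hv⟩ := jostTensorP_decomposable hP hz' ha 0
  have e0 : pair (P.jostColP t (conj z) 0 0) (P.jostCol t z 0 0) = 0 := by
    rwa [minorOne, div_eq_zero_iff, or_iff_left hg] at h0
  have e1 : P.minorTwo t a z = pair (P.jostColP t (conj z) 0 0) w * pair v (P.jostCol t z 0 0) /
      P.gam z := by
    rw [minorTwo, hw, hv, pair2_wedge, e0, zero_mul, zero_sub, neg_neg]
  set κ := -(pair (P.jostColP t (conj z) 0 0) w / P.gam z) with hκ
  have e2 : P.minorTwo t a z = -κ * pair v (P.jostCol t z 0 0) := by rw [e1, hκ]; ring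
  have hκ0 : κ ≠ 0 := by
    intro h
    rw [h, neg_zero, zero_mul] at e2
    exact h1 e2
  refine ⟨κ, hκ0, fun x => ?_, fun x => ?_⟩
  · refine (isSol_chiP hP (subset_dom _ hz) ha).eq_smul hP
      (isSol_jostCol_zero hP (subset_dom _ hz)) (x₀ := 0) ?_ x
    rw [chiP, hw, contr_wedge, e0, zero_smul, zero_sub, smul_neg, smul_smul, ← neg_smul, hκ]
    congr 1
    ring
  · refine (isSol_chiM hP (subset_dom _ hz') ha).eq_smul hP
      (isSol_jostColP_zero hP (subset_dom _ hz')) (x₀ := 0) ?_ x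
    rw [chiM, Complex.conj_conj, hv, contr_wedge, ← conj_pair, e0, map_zero, zero_smul, zero_sub,
      smul_neg, smul_smul, ← neg_smul, e2, neg_mul, neg_div, mul_div_cancel_left₀ _ hκ0, map_neg,
      conj_pair]
    congr 1
    ring

variable (hm : P.NonprincipalMinorsVanish t)

include hm

/-- Differentiating `minorTwo a * minorTwo b = A_{[1]} A_{[1,2,3]}` at `z` leaves `minorTwo a *
(minorTwo b)' = A_{[1]}' A_{[1,2,3]}`, which is nonzero. -/
theorem deriv_minorTwo_ne_zero {a b : Fin 4} (hab : a = 1 ∧ b = 2 ∨ a = 2 ∧ b = 1) {z : ℂ}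
    (hz : z ∈ upper) (h0 : P.minorOne t z = 0) (h1 : deriv (P.minorOne t) z ≠ 0)
    (h2 : P.A123 t z ≠ 0) (hb : P.minorTwo t b z = 0) :
    P.minorTwo t a z ≠ 0 ∧ deriv (P.minorTwo t b) z ≠ 0 := by
  have ha' : a = 1 ∨ a = 2 := hab.imp And.left And.left
  have hb' : b = 1 ∨ b = 2 := by rcases hab with ⟨-, rfl⟩ | ⟨-, rfl⟩ <;> simp
  have d1 := ((Reg.minorTwo_upper hP ha').differentiableAt_upper hz).hasDerivAt.mul
    ((Reg.minorTwo_upper hP hb').differentiableAt_upper hz).hasDerivAt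
  have hr := (Reg.minorOne_inv_lower hP).conj_conj_lower
  have d2 := (hasDerivAt_minorOne hP hz).mul (hr.differentiableAt_upper hz).hasDerivAt
  have e : (P.minorTwo t a * P.minorTwo t b) =ᶠ[𝓝 z] (P.minorOne t *
      fun z => conj (P.rho⁻¹ * P.minorOne t ((P.qo : ℂ) ^ 2 / conj z))) := by
    filter_upwards [isOpen_upper.mem_nhds hz] with w hw
    have h := minorTwo_mul_minorTwo hP hm hw
    rw [A123_eq hP hw] at h
    rw [Pi.mul_apply, Pi.mul_apply, ← h]
    rcases hab with ⟨rfl, rfl⟩ | ⟨rfl, rfl⟩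
    · rfl
    · exact mul_comm _ _
  have h := (d1.congr_of_eventuallyEq e.symm).unique d2
  rw [hb, h0, mul_zero, zero_add, zero_mul, add_zero, ← A123_eq hP hz] at h
  exact ⟨fun h3 => mul_ne_zero h1 h2 (by rw [← h, h3, zero_mul]),
    fun h3 => mul_ne_zero h1 h2 (by rw [← h, h3, mul_zero])⟩

theorem chiM_inv {z : ℂ} (hz : z ∈ upper) {a : Fin 4} (ha : a = 1 ∨ a = 2)
    (h1 : P.minorTwo t a z ≠ 0) {κ : ℂ} {x : ℝ} (h : P.chiP t a x z = κ • P.jostCol t z 0 x) :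
    P.chiM t a x ((P.qo : ℂ) ^ 2 / z) =
      (conj (P.minorOne t (conj ((P.qo : ℂ) ^ 2 / z))) * κ / P.minorTwo t a z) •
        P.jostCol t z 0 x := by
  have h2 := minorOne_smul_chiP hP hm hz ha x
  rw [h, smul_smul] at h2
  rw [div_eq_inv_mul _ (P.minorTwo t a z), mul_smul, h2, smul_smul, inv_mul_cancel₀ h1, one_smul]

/-- At `ẑ` both scalar factors in `minorOne_smul_chiP` vanish, so the identity itself is empty
there; its derivative leaves each eigenfunction multiplied by the derivative of its factor. -/
theorem chiP_hat {z : ℂ} (hz : z ∈ upper) {a : Fin 4} (ha : a = 1 ∨ a = 2)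
    (h0 : P.minorOne t z = 0) (h1 : deriv (P.minorOne t) z ≠ 0)
    (h2 : P.minorTwo t a (P.hat z) = 0) {δ : ℂ} {x : ℝ}
    (h : P.chiM t a x (conj z) = δ • P.jostColP t (conj z) 0 x) :
    P.chiP t a x (P.hat z) = (deriv (P.minorTwo t a) (P.hat z) * δ /
      (-(P.qo : ℂ) ^ 2 / P.hat z ^ 2 * conj (deriv (P.minorOne t) z))) •
        P.jostColP t (conj z) 0 x := by
  have hq := hP.qo_pos.ne'
  have hz' := hat_mem_upper hq hz
  have e : (P.qo : ℂ) ^ 2 / P.hat z = conj z := inv_inv_eq hq _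
  have d1 := (hasDerivAt_minorOne_conj_inv hP hz).smul
    ((Reg.chiP_upper hP ha x).differentiableAt_upper hz').hasDerivAt
  have d2 := ((Reg.minorTwo_upper hP ha).differentiableAt_upper hz').hasDerivAt.smul
    (((Reg.chiM_lower hP ha x).comp_inv_lower hq).differentiableAt_upper hz').hasDerivAt
  have h3 := (d1.congr_of_eventuallyEq (Filter.EventuallyEq.symm (by
    filter_upwards [isOpen_upper.mem_nhds hz'] with w hw
    exact minorOne_smul_chiP hP hm hw ha x))).unique d2
  rw [e, Complex.conj_conj, h0, map_zero, zero_smul, h2, zero_smul, zero_add, zero_add, h] at h3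
  have hne : -(P.qo : ℂ) ^ 2 / P.hat z ^ 2 * conj (deriv (P.minorOne t) z) ≠ 0 :=
    mul_ne_zero (div_ne_zero (neg_ne_zero.2 (pow_ne_zero 2 (Complex.ofReal_ne_zero.2 hq)))
      (pow_ne_zero 2 (ne_zero_of_mem_dom_upper (P := P) (subset_dom _ hz')))) (conj_ne_zero h1)
  rw [div_eq_inv_mul, mul_smul, mul_smul, ← h3, smul_smul, inv_mul_cancel₀ hne, one_smul]

end

end Potential

/-! ### Norming constants and their symmetries -/

theorem norming_iff {V : Type} [NormedAddCommGroup V] [NormedSpace ℂ V] {u v : ℝ → V}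
    (hu : u 0 ≠ 0) (hv : v 0 ≠ 0) {f₁ g₁ f₂ g₂ f₃ g₃ f₄ g₄ : ℝ → V} {M κ δ α β η ε : ℂ}
    (hM : M ≠ 0) (hκ : κ ≠ 0) (hβ : β ≠ 0) (hε : ε ≠ 0)
    (hf₁ : ∀ x, f₁ x = u x) (hg₁ : ∀ x, g₁ x = κ • u x)
    (hf₂ : ∀ x, f₂ x = δ • v x) (hg₂ : ∀ x, g₂ x = v x)
    (hf₃ : ∀ x, f₃ x = α • u x) (hg₃ : ∀ x, g₃ x = β • u x)
    (hf₄ : ∀ x, f₄ x = η • v x) (hg₄ : ∀ x, g₄ x = ε • v x) (d : NormingConstants) :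
    (∀ x, f₁ x = (d.plain / M) • g₁ x ∧ f₂ x = d.bar • g₂ x ∧ f₃ x = d.check • g₃ x ∧
      f₄ x = d.hat • g₄ x) ↔ d = ⟨M / κ, δ, α / β, η / ε⟩ := by
  simp only [hf₁, hg₁, hf₂, hg₂, hf₃, hg₃, hf₄, hg₄, smul_smul]
  constructor
  · intro h
    obtain ⟨h1, h2, h3, h4⟩ := h 0
    rw [← one_smul ℂ (u 0), smul_smul, mul_one] at h1
    have e1 := smul_left_injective ℂ hu h1
    have e2 := smul_left_injective ℂ hv h2
    have e3 := smul_left_injective ℂ hu h3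
    have e4 := smul_left_injective ℂ hv h4
    obtain ⟨d1, d2, d3, d4⟩ := d
    simp only at e1 e2 e3 e4
    rw [NormingConstants.mk.injEq]
    refine ⟨?_, e2.symm, ?_, ?_⟩
    · field_simp at e1 ⊢
      exact e1.symm
    · rw [e3, mul_div_cancel_right₀ _ hβ]
    · rw [e4, mul_div_cancel_right₀ _ hε]
  · rintro rfl x
    refine ⟨?_, rfl, ?_, ?_⟩
    · rw [div_div_cancel_left' hM, inv_mul_cancel₀ hκ, one_smul]
    · rw [div_mul_cancel₀ _ hβ]
    · rw [div_mul_cancel₀ _ hε]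

namespace Potential

variable {P : Potential}

theorem lam_conj (z : ℂ) : P.lam (conj z) = conj (P.lam z) := by
  simp only [lam, map_div₀, map_sub, map_pow, Complex.conj_ofReal, map_ofNat]

theorem conj_phase (x t : ℝ) (z : ℂ) : conj (P.phase x t z) = P.phaseInv x t (conj z) := by
  rw [phase, phaseInv, ← Complex.exp_conj]
  simp only [theta1, theta2, lam_conj, k_conj, map_neg, map_mul, map_sub, map_add, map_pow,
    Complex.conj_I, Complex.conj_ofReal, map_ofNat]
  ring_nf

section

variable {t : ℝ} (hP : P.IsAdmissibleAt t)

include hP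

theorem check_relation {z : ℂ} (hz : z ≠ 0) {κ a : ℂ} (ha : a ≠ 0) :
    -(Complex.I * conj P.qm) / ((P.qo : ℂ) ^ 2 / z) * κ /
      (P.rho⁻¹ * (-(P.qo : ℂ) ^ 2 / ((P.qo : ℂ) ^ 2 / z) ^ 2 * a)) =
      Complex.I * conj P.qp / z * (κ / a) := by
  have hq : (P.qo : ℂ) ≠ 0 := Complex.ofReal_ne_zero.2 hP.qo_pos.ne'
  have h1 := conj_ne_zero (qm_ne_zero hP)
  have h2 := conj_ne_zero (qp_ne_zero hP)
  rw [rho]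
  field_simp

theorem hat_relation {z : ℂ} (hz : z ∈ upper) {κ a : ℂ} (ha : a ≠ 0) :
    conj κ / P.gam (conj z) / ((-(P.qo : ℂ) ^ 2 / P.hat z ^ 2 * conj a) *
      (-(Complex.I * conj P.qp) / P.hat z)) =
      Complex.I * P.qp / (conj z * P.gam (P.hat z)) * conj (κ / a) := by
  have hq : (P.qo : ℂ) ≠ 0 := Complex.ofReal_ne_zero.2 hP.qo_pos.ne'
  have h2 := conj_ne_zero (qp_ne_zero hP)
  have hz0 : conj z ≠ 0 := conj_ne_zero (ne_zero_of_mem_dom_upper (P := P) (subset_dom _ hz))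
  have hg : P.gam (conj z) ≠ 0 := gam_ne_zero_of_mem_dom_lower (subset_dom _ (conj_mem_lower hz))
  have ha' := conj_ne_zero ha
  have hI := Complex.I_ne_zero
  -- This converts the factor `γ(conj z)` from the barred relation into the `γ(ẑ)` of the claim; the
  -- modulus of `q₊` accounts for the remaining constants.
  have e1 : P.gam (P.hat z) = -(conj z ^ 2 / (P.qo : ℂ) ^ 2) * P.gam (conj z) := by
    rw [gam, gam, hat]
    field_simp
    ring
  have e2 := mul_conj_eq hP.norm_qp
  rw [e1, hat, map_div₀]
  field_simp
  rw [Complex.I_sq]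
  linear_combination -conj κ * e2

variable (hm : P.NonprincipalMinorsVanish t)

include hm

/-- Both eigenvalue types at once: `(a, b) = (1, 2)` for type I and `(2, 1)` for type IV. A zero of
minor `b` at `z` is a zero of minor `a` at `ẑ`, the setting of `chiP_hat`. -/
theorem exists_eigenvalue_data {a b : Fin 4} (hab : a = 1 ∧ b = 2 ∨ a = 2 ∧ b = 1) {z : ℂ}
    (hz : z ∈ upper) (h0 : P.minorOne t z = 0) (h1 : deriv (P.minorOne t) z ≠ 0)
    (h3 : P.A123 t z ≠ 0) (hb : P.minorTwo t b z = 0) :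
    P.minorTwo t a z ≠ 0 ∧ deriv (P.minorTwo t b) z ≠ 0 ∧
    deriv (P.minorTwo t a) (P.hat z) ≠ 0 ∧
    conj (P.minorOne t (conj ((P.qo : ℂ) ^ 2 / z))) ≠ 0 ∧
    ∃ κ : ℂ, κ ≠ 0 ∧ (∀ x, P.chiP t a x z = κ • P.jostCol t z 0 x) ∧
      (∀ x, P.chiM t a x (conj z) =
        (conj (P.minorTwo t a z / κ) / P.gam (conj z)) • P.jostColP t (conj z) 0 x) ∧
      (∀ x, P.chiM t a x ((P.qo : ℂ) ^ 2 / z) =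
        (conj (P.minorOne t (conj ((P.qo : ℂ) ^ 2 / z))) * κ / P.minorTwo t a z) •
          P.jostCol t z 0 x) ∧
      ∀ x, P.chiP t a x (P.hat z) = (deriv (P.minorTwo t a) (P.hat z) *
        (conj (P.minorTwo t a z / κ) / P.gam (conj z)) /
          (-(P.qo : ℂ) ^ 2 / P.hat z ^ 2 * conj (deriv (P.minorOne t) z))) •
            P.jostColP t (conj z) 0 x := by
  have ha : a = 1 ∨ a = 2 := hab.imp And.left And.left
  obtain ⟨h2, hd⟩ := deriv_minorTwo_ne_zero hP hm hab hz h0 h1 h3 hb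
  have hb' : P.minorTwo t a (P.hat z) = 0 := by
    rw [minorTwo_eq hP hab hz] at hb
    simpa [rho_ne_zero hP] using hb
  have hd' : deriv (P.minorTwo t a) (P.hat z) ≠ 0 := by
    intro e
    rw [deriv_minorTwo_eq hP hab hz, e] at hd
    simp at hd
  obtain ⟨κ, hκ, r1, r2⟩ := exists_proportional hP hz ha h0 h2
  rw [A123_eq_rho hP hz] at h3
  exact ⟨h2, hd, hd', right_ne_zero_of_mul h3, κ, hκ, r1, r2,
    fun x => chiM_inv hP hm hz ha h2 (r1 x), fun x => chiP_hat hP hm hz ha h0 h1 hb' (r2 x)⟩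

theorem exists_norming_typeI {z : ℂ} (h : P.IsTypeI t z) :
    ∃ d₀ : NormingConstants, (∀ d, P.IsNormingI t z d ↔ d = d₀) ∧
      d₀.bar / deriv (P.A234 t) (conj z) =
        conj (d₀.plain / deriv (P.A1 t) z) / P.gam (conj z) ∧
      d₀.check * P.A234 t (conj (P.hat z)) / deriv (P.A4 t) (conj (P.hat z)) =
        Complex.I * conj P.qp / z * (d₀.plain / deriv (P.A1 t) z) ∧
      d₀.hat / deriv (P.A12 t) (P.hat z) =
        Complex.I * P.qp / (conj z * P.gam (P.hat z)) * conj (d₀.plain / deriv (P.A1 t) z) := by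
  obtain ⟨hz, h0, h1, h2, h3⟩ := h
  have hq := hP.qo_pos.ne'
  change z ∈ upper at hz
  have hz0 : z ≠ 0 := ne_zero_of_mem_dom_upper (P := P) (subset_dom _ hz)
  have hl := conj_mem_lower hz
  have hu' := hat_mem_upper hq hz
  have hl' := inv_mem_lower hq hz
  rw [A1_eq hP hz] at h0
  rw [deriv_A1_eq hP hz] at h1
  rw [A12_eq hP hz] at h2
  -- `A_{[1]}` vanishes here and `A_{[1,2]}` does not, so the product identity forces `A_{[1,3]}` to
  -- vanish.
  have hb : P.minorTwo t 2 z = 0 := by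
    have e := minorTwo_mul_minorTwo hP hm hz
    rw [h0, zero_mul] at e
    exact (mul_eq_zero.1 e).resolve_left h2
  obtain ⟨-, -, hd', hm0, κ, hκ, r1, r2, r3, r4⟩ :=
    exists_eigenvalue_data hP hm (.inl ⟨rfl, rfl⟩) hz h0 h1 h3 hb
  have hh0 : P.hat z ≠ 0 := ne_zero_of_mem_dom_upper (P := P) (subset_dom _ hu')
  have hε : -(Complex.I * conj P.qp) / P.hat z ≠ 0 := div_ne_zero (neg_ne_zero.2 (mul_ne_zero
    Complex.I_ne_zero (conj_ne_zero (qp_ne_zero hP)))) hh0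
  have hβ := div_ne_zero (mul_ne_zero hm0 hκ) h2
  have r5 := fun x => phiP4_eq hP x hu'
  simp only [show (P.qo : ℂ) ^ 2 / P.hat z = conj z from inv_inv_eq hq _] at r5
  have r6 := fun x => phiM4_eq hP x hl'
  simp only [inv_inv_eq hq] at r6
  have key := norming_iff (jostCol_ne_zero hP (subset_dom _ hz) 0)
    (jostColP_ne_zero hP (subset_dom _ hl) 0) h2 hκ hβ hε (fun x => phiM1_eq hP x hz)
    (fun x => (chi2Up_eq hP x hz).trans (r1 x)) (fun x => (chi2Down_eq hP x hl).trans (r2 x))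
    (fun x => phiP1_eq hP x hl) r6 (fun x => (chi2Down_eq hP x hl').trans (r3 x))
    (fun x => (chi2Up_eq hP x hu').trans (r4 x)) r5
  have ha := deriv_A1_eq hP hz
  have hne : -(P.qo : ℂ) ^ 2 / P.hat z ^ 2 * conj (deriv (P.minorOne t) z) ≠ 0 :=
    mul_ne_zero (div_ne_zero (neg_ne_zero.2 (pow_ne_zero 2 (Complex.ofReal_ne_zero.2 hq)))
      (pow_ne_zero 2 hh0)) (conj_ne_zero h1)
  refine ⟨_, fun d => Iff.trans (by rw [IsNormingI, A12_eq hP hz, conj_hat]) (key d), ?_, ?_, ?_⟩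
  · simp only
    rw [deriv_A234_conj hP hz, ha, map_div₀ conj _ (deriv (P.minorOne t) z), div_right_comm]
  · simp only
    rw [deriv_A4_conj_hat hP hz, ha, ← check_relation hP hz0 h1, conj_hat, A234_eq hP hl']
    congr 1
    field_simp
  · simp only
    rw [deriv_A12_eq hP hu', ha, ← hat_relation hP hz h1]
    generalize -(P.qo : ℂ) ^ 2 / P.hat z ^ 2 * conj (deriv (P.minorOne t) z) = e at hne
    generalize -(Complex.I * conj P.qp) / P.hat z = e' at hε
    generalize conj (P.minorTwo t 1 z / κ) / P.gam (conj z) = e''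
    field_simp

theorem exists_norming_typeIV {z : ℂ} (h : P.IsTypeIV t z) :
    ∃ d₀ : NormingConstants, (∀ d, P.IsNormingIV t z d ↔ d = d₀) ∧
      d₀.bar / deriv (P.A34 t) (conj z) =
        conj (d₀.plain / deriv (P.A1 t) z) / P.gam (conj z) ∧
      d₀.check * P.A34 t (conj (P.hat z)) / deriv (P.A4 t) (conj (P.hat z)) =
        Complex.I * conj P.qp / z * (d₀.plain / deriv (P.A1 t) z) ∧
      d₀.hat / deriv (P.A123 t) (P.hat z) =
        Complex.I * P.qp / (conj z * P.gam (P.hat z)) * conj (d₀.plain / deriv (P.A1 t) z) := by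
  obtain ⟨hz, h0, h1, hb, h3⟩ := h
  have hq := hP.qo_pos.ne'
  change z ∈ upper at hz
  have hz0 : z ≠ 0 := ne_zero_of_mem_dom_upper (P := P) (subset_dom _ hz)
  have hl := conj_mem_lower hz
  have hu' := hat_mem_upper hq hz
  have hl' := inv_mem_lower hq hz
  rw [A1_eq hP hz] at h0
  rw [deriv_A1_eq hP hz] at h1
  rw [A12_eq hP hz] at hb
  obtain ⟨h2, hd, hd', hm0, κ, hκ, r1, r2, r3, r4⟩ :=
    exists_eigenvalue_data hP hm (.inr ⟨rfl, rfl⟩) hz h0 h1 h3 hb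
  have hρ := rho_ne_zero hP
  have hh0 : P.hat z ≠ 0 := ne_zero_of_mem_dom_upper (P := P) (subset_dom _ hu')
  have hε : -(Complex.I * conj P.qp) / P.hat z ≠ 0 := div_ne_zero (neg_ne_zero.2 (mul_ne_zero
    Complex.I_ne_zero (conj_ne_zero (qp_ne_zero hP)))) hh0
  have hβ := mul_ne_zero hρ (div_ne_zero (mul_ne_zero hm0 hκ) h2)
  have hhat : (P.qo : ℂ) ^ 2 / P.hat z = conj z := inv_inv_eq hq _
  have r5 := fun x => phiP4_eq hP x hu'
  simp only [hhat] at r5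
  have r6 := fun x => phiM4_eq hP x hl'
  simp only [inv_inv_eq hq] at r6
  have s1 : ∀ x, P.chi3Up x t z = _ • P.jostCol t z 0 x := fun x => by
    rw [chi3Up_eq hP x hz, r3, smul_smul]
  have s2 : ∀ x, P.chi3Down x t (conj z) = _ • P.jostColP t (conj z) 0 x := fun x => by
    rw [chi3Down_eq hP x hl, ← hat, r4, smul_smul]
  have s3 : ∀ x, P.chi3Down x t ((P.qo : ℂ) ^ 2 / z) = _ • P.jostCol t z 0 x := fun x => by
    rw [chi3Down_eq hP x hl', inv_inv_eq hq, r1, smul_smul]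
  have s4 : ∀ x, P.chi3Up x t (P.hat z) = _ • P.jostColP t (conj z) 0 x := fun x => by
    rw [chi3Up_eq hP x hu', hhat, r2, smul_smul]
  have key := norming_iff (jostCol_ne_zero hP (subset_dom _ hz) 0)
    (jostColP_ne_zero hP (subset_dom _ hl) 0) h3 hβ (mul_ne_zero (inv_ne_zero hρ) hκ) hε
    (fun x => phiM1_eq hP x hz) s1 s2 (fun x => phiP1_eq hP x hl) r6 s3 s4 r5
  have ha := deriv_A1_eq hP hz
  have hne : -(P.qo : ℂ) ^ 2 / P.hat z ^ 2 * conj (deriv (P.minorOne t) z) ≠ 0 :=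
    mul_ne_zero (div_ne_zero (neg_ne_zero.2 (pow_ne_zero 2 (Complex.ofReal_ne_zero.2 hq)))
      (pow_ne_zero 2 hh0)) (conj_ne_zero h1)
  -- The normalization by `A_{[1,2,3]}` cancels the factor contributed by `chiM_inv`, which brings
  -- the constant to the type I form `minorTwo / κ`.
  have hplain : P.A123 t z / (P.rho * (conj (P.minorOne t (conj ((P.qo : ℂ) ^ 2 / z))) * κ /
      P.minorTwo t 2 z)) = P.minorTwo t 2 z / κ := by
    rw [A123_eq_rho hP hz]
    field_simp
  refine ⟨_, fun d => Iff.trans (by rw [IsNormingIV, conj_hat]) (key d), ?_, ?_, ?_⟩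
  · simp only
    rw [hplain]
    -- Applied at `ẑ`, whose hat is `z`: this links the derivative of `minorTwo t 2` at `ẑ`, present
    -- in the constant, with that of `minorTwo t 1` at `z`, present in `A_{[3,4]}'`.
    have e := deriv_minorTwo_eq hP (a := 1) (b := 2) (.inl ⟨rfl, rfl⟩) hu'
    have e2 : P.hat (P.hat z) = z := by rw [hat, conj_hat, inv_inv_eq hq]
    rw [e2, map_mul, map_div₀, map_neg, map_pow, map_pow, Complex.conj_ofReal,
      Complex.conj_conj] at e
    rw [deriv_A34_conj hP hz, ha, map_div₀ conj _ (deriv (P.minorOne t) z), e]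
    have h5 := conj_ne_zero hd
    have h6 := conj_ne_zero h1
    have h7 := Complex.ofReal_ne_zero.2 hq
    field_simp
  · simp only
    rw [hplain, deriv_A4_conj_hat hP hz, ha, ← check_relation hP hz0 h1, conj_hat, A34_eq hP hl',
      ← conj_hat, Complex.conj_conj, minorTwo_two hP hz, ← hat]
    congr 1
    field_simp
  · simp only
    rw [hplain, deriv_A123_hat hP hz, ha, ← hat_relation hP hz h1]
    generalize -(P.qo : ℂ) ^ 2 / P.hat z ^ 2 * conj (deriv (P.minorOne t) z) = e at hne
    generalize -(Complex.I * conj P.qp) / P.hat z = e' at hε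
    generalize conj (P.minorTwo t 2 z / κ) / P.gam (conj z) = e''
    field_simp

end

end Potential

end VNLS

theorem lemmaL (P : VNLS.Potential) (t : ℝ) (hP : P.IsAdmissibleAt t)
    (hminors : P.NonprincipalMinorsVanish t) :
    (∀ z : ℂ, P.IsTypeI t z →
      (∃! d : VNLS.NormingConstants, P.IsNormingI t z d) ∧
      ∀ d : VNLS.NormingConstants, P.IsNormingI t z d → ∀ x : ℝ,
        P.DCheck z d x t = Complex.I * conj P.qp / z * P.D z d x t ∧
        P.DBar z d x t = conj (P.D z d x t) / P.gam (conj z) ∧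
        P.DHat z d x t =
          Complex.I * P.qp / (conj z * P.gam (P.hat z)) * conj (P.D z d x t)) ∧
    (∀ w : ℂ, P.IsTypeIV t w →
      (∃! c : VNLS.NormingConstants, P.IsNormingIV t w c) ∧
      ∀ c : VNLS.NormingConstants, P.IsNormingIV t w c → ∀ x : ℝ,
        P.CCheck w c x t = Complex.I * conj P.qp / w * P.C w c x t ∧
        P.CBar w c x t = conj (P.C w c x t) / P.gam (conj w) ∧
        P.CHat w c x t =
          Complex.I * P.qp / (conj w * P.gam (P.hat w)) * conj (P.C w c x t)) := by
  refine ⟨fun z hz => ?_, fun w hw => ?_⟩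
  · obtain ⟨d₀, h, hbar, hcheck, hhat⟩ := VNLS.Potential.exists_norming_typeI hP hminors hz
    refine ⟨⟨d₀, (h d₀).2 rfl, fun d hd => (h d).1 hd⟩, fun d hd x => ?_⟩
    -- Conjugation takes the phase at `z` to the inverse phase at `conj z`, so the relations between
    -- the constants carry over for every `x`.
    rw [(h d).1 hd, VNLS.Potential.DCheck, VNLS.Potential.DBar, VNLS.Potential.DHat,
      VNLS.Potential.D, hbar, hcheck, hhat, map_mul, VNLS.Potential.conj_phase]
    exact ⟨mul_assoc _ _ _, div_mul_eq_mul_div _ _ _, mul_assoc _ _ _⟩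
  · obtain ⟨c₀, h, hbar, hcheck, hhat⟩ := VNLS.Potential.exists_norming_typeIV hP hminors hw
    refine ⟨⟨c₀, (h c₀).2 rfl, fun c hc => (h c).1 hc⟩, fun c hc x => ?_⟩
    rw [(h c).1 hc, VNLS.Potential.CCheck, VNLS.Potential.CBar, VNLS.Potential.CHat,
      VNLS.Potential.C, hbar, hcheck, hhat, map_mul, VNLS.Potential.conj_phase]
    exact ⟨mul_assoc _ _ _, div_mul_eq_mul_div _ _ _, mul_assoc _ _ _⟩
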